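/- Let $d\ge 1$ and $m,n\ge 0$ be integers, $\mathcal A=\mathbb Z[v,v^{-1}]$, $q=v^2$. Let $W$ be the group of permutations $w$ of $\{-d,\dots,d\}$ with $w(-i)=-w(i)$ (product: composition of maps), with simple reflections $s_0=(-1,1)$, $s_i=(i,i+1)(-i,-i-1)$ for $1\le i<d$, and length function $\ell$. Let $\mathcal H$ be the Hecke algebra of $W$ over $\mathcal A$: it has basis $\{T_w\mid w\in W\}$, with $T_1=1$, $T_wT_{w'}=T_{ww'}$ if $\ell(ww')=\ell(w)+\ell(w')$, and $(T_{s_i}+1)(T_{s_i}-q)=0$ for $0\le i<d$. Let $\mathbb I=\{-m-n,\dots,m+n\}$; call $i\in\mathbb I$ even if $|i|\le m$ and odd otherwise. Let $\Lambda=\Lambda(m|n,d)$ be the set of $\lambda=(\lambda_0,\dots,\lambda_{m+n})\in\mathbb N^{m+n+1}$ with sum $d$, and put $\tilde\lambda_i=\lambda_0+\dots+\lambda_i$. Let $R^\lambda_0=\{-\lambda_0,\dots,\lambda_0\}$, $R^\lambda_i=\{\tilde\lambda_{i-1}+1,\dots,\tilde\lambda_i\}$ and $R^\lambda_{-i}=-R^\lambda_i$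 for $1\le i\le m+n$. For a weak composition $\delta$ of $d$ let $W_\delta$ be the subgroup of $W$ generated by the $s_k$ $(0\le k<d)$ with $k$ not a partial sum of $\delta$, and let $\mathcal D_\delta$ be the set of shortest representatives of the right cosets $W_\delta\backslash W$. For $\lambda\in\Lambda$ let $W_{\lambda^{(0)}}$, respectively $W_{\lambda^{(1)}}$, be generated by those of these $s_k$ (for $\delta=\lambda$) with $k<\tilde\lambda_m$, respectively $k>\tilde\lambda_m$; then $W_\lambda=W_{\lambda^{(0)}}\times W_{\lambda^{(1)}}$, and we write $w=w^{(0)}w^{(1)}$ accordingly. Put $$[xy]_\lambda=\Big(\sum_{w\in W_{\lambda^{(0)}}}T_w\Big)\Big(\sum_{w\in W_{\lambda^{(1)}}}(-q)^{-\ell(w)}T_w\Big),\qquad \mathcal S^{\jmath}_{m|n,d}=\mathrm{End}_{\mathcal H}\Big(\bigoplus_{\lambda\in\Lambda}[xy]_\lambda\mathcal H\Big),$$ the endomorphisms being those of right $\mathcal H$-modules. For $\mu,\nu\in\Lambda$ let $\mathcal D^\circ_{\mu\nu}$ be the set of shortest representatives $g$ of the double cosets $W_\mu\backslash W/W_\nu$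 with $g^{-1}W_{\mu^{(1)}}g\cap W_{\nu^{(0)}}=g^{-1}W_{\mu^{(0)}}g\cap W_{\nu^{(1)}}=\{1\}$. Let $\Xi_{m|n,d}$ be the set of matrices $A=(a_{ij})_{i,j\in\mathbb I}$ over $\mathbb N$ with $\sum_{i,j} a_{ij}=2d+1$, with $a_{-i,-j}=a_{ij}$ for all $i,j$, and with $a_{ij}\in\{0,1\}$ whenever $i$ and $j$ have different parity. Then $\kappa(\mu,g,\nu)=(|R^\mu_i\cap gR^\nu_j|)_{i,j\in\mathbb I}$ defines a bijection from the set of triples $(\mu,g,\nu)$ with $\mu,\nu\in\Lambda$ and $g\in\mathcal D^\circ_{\mu\nu}$ onto $\Xi_{m|n,d}$. For $A=\kappa(\mu,g,\nu)\in\Xi_{m|n,d}$ let $$\delta=\Big(\tfrac{a_{00}-1}2,a_{10},\dots,a_{m+n,0},a_{-m-n,1},\dots,a_{m+n,1},\dots,a_{-m-n,m+n},\dots,a_{m+n,m+n}\Big),$$ $$T_{W_\mu gW_\nu}=[xy]_\mu\,T_g\sum_{w=w^{(0)}w^{(1)}\in\mathcal D_\delta\cap W_\nu}(-q)^{-\ell(w^{(1)})}T_w,$$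 where $w^{(i)}\in W_{\nu^{(i)}}$, and let $e_A\in\mathcal S^{\jmath}_{m|n,d}$ be the (well defined) endomorphism that sends $[xy]_\nu h$ in the $\nu$-th summand to $T_{W_\mu gW_\nu}h\in[xy]_\mu\mathcal H$ in the $\mu$-th summand for all $h\in\mathcal H$, and vanishes on the summands with $\lambda\ne\nu$. **Lemma.** The elements $e_A$, $A\in\Xi_{m|n,d}$, form an $\mathcal A$-basis of $\mathcal S^{\jmath}_{m|n,d}$. In particular $$\mathrm{rank}(\mathcal S^{\jmath}_{m|n,d})=\sum_{k=0}^d\binom{2m^2+2n^2+2m+k}{k}\binom{4mn+2n}{d-k}.$$ -/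

import Mathlib

open scoped DirectSum

noncomputable section

namespace IotaSchur

/-! ### The Weyl group of type B -/

/-- The integral interval `[-k..k]`. For `k = d` this is the set on which the Weyl group acts, for
`k = m + n` it is the index set `𝕀` of the matrices. -/
abbrev Seg (k : ℕ) : Type := Set.Icc (-(k : ℤ)) (k : ℤ)

/-- The negation `x ↦ -x` of `[-k..k]`. -/
def neg {k : ℕ} (x : Seg k) : Seg k :=
  ⟨-x.1, by have := x.2.1; have := x.2.2; constructor <;> omega⟩

/-- The Weyl group of type `B_d`: the permutations `w` of `[-d..d]` with `w (-i) = - w i`.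
The product is composition of maps. -/
def W (d : ℕ) : Subgroup (Equiv.Perm (Seg d)) where
  carrier := {w | ∀ i, w (neg i) = neg (w i)}
  one_mem' := fun _ => rfl
  mul_mem' := by
    intro a b ha hb i
    simp only [Set.mem_ofPred_eq] at ha hb
    simp [Equiv.Perm.mul_apply, ha, hb]
  inv_mem' := by
    intro a ha i
    simp only [Set.mem_ofPred_eq] at ha
    rw [Equiv.Perm.inv_eq_iff_eq, ha]
    simp

instance (d : ℕ) : Fintype (W d) := Fintype.ofFinite _

/-- The element `i` of `[-d..d]`, for a natural number `i ≤ d`. -/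
def pt {d : ℕ} (i : ℕ) (h : i ≤ d) : Seg d := ⟨(i : ℤ), by constructor <;> omega⟩

/-- The simple reflections `s_0 = (-1, 1)` and `s_i = (i, i+1)(-i, -i-1)` for `1 ≤ i < d`. -/
def s {d : ℕ} (i : Fin d) : W d :=
  ⟨if i.1 = 0 then Equiv.swap (neg (pt (i.1 + 1) i.2)) (pt (i.1 + 1) i.2)
    else Equiv.swap (pt i.1 i.2.le) (pt (i.1 + 1) i.2) *
      Equiv.swap (neg (pt i.1 i.2.le)) (neg (pt (i.1 + 1) i.2)), by
    have key : ∀ (a b x : Seg d), neg (Equiv.swap a b x) = Equiv.swap (neg a) (neg b) (neg x) := by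
      intro a b x
      have hn : ∀ y z : Seg d, neg y = neg z ↔ y = z := by
        intro y z
        simp [neg, Subtype.ext_iff]
      simp only [Equiv.swap_apply_def, hn]
      split_ifs <;> rfl
    have nn : ∀ y : Seg d, neg (neg y) = y := fun y => by simp [neg]
    intro x
    split_ifs with h0
    · rw [key, nn, Equiv.swap_comm]
    · have hd : (Equiv.swap (pt i.1 i.2.le) (pt (i.1 + 1) i.2) *
          Equiv.swap (neg (pt i.1 i.2.le)) (neg (pt (i.1 + 1) i.2)) : Equiv.Perm (Seg d)) =
          Equiv.swap (neg (pt i.1 i.2.le)) (neg (pt (i.1 + 1) i.2)) *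
            Equiv.swap (pt i.1 i.2.le) (pt (i.1 + 1) i.2) := by
        apply Equiv.Perm.Disjoint.commute
        intro z
        by_cases hz : 0 < z.1
        · right
          apply Equiv.swap_apply_of_ne_of_ne <;> intro h <;>
            simp only [neg, pt, Subtype.ext_iff] at h <;> omega
        · left
          apply Equiv.swap_apply_of_ne_of_ne <;> intro h <;>
            simp only [pt, Subtype.ext_iff] at h <;> omega
      rw [Equiv.Perm.mul_apply, Equiv.Perm.mul_apply, key, key, nn, nn]
      exact (DFunLike.congr_fun hd (neg x))⟩

/-- The length of `w`: the least length of a word in the simple reflections that represents `w`. -/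
def len {d : ℕ} (w : W d) : ℕ :=
  sInf {k | ∃ l : List (Fin d), l.length = k ∧ (l.map s).prod = w}

/-! ### Compositions with parity and their parabolic subgroups -/

/-- `Λ(m|n, d)`: the weak compositions `(λ_0, …, λ_m | λ_{m+1}, …, λ_{m+n})` of `d`. -/
abbrev Comp (m n d : ℕ) : Type := {l : Fin (m + n + 1) → ℕ // ∑ i, l i = d}

/-- The partial sum of a family of parts, indexed by a finite linear order, up to the index `i`. -/
def psum {ι : Type} [Fintype ι] [LinearOrder ι] (l : ι → ℕ) (i : ι) : ℕ := ∑ j with j ≤ i, l j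

/-- The parabolic subgroup of a weak composition of `d` (with parts indexed by a finite linear
order): it is generated by the `s_k`, `0 ≤ k < d`, such that `k` is not a partial sum of the
composition. (The partial sum of all parts is `d`, so it excludes no `k`.) -/
def parabolic (d : ℕ) {ι : Type} [Fintype ι] [LinearOrder ι] (l : ι → ℕ) : Subgroup (W d) :=
  Subgroup.closure {w | ∃ k : Fin d, (∀ i, k.1 ≠ psum l i) ∧ w = s k}

variable {m n d : ℕ}

/-- `∑_{j ≤ k} λ_j` for a natural number `k`. -/
def partialSum (l : Comp m n d) (k : ℕ) : ℕ := ∑ j : Fin (m + n + 1) with j.1 ≤ k, l.1 j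

/-- `W_λ`. -/
def Wl (l : Comp m n d) : Subgroup (W d) := parabolic d l.1

/-- The even part of `W_λ`: generated by the generators of `W_λ` that move the blocks
`0, …, m`. -/
def Weven (l : Comp m n d) : Subgroup (W d) :=
  Subgroup.closure {w | ∃ k : Fin d, (∀ i, k.1 ≠ psum l.1 i) ∧ k.1 < partialSum l m ∧ w = s k}

/-- The odd part of `W_λ`: generated by the generators of `W_λ` that move the blocks
`m + 1, …, m + n`. -/
def Wodd (l : Comp m n d) : Subgroup (W d) :=
  Subgroup.closure {w | ∃ k : Fin d, (∀ i, k.1 ≠ psum l.1 i) ∧ partialSum l m < k.1 ∧ w = s k}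

/-- The integral intervals `R_i^λ ⊆ [-d..d]`, for `i ∈ 𝕀`. -/
def R (l : Comp m n d) (i : Seg (m + n)) : Finset (Seg d) :=
  Finset.univ.filter fun x =>
    if i.1 = 0 then -(partialSum l 0 : ℤ) ≤ x.1 ∧ x.1 ≤ partialSum l 0
    else if 0 < i.1 then
      (partialSum l (i.1.natAbs - 1) : ℤ) < x.1 ∧ x.1 ≤ partialSum l i.1.natAbs
    else (partialSum l (i.1.natAbs - 1) : ℤ) < -x.1 ∧ -x.1 ≤ partialSum l i.1.natAbs

/-- The shortest representatives of the right cosets `H \ W`. -/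
def minRight (H : Subgroup (W d)) : Set (W d) := {g | ∀ x ∈ H, len g ≤ len (x * g)}

/-- `𝒟_{λμ}`: the shortest representatives of the double cosets `W_λ \ W / W_μ`. -/
def minDouble (l μ : Comp m n d) : Set (W d) :=
  {g | ∀ x ∈ Wl l, ∀ y ∈ Wl μ, len g ≤ len (x * g * y)}

/-- `𝒟°_{λμ}`: the elements `g` of `𝒟_{λμ}` with the even-odd trivial intersection property
`g⁻¹ W_{λ^{(1)}} g ∩ W_{μ^{(0)}} = g⁻¹ W_{λ^{(0)}} g ∩ W_{μ^{(1)}} = {1}`. -/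
def minDoubleCirc (l μ : Comp m n d) : Set (W d) :=
  {g | g ∈ minDouble l μ ∧
    (∀ w ∈ Weven μ, g * w * g⁻¹ ∈ Wodd l → w = 1) ∧
    (∀ w ∈ Wodd μ, g * w * g⁻¹ ∈ Weven l → w = 1)}

/-! ### Matrices -/

/-- Square matrices over `ℕ` with rows and columns indexed by `𝕀 = [-m-n..m+n]`. -/
abbrev Mat (m n : ℕ) : Type := Matrix (Seg (m + n)) (Seg (m + n)) ℕ

/-- The parity of `i ∈ 𝕀`: even if `-m ≤ i ≤ m`, odd otherwise. -/
def parity (m : ℕ) {n : ℕ} (i : Seg (m + n)) : ZMod 2 := if |i.1| ≤ (m : ℤ) then 0 else 1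

/-- `Ξ_{m|n,d}`. -/
def Xi (m n d : ℕ) : Set (Mat m n) :=
  {A | ∑ i, ∑ j, A i j = 2 * d + 1 ∧ (∀ i j, A (neg i) (neg j) = A i j) ∧
    ∀ i j, parity m i ≠ parity m j → A i j = 0 ∨ A i j = 1}

/-- `κ(λ, g, μ) = (|R_i^λ ∩ g R_j^μ|)_{i,j ∈ 𝕀}`. -/
def kappa (l : Comp m n d) (g : W d) (μ : Comp m n d) : Mat m n :=
  fun i j => (R l i ∩ (R μ j).image (g : Equiv.Perm (Seg d))).card

/-- The element `0` of `𝕀`. -/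
def zeroIdx (k : ℕ) : Seg k := ⟨0, by constructor <;> omega⟩

/-- The index set of the composition `δ(A)`: the pairs `(j, i)`, ordered lexicographically, that
are at least `(0, 0)`, that is, `j = 0 ≤ i` or `0 < j`. -/
abbrev DeltaIdx (k : ℕ) : Type := {p : Seg k ×ₗ Seg k // toLex (zeroIdx k, zeroIdx k) ≤ p}

/-- The composition `δ(A) = ((a_{00} - 1)/2, a_{10}, …, a_{m+n,0}, a_{-m-n,1}, …, a_{m+n,1}, …,
a_{-m-n,m+n}, …, a_{m+n,m+n})`: the part with index `(j, i) ≠ (0, 0)` is `a_{ij}`. -/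
def delta (A : Mat m n) : DeltaIdx (m + n) → ℕ := fun p =>
  if ofLex p.1 = (zeroIdx (m + n), zeroIdx (m + n)) then
    (A (zeroIdx (m + n)) (zeroIdx (m + n)) - 1) / 2
  else A (ofLex p.1).2 (ofLex p.1).1

/-! ### The Hecke algebra -/

/-- `𝒜 = ℤ[v, v⁻¹]`. -/
abbrev LaurentA : Type := LaurentPolynomial ℤ

/-- The indeterminate `v`, as a unit of `ℤ[v, v⁻¹]`. -/
def v : LaurentAˣ where
  val := LaurentPolynomial.T 1
  inv := LaurentPolynomial.T (-1)
  val_inv := by rw [← LaurentPolynomial.T_add]; simp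
  inv_val := by rw [← LaurentPolynomial.T_add]; simp

/-- `q = v²`. -/
def q : LaurentAˣ := v ^ 2

/-- The defining relations of the Hecke algebra on the generators `T_w`, `w ∈ W`. -/
inductive HeckeRel (d : ℕ) : FreeAlgebra LaurentA (W d) → FreeAlgebra LaurentA (W d) → Prop
  | one : HeckeRel d (FreeAlgebra.ι LaurentA 1) 1
  | mul (w w' : W d) (h : len (w * w') = len w + len w') :
      HeckeRel d (FreeAlgebra.ι LaurentA w * FreeAlgebra.ι LaurentA w')
        (FreeAlgebra.ι LaurentA (w * w'))
  | quad (i : Fin d) :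
      HeckeRel d ((FreeAlgebra.ι LaurentA (s i) + 1) *
        (FreeAlgebra.ι LaurentA (s i) - algebraMap LaurentA _ (q : LaurentA))) 0

/-- The Hecke algebra `ℋ` of `W` over `ℤ[v, v⁻¹]` with parameter `q = v²`. -/
abbrev Hecke (d : ℕ) : Type := RingQuot (HeckeRel d)

/-- The element `T_w` of `ℋ`. -/
def T (w : W d) : Hecke d := RingQuot.mkAlgHom LaurentA (HeckeRel d) (FreeAlgebra.ι LaurentA w)

/-- `(-q)^{-k}`. -/
def negQPow (k : ℕ) : LaurentA := (((-q) ^ (-(k : ℤ)) : LaurentAˣ) : LaurentA)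

open Classical in
/-- `x_{λ^{(0)}}`. -/
def x (l : Comp m n d) : Hecke d := ∑ w : W d with w ∈ Weven l, T w

open Classical in
/-- `y_{λ^{(1)}}`. -/
def y (l : Comp m n d) : Hecke d := ∑ w : W d with w ∈ Wodd l, negQPow (len w) • T w

/-- `[xy]_λ`. -/
def xy (l : Comp m n d) : Hecke d := x l * y l

open Classical in
/-- `T_{𝒟_δ ∩ W_ν} = ∑ (-q)^{-ℓ(w₁)} T_w` for `δ = δ(κ(μ, g, ν))`, the sum over the
`w = w₀ w₁ ∈ 𝒟_δ ∩ W_ν` with `w₀` in the even and `w₁` in the odd part of `W_ν`. -/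
def TD (μ : Comp m n d) (g : W d) (ν : Comp m n d) : Hecke d :=
  ∑ p : W d × W d with p.1 ∈ Weven ν ∧ p.2 ∈ Wodd ν ∧
      p.1 * p.2 ∈ minRight (parabolic d (delta (kappa μ g ν))),
    negQPow (len p.2) • T (p.1 * p.2)

/-- `T_{W_μ g W_ν} = [xy]_μ T_g T_{𝒟_δ ∩ W_ν}`. -/
def TWgW (μ : Comp m n d) (g : W d) (ν : Comp m n d) : Hecke d := xy μ * T g * TD μ g ν

/-! ### The `ι`Schur superalgebra -/

/-- The right `ℋ`-module `[xy]_λ ℋ`, as a right ideal of `ℋ`. -/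
abbrev XYH (l : Comp m n d) : Submodule (Hecke d)ᵐᵒᵖ (Hecke d) :=
  Submodule.span (Hecke d)ᵐᵒᵖ {xy l}

theorem xy_mul_mem (l : Comp m n d) (h : Hecke d) : xy l * h ∈ XYH l :=
  Submodule.mem_span_singleton.2 ⟨MulOpposite.op h, rfl⟩

theorem TWgW_mul_mem (μ : Comp m n d) (g : W d) (ν : Comp m n d) (h : Hecke d) :
    TWgW μ g ν * h ∈ XYH μ := by
  rw [TWgW, mul_assoc, mul_assoc]
  exact xy_mul_mem μ _

/-- The right `ℋ`-module `⨁_λ [xy]_λ ℋ`. -/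
abbrev PermModule (m n d : ℕ) : Type := ⨁ l : Comp m n d, XYH l

/-- The `ι`Schur superalgebra `End_ℋ (⨁_λ [xy]_λ ℋ)` (its underlying algebra; the product is the
composition of maps). -/
abbrev SchurJ (m n d : ℕ) : Type := Module.End (Hecke d)ᵐᵒᵖ (PermModule m n d)

/-- The embedding of the summand `[xy]_λ ℋ` into `⨁_λ [xy]_λ ℋ`. -/
abbrev incl (l : Comp m n d) : XYH l →ₗ[(Hecke d)ᵐᵒᵖ] PermModule m n d :=
  DirectSum.lof (Hecke d)ᵐᵒᵖ (Comp m n d) (fun l => XYH l) l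

/-- `f` is the map `φ_{μν}^g`: it sends the element `[xy]_λ h` of the `λ`-th summand to
`δ_{νλ} T_{W_μ g W_ν} h`, taken in the `μ`-th summand. -/
def IsPhi (μ : Comp m n d) (g : W d) (ν : Comp m n d) (f : SchurJ m n d) : Prop :=
  ∀ (l : Comp m n d) (h : Hecke d),
    f (incl l ⟨xy l * h, xy_mul_mem l h⟩) =
      if ν = l then incl μ ⟨TWgW μ g ν * h, TWgW_mul_mem μ g ν h⟩ else 0

/-- `e_A = φ_{μν}^g` for `A = κ(μ, g, ν)` with `g ∈ 𝒟°_{μν}`. -/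
def e (A : Xi m n d) : SchurJ m n d :=
  Classical.epsilon fun f => ∃ (μ : Comp m n d) (g : W d) (ν : Comp m n d),
    g ∈ minDoubleCirc μ ν ∧ kappa μ g ν = A.1 ∧ IsPhi μ g ν f

end IotaSchur

end

noncomputable section

namespace IotaSchur

/-! ### Signed permutations -/

section SignedPerm

variable {d : ℕ}

/-! An endomorphism is determined by the components `z` in `[xy]_μ ℋ` of the images of the
generators `[xy]_ν`. On such a `z` the generators `T_{s_k}` of `W_μ` act from the left, and those of
`W_ν` from the right, by the scalar `q` (even `k`) or `-1` (odd `k`). In coordinates this is a sign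
rule: when `s_k` lengthens `w`, the coefficient is multiplied by `1` or by `-q⁻¹`. So `z` is
determined by its coefficients at the minimal double coset representatives `g`. If `g` violates the
trivial intersection property, some `u ≠ 1` is even in `W_ν` with `g u g⁻¹` odd in `W_μ`, or
conversely; computing the coefficient at `g u` from both sides gives `z_g = (-q)^{-k} z_g` with `k >
0`, hence `z_g = 0`. Only the coefficients at `g ∈ 𝒟°` remain (`eq_zero_of_signs`,
`eq_zero_of_coef`).

Conversely, `T_{W_μ g W_ν}` is supported on the double coset of `g`, with coefficient `(-q)^{-k}` at
`w`, where `k` is half the number of inversions of `w` inside an odd block on either side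
(`coef_TWgW`, `oddWeight`). This description is symmetric in the two sides, so the right sign rule
holds as well as the left one. An element with the right sign rule is a left multiple `a [xy]_ν`
(`exists_eq_mul_xy`), and left multiplication by `a` is the required endomorphism. The coefficients
of the `e_A` at the chosen representatives form an identity matrix (`coords_e`), which gives the
basis.

The group theory rests on three facts. The length is half a number of inversions (`card_inv`);
parabolic subgroups are stabilizers of monotone labellings (`mem_closure_iff_label`); shortest
representatives are the elements increasing on the fibres of the labelling. A monotone map on a
finite chain is determined by its fibre sizes, so `κ` separates double cosets; listing the cells of
a matrix by rows and by columns shows that `κ` is onto. That the `T_w` are independent comes from a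
regular representation, built from commuting left and right operators (`leftOp_rightOp`).

For the rank, central symmetry leaves one half of the matrix and the odd central entry free: a
multiset on `2m²+2n²+2m+1` positions and a subset of the `4mn+2n` positions of mixed parity. -/

@[simp] theorem neg_val {k : ℕ} (x : Seg k) : (neg x).1 = -x.1 := rfl

@[simp] theorem neg_neg' {k : ℕ} (x : Seg k) : neg (neg x) = x := by
  apply Subtype.ext; simp

theorem neg_inj {k : ℕ} {x y : Seg k} : neg x = neg y ↔ x = y :=
  ⟨fun h => by rw [← neg_neg' x, h, neg_neg'], fun h => by rw [h]⟩

theorem neg_lt_neg {k : ℕ} {x y : Seg k} : neg x < neg y ↔ y < x := by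
  simp only [← Subtype.coe_lt_coe, neg_val]; omega

theorem neg_le_neg' {k : ℕ} {x y : Seg k} : neg x ≤ neg y ↔ y ≤ x := by
  simp only [← Subtype.coe_le_coe, neg_val]; omega

theorem neg_eq_self {k : ℕ} {x : Seg k} : neg x = x ↔ x.1 = 0 := by
  simp only [Subtype.ext_iff, neg_val]; omega

theorem W_neg (w : W d) (x : Seg d) : w.1 (neg x) = neg (w.1 x) := w.2 x

@[simp] theorem W_mul_apply (w u : W d) (x : Seg d) : (w * u).1 x = w.1 (u.1 x) := rfl

@[simp] theorem W_one_apply (x : Seg d) : (1 : W d).1 x = x := rfl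

@[simp] theorem W_inv_apply_self (w : W d) (x : Seg d) : (w⁻¹).1 (w.1 x) = x :=
  Equiv.symm_apply_apply w.1 x

@[simp] theorem W_apply_inv_self (w : W d) (x : Seg d) : w.1 ((w⁻¹).1 x) = x :=
  Equiv.apply_symm_apply w.1 x

theorem W_ext {w u : W d} (h : ∀ x, w.1 x = u.1 x) : w = u :=
  Subtype.ext (Equiv.ext h)

theorem W_inj (w : W d) {x y : Seg d} : w.1 x = w.1 y ↔ x = y := w.1.injective.eq_iff

theorem W_zero (w : W d) {x : Seg d} (h : x.1 = 0) : (w.1 x).1 = 0 := by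
  have h1 := W_neg w x
  rw [neg_eq_self.2 h] at h1
  exact neg_eq_self.1 h1.symm

/-- The lower point `k` moved by the reflection `s k`. -/
def lo (k : Fin d) : Seg d := pt k.1 k.2.le

/-- The upper point `k + 1` moved by the reflection `s k`. -/
def hi (k : Fin d) : Seg d := pt (k.1 + 1) k.2

@[simp] theorem lo_val (k : Fin d) : (lo k).1 = (k.1 : ℤ) := rfl

@[simp] theorem hi_val (k : Fin d) : (hi k).1 = (k.1 : ℤ) + 1 := by simp [hi, pt]

theorem lo_lt_hi (k : Fin d) : lo k < hi k := by
  rw [← Subtype.coe_lt_coe]; simp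

theorem s_val (k : Fin d) (x : Seg d) : ((s k).1 x).1 =
    if x.1 = (k.1 : ℤ) + 1 then (if k.1 = 0 then -1 else (k.1 : ℤ))
    else if x.1 = -((k.1 : ℤ) + 1) then (if k.1 = 0 then 1 else -(k.1 : ℤ))
    else if k.1 = 0 then x.1
    else if x.1 = k.1 then (k.1 : ℤ) + 1
    else if x.1 = -(k.1 : ℤ) then -((k.1 : ℤ) + 1) else x.1 := by
  rcases x with ⟨x, hx⟩
  by_cases h0 : k.1 = 0
  · simp only [s, h0, if_true, Equiv.swap_apply_def, Subtype.ext_iff, neg, pt]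
    push_cast
    split_ifs <;> simp_all
  · simp only [s, h0, if_false, Equiv.swap_apply_def, Equiv.Perm.mul_apply, Subtype.ext_iff, neg, pt]
    push_cast
    split_ifs <;> simp_all <;> omega

theorem s_mul_self (k : Fin d) : s k * s k = 1 := by
  apply W_ext
  intro x
  apply Subtype.ext
  rw [W_mul_apply, s_val, s_val, W_one_apply]
  split_ifs <;> omega

theorem s_inv (k : Fin d) : (s k)⁻¹ = s k := inv_eq_of_mul_eq_one_left (s_mul_self k)

@[simp] theorem mul_s_s (w : W d) (k : Fin d) : w * s k * s k = w := by
  rw [mul_assoc, s_mul_self, mul_one]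

@[simp] theorem s_s_mul (w : W d) (k : Fin d) : s k * (s k * w) = w := by
  rw [← mul_assoc, s_mul_self, one_mul]

theorem s_lo {k : Fin d} (h : k.1 ≠ 0) : (s k).1 (lo k) = hi k := by
  apply Subtype.ext; rw [s_val]; simp; split_ifs <;> omega

theorem s_hi {k : Fin d} (h : k.1 ≠ 0) : (s k).1 (hi k) = lo k := by
  apply Subtype.ext; rw [s_val]; simp; omega

/-- `s k` moves only points of the two adjacent pairs. -/
theorem s_apply_cases (k : Fin d) (x : Seg d) :
    (s k).1 x = x ∨ (x = lo k ∧ (s k).1 x = hi k) ∨ (x = hi k ∧ (s k).1 x = lo k) ∨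
    (x = neg (lo k) ∧ (s k).1 x = neg (hi k)) ∨ (x = neg (hi k) ∧ (s k).1 x = neg (lo k)) ∨
    (k.1 = 0 ∧ x = hi k ∧ (s k).1 x = neg (hi k)) ∨
    (k.1 = 0 ∧ x = neg (hi k) ∧ (s k).1 x = hi k) := by
  simp only [Subtype.ext_iff, s_val, neg_val, lo_val, hi_val]
  split_ifs <;> omega

/-! ### Inversions -/

/-- The inversions of a signed permutation, not counting the pairs `(-b, b)`: every reflection
that shortens `w` is counted twice. -/
def inv (w : W d) : Finset (Seg d × Seg d) :=
  Finset.univ.filter fun p => p.1 < p.2 ∧ w.1 p.2 < w.1 p.1 ∧ neg p.1 ≠ p.2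

theorem mem_inv {w : W d} {p : Seg d × Seg d} :
    p ∈ inv w ↔ p.1 < p.2 ∧ w.1 p.2 < w.1 p.1 ∧ neg p.1 ≠ p.2 := by simp [inv]

/-- Excluding the pairs `(-b, b)` makes the count uniform: `s 0` also reverses `(-1, 1)`, which
would give three inversions in place of two. -/
theorem inv_s (k : Fin d) : inv (s k) = {(lo k, hi k), (neg (hi k), neg (lo k))} := by
  ext ⟨⟨a, ha⟩, ⟨b, hb⟩⟩
  simp only [mem_inv, Finset.mem_insert, Finset.mem_singleton, Prod.ext_iff, Subtype.ext_iff,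
    ← Subtype.coe_lt_coe, s_val, neg_val, lo_val, hi_val, ne_eq]
  split_ifs <;> omega

theorem inv_s_ne (k : Fin d) : (lo k, hi k) ≠ (neg (hi k), neg (lo k)) := by
  simp only [ne_eq, Prod.ext_iff, Subtype.ext_iff, neg_val, lo_val, hi_val]
  omega

theorem inv_one : inv (1 : W d) = ∅ := by
  ext p
  simp only [mem_inv, W_one_apply, Finset.notMem_empty, iff_false]
  rintro ⟨h1, h2, -⟩
  exact lt_asymm h1 h2

/-- If the inversions of `u` stay inversions of `w u`, the inversions of `w u` are those of `u` and
the pullbacks of those of `w`. -/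
theorem card_inv_mul_filter (w u : W d) (h : ∀ p ∈ inv u, w.1 (u.1 p.2) < w.1 (u.1 p.1))
    (Q : Seg d × Seg d → Prop) [DecidablePred Q] :
    ((inv (w * u)).filter Q).card = ((inv u).filter Q).card +
      ((inv w).filter fun p => Q ((u⁻¹).1 p.1, (u⁻¹).1 p.2)).card := by
  classical
  have e : (inv (w * u)).filter Q = (inv u).filter Q ∪
      ((inv w).filter fun p => Q ((u⁻¹).1 p.1, (u⁻¹).1 p.2)).image
        (fun p => ((u⁻¹).1 p.1, (u⁻¹).1 p.2)) := by
    ext ⟨a, b⟩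
    simp only [Finset.mem_filter, Finset.mem_union, Finset.mem_image, mem_inv, W_mul_apply]
    constructor
    · rintro ⟨⟨h1, h2, h3⟩, hQ⟩
      by_cases hu : u.1 b < u.1 a
      · exact Or.inl ⟨⟨h1, hu, h3⟩, hQ⟩
      · refine Or.inr ⟨(u.1 a, u.1 b), ⟨⟨lt_of_le_of_ne (not_lt.1 hu) ?_, h2, ?_⟩, by simpa using hQ⟩,
          by simp⟩
        · exact fun hh => h1.ne ((W_inj u).1 hh)
        · simpa [← W_neg, W_inj] using h3
    · rintro (⟨⟨h1, h2, h3⟩, hQ⟩ | ⟨⟨x, y⟩, ⟨⟨h1, h2, h3⟩, hQ⟩, hp⟩)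
      · exact ⟨⟨h1, h (a, b) (mem_inv.2 ⟨h1, h2, h3⟩), h3⟩, hQ⟩
      · obtain ⟨rfl, rfl⟩ := Prod.ext_iff.1 hp
        simp only [W_apply_inv_self] at *
        refine ⟨⟨?_, h2, by rw [← W_neg, ne_eq, W_inj]; exact h3⟩, hQ⟩
        by_contra hc
        have hlt : (u⁻¹).1 y < (u⁻¹).1 x :=
          lt_of_le_of_ne (not_lt.1 hc) fun hh => h1.ne' ((W_inj _).1 hh)
        have := h ((u⁻¹).1 y, (u⁻¹).1 x) (mem_inv.2 ⟨hlt, by simpa using h1, ?_⟩)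
        · simp only [W_apply_inv_self] at this
          exact lt_asymm this h2
        · intro hh
          rw [← W_neg, W_inj] at hh
          exact h3 (by rw [← hh, neg_neg'])
  rw [e, Finset.card_union_of_disjoint, Finset.card_image_of_injective]
  · rintro ⟨a, b⟩ ⟨a', b'⟩ hh
    simpa [Prod.ext_iff, W_inj] using hh
  · rw [Finset.disjoint_left]
    rintro p hp hp'
    simp only [Finset.mem_filter, Finset.mem_image, mem_inv] at hp hp'
    obtain ⟨⟨x, y⟩, ⟨⟨h1, -⟩, -⟩, rfl⟩ := hp'
    have := hp.1.2.1
    simp only [W_apply_inv_self] at this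
    exact lt_asymm this h1

theorem card_inv_mul (w u : W d) (h : ∀ p ∈ inv u, w.1 (u.1 p.2) < w.1 (u.1 p.1)) :
    (inv (w * u)).card = (inv u).card + (inv w).card := by
  simpa using card_inv_mul_filter w u h fun _ => True

/-- `s k` lengthens `w` on the right. -/
def Up (w : W d) (k : Fin d) : Prop := w.1 (lo k) < w.1 (hi k)

theorem not_up {w : W d} {k : Fin d} : ¬ Up w k ↔ w.1 (hi k) < w.1 (lo k) := by
  rw [Up, not_lt, le_iff_lt_or_eq, or_iff_left]
  exact fun h => (lo_lt_hi k).ne' ((W_inj w).1 h)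

theorem up_mul_s {w : W d} {k : Fin d} : Up (w * s k) k ↔ ¬ Up w k := by
  rw [not_up, Up, W_mul_apply, W_mul_apply]
  -- The reflection `s 0` does not exchange `lo k` and `hi k`: it fixes `0` and negates `1`, so the
  -- order flips by the sign of `w 1`.
  by_cases h : k.1 = 0
  · have h1 : (s k).1 (lo k) = lo k := by
      apply Subtype.ext; rw [s_val]; simp [h]
    have h2 : (s k).1 (hi k) = neg (hi k) := by
      apply Subtype.ext; rw [s_val]; simp [h]
    have h3 : (w.1 (lo k)).1 = 0 := W_zero w (by simp [h])
    rw [h1, h2, W_neg, ← Subtype.coe_lt_coe, ← Subtype.coe_lt_coe, h3, neg_val]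
    omega
  · rw [s_lo h, s_hi h]

theorem up_inv_pairs {w : W d} {k : Fin d} (h : ¬ Up w k) :
    ∀ p ∈ inv (s k), w.1 p.2 < w.1 p.1 := by
  rw [inv_s]
  rw [not_up] at h
  intro p hp
  simp only [Finset.mem_insert, Finset.mem_singleton] at hp
  rcases hp with rfl | rfl
  · exact h
  · simpa [W_neg, neg_lt_neg] using h

theorem up_pairs {w : W d} {k : Fin d} (h : Up w k) :
    ∀ p ∈ inv (s k), w.1 ((s k).1 p.2) < w.1 ((s k).1 p.1) := fun p hp => by
  rw [← not_not (a := Up w k), ← up_mul_s] at h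
  exact up_inv_pairs h p hp

theorem card_inv_mul_s {w : W d} {k : Fin d} (h : Up w k) :
    (inv (w * s k)).card = (inv w).card + 2 := by
  rw [card_inv_mul w (s k) (up_pairs h), inv_s, Finset.card_pair (inv_s_ne k), add_comm]

theorem card_inv_mul_s' {w : W d} {k : Fin d} (h : ¬ Up w k) :
    (inv (w * s k)).card + 2 = (inv w).card := by
  rw [← card_inv_mul_s (up_mul_s.2 h), mul_s_s]

/-- A signed permutation that satisfies `w k < w (k+1)` for all `k ≥ 0` with `f k = f (k+1)` is
increasing on the fibres of the monotone map `f`. -/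
theorem lt_of_up {α : Type*} [LinearOrder α] {f : Seg d → α} (hf : Monotone f)
    (hn : ∀ x y, f x = f y → f (neg x) = f (neg y)) {w : W d}
    (h : ∀ k, f (lo k) = f (hi k) → Up w k) {x y : Seg d} (hxy : x < y) (e : f x = f y) :
    w.1 x < w.1 y := by
  -- Induction on the number `t` of points strictly between; monotonicity puts them all in the same
  -- fibre.
  obtain ⟨t, ht⟩ : ∃ t : ℕ, y.1 = x.1 + t + 1 := ⟨(y.1 - x.1 - 1).toNat, by
    have : x.1 < y.1 := hxy
    omega⟩
  clear hxy
  have step : ∀ x y : Seg d, y.1 = x.1 + 1 → f x = f y → w.1 x < w.1 y := by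
    intro x y hy e
    by_cases h0 : 0 ≤ x.1
    · have hk : x.1.toNat < d := by have := y.2.2; omega
      have hx : x = lo ⟨x.1.toNat, hk⟩ := by apply Subtype.ext; simp [h0]
      have hy : y = hi ⟨x.1.toNat, hk⟩ := by apply Subtype.ext; simp [h0, hy]
      rw [hx, hy]
      apply h
      rw [← hx, ← hy, e]
    -- An adjacent pair left of `0` is the negative of a pair `lo k`, `hi k`.
    · have hk : (-y.1).toNat < d := by have := x.2.1; omega
      have hy' : neg y = lo ⟨(-y.1).toNat, hk⟩ := by apply Subtype.ext; simp; omega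
      have hx : neg x = hi ⟨(-y.1).toNat, hk⟩ := by apply Subtype.ext; simp; omega
      rw [← neg_lt_neg, ← W_neg, ← W_neg, hx, hy']
      apply h
      rw [← hx, ← hy', hn _ _ e]
  induction t generalizing y with
  | zero => exact step x y (by simpa using ht) e
  | succ t ih =>
    have hz : y.1 - 1 ∈ Set.Icc (-(d : ℤ)) d := by
      have h1 := x.2.1; have h2 := y.2.2
      push_cast at ht
      constructor <;> omega
    have hzy : (⟨y.1 - 1, hz⟩ : Seg d) ≤ y := by
      rw [← Subtype.coe_le_coe]; simp
    have hxz : x ≤ (⟨y.1 - 1, hz⟩ : Seg d) := by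
      rw [← Subtype.coe_le_coe]; push_cast at ht; simp only; omega
    have e1 : f x = f ⟨y.1 - 1, hz⟩ := le_antisymm (hf hxz) (by rw [e]; exact hf hzy)
    exact (ih e1 (by push_cast at ht; simp only; omega)).trans
      (step _ y (by simp) (by rw [← e1, e]))

/-! ### Length as half the number of inversions -/

theorem eq_one_of_up {w : W d} (h : ∀ k, Up w k) : w = 1 := by
  -- With a constant labelling the whole interval is one fibre; a finite chain has no automorphism
  -- but the identity.
  have hm : StrictMono w.1 := fun x y hxy =>
    lt_of_up (f := fun _ => (0 : ℕ)) monotone_const (fun _ _ _ => rfl) (fun k _ => h k) hxy rfl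
  have : (hm.orderIsoOfSurjective _ w.1.surjective) = OrderIso.refl _ := Subsingleton.elim _ _
  exact W_ext fun x => DFunLike.congr_fun this x

theorem exists_not_up {w : W d} (h : w ≠ 1) : ∃ k, ¬ Up w k := by
  by_contra! hc
  exact h (eq_one_of_up hc)

/-- Cancelling a descent on the right removes exactly two inversions, so sorting `w` yields a word
half as long as its number of inversions. -/
theorem exists_word (w : W d) : ∃ l : List (Fin d), 2 * l.length = (inv w).card ∧
    (l.map s).prod = w := by
  induction hN : (inv w).card using Nat.strong_induction_on generalizing w with
  | _ N ih =>
    by_cases hw : w = 1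
    · exact ⟨[], by rw [← hN, hw, inv_one]; rfl, by simp [hw]⟩
    · obtain ⟨k, hk⟩ := exists_not_up hw
      have hc := card_inv_mul_s' hk
      obtain ⟨l, h1, h2⟩ := ih _ (by omega) (w * s k) rfl
      exact ⟨l ++ [k], by simp; omega, by simp [h2]⟩

theorem card_inv_le_word (l : List (Fin d)) : (inv (l.map s).prod).card ≤ 2 * l.length := by
  induction l using List.reverseRecOn with
  | nil => simp [inv_one]
  | append_singleton l k ih =>
    simp only [List.map_append, List.map_cons, List.map_nil, List.prod_append, List.prod_cons,
      List.prod_nil, mul_one, List.length_append, List.length_cons, List.length_nil]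
    by_cases h : Up (l.map s).prod k
    · rw [card_inv_mul_s h]; omega
    · have := card_inv_mul_s' h; omega

/-- Sorting gives a word of this length, and no word is shorter because each letter creates at most
two inversions. -/
theorem card_inv (w : W d) : (inv w).card = 2 * len w := by
  obtain ⟨l, h1, h2⟩ := exists_word w
  apply le_antisymm
  · obtain ⟨l', h1', h2'⟩ := Nat.sInf_mem (s := {k | ∃ l : List (Fin d), l.length = k ∧
      (l.map s).prod = w}) ⟨_, l, rfl, h2⟩
    rw [← h2', len, h2', ← h1']
    have := card_inv_le_word l'
    rwa [h2'] at this
  · rw [← h1]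
    exact Nat.mul_le_mul_left 2 (Nat.sInf_le ⟨l, rfl, h2⟩)

theorem len_one : len (1 : W d) = 0 := by
  have := card_inv (1 : W d)
  rw [inv_one] at this
  simpa using this.symm

theorem len_mul_s {w : W d} {k : Fin d} (h : Up w k) : len (w * s k) = len w + 1 := by
  have := card_inv_mul_s h
  rw [card_inv, card_inv] at this; omega

theorem len_mul_s' {w : W d} {k : Fin d} (h : ¬ Up w k) : len (w * s k) + 1 = len w := by
  have := card_inv_mul_s' h
  rw [card_inv, card_inv] at this; omega

theorem len_inv (w : W d) : len w⁻¹ = len w := by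
  suffices h : ∀ w : W d, len w⁻¹ ≤ len w from le_antisymm (h w) (by simpa using h w⁻¹)
  intro w
  obtain ⟨l, h1, h2⟩ := exists_word w
  rw [card_inv] at h1
  have hl : l.length = len w := by omega
  rw [← hl]
  refine Nat.sInf_le ⟨l.reverse, by simp, ?_⟩
  rw [← h2, List.prod_inv_reverse, List.map_map, List.map_reverse]
  congr 1
  simp [Function.comp_def, s_inv]

theorem len_s (k : Fin d) : len (s k) = 1 := by
  have := card_inv (s k)
  rw [inv_s, Finset.card_pair (inv_s_ne k)] at this; omega

theorem eq_one_of_len {w : W d} (h : len w = 0) : w = 1 := by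
  by_contra hw
  obtain ⟨k, hk⟩ := exists_not_up hw
  have := len_mul_s' hk
  omega

theorem len_mul {w u : W d} (h : ∀ p ∈ inv u, w.1 (u.1 p.2) < w.1 (u.1 p.1)) :
    len (w * u) = len w + len u := by
  have := card_inv_mul w u h
  simp only [card_inv] at this; omega

theorem s_mul_eq_inv (k : Fin d) (w : W d) : s k * w = (w⁻¹ * s k)⁻¹ := by
  rw [mul_inv_rev, inv_inv, s_inv]

theorem len_s_mul {w : W d} {k : Fin d} (h : Up w⁻¹ k) : len (s k * w) = len w + 1 := by
  rw [s_mul_eq_inv, len_inv, len_mul_s h, len_inv]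

theorem len_s_mul' {w : W d} {k : Fin d} (h : ¬ Up w⁻¹ k) : len (s k * w) + 1 = len w := by
  rw [s_mul_eq_inv, len_inv, len_mul_s' h, len_inv]

theorem up_inv_s_mul {w : W d} {k : Fin d} : Up (s k * w)⁻¹ k ↔ ¬ Up w⁻¹ k := by
  rw [s_mul_eq_inv, inv_inv, up_mul_s]

/-- Induction over words, appending on the right a reflection that lengthens. -/
theorem induction_up {P : W d → Prop} (one : P 1) (step : ∀ w k, Up w k → P w → P (w * s k))
    (w : W d) : P w := by
  induction hN : len w using Nat.strong_induction_on generalizing w with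
  | _ N ih =>
    by_cases hw : w = 1
    · rwa [hw]
    · obtain ⟨k, hk⟩ := exists_not_up hw
      have := step (w * s k) k (up_mul_s.2 hk) (ih _ (by have := len_mul_s' hk; omega) _ rfl)
      rwa [mul_s_s] at this

/-! ### Parabolic subgroups as stabilizers of monotone labellings -/

theorem label_inv {α : Type*} {f : Seg d → α} {w : W d} (hw : ∀ x, f (w.1 x) = f x) (x : Seg d) :
    f ((w⁻¹).1 x) = f x := by
  rw [← hw, W_apply_inv_self]

theorem label_s {α : Type*} {f : Seg d → α} (hn : ∀ x y, f x = f y → f (neg x) = f (neg y)) {k : Fin d}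
    (hk : f (lo k) = f (hi k)) (x : Seg d) : f ((s k).1 x) = f x := by
  have hk' := hn _ _ hk
  rcases s_apply_cases k x with h | ⟨h1, h2⟩ | ⟨h1, h2⟩ | ⟨h1, h2⟩ | ⟨h1, h2⟩ | ⟨h0, h1, h2⟩ |
      ⟨h0, h1, h2⟩
  · rw [h]
  · rw [h2, h1, hk]
  · rw [h2, h1, hk]
  · rw [h2, h1, hk']
  · rw [h2, h1, hk']
  -- For `k = 0` the point `lo k` is its own negative, so `hi k` and `neg (hi k)` both carry its
  -- label.
  all_goals
    have : neg (lo k) = lo k := neg_eq_self.2 (by simp [h0])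
    rw [h2, h1, ← hk', this, hk]

section Label

variable {α : Type*} [LinearOrder α] {f : Seg d → α}

theorem label_lt (hf : Monotone f) {x y : Seg d} (h : f x < f y) : x < y := by
  by_contra hc
  exact absurd (hf (not_lt.1 hc)) (not_le.2 h)

/-- The inversions of a signed permutation that preserves `f` lie in the fibres of `f`. -/
theorem label_eq_of_inv (hf : Monotone f) {w : W d} (hw : ∀ x, f (w.1 x) = f x)
    {x y : Seg d} (h : x < y) (h' : w.1 y < w.1 x) : f x = f y := by
  refine (hf h.le).eq_of_not_lt fun hc => ?_
  rw [← hw x, ← hw y] at hc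
  exact lt_asymm (label_lt hf hc) h'

/-- A descent of a stabilizing `w ≠ 1` joins two points of one fibre, so it belongs to a generator
that can be split off to shorten `w`. Used with `blk` for `W_λ`, with `refine` for its even and odd
parts, and with `entry` for the parabolic subgroup of `δ`. -/
theorem mem_closure_iff_label (hf : Monotone f) (hn : ∀ x y, f x = f y → f (neg x) = f (neg y))
    {S : Set (W d)} (hS : S = {w | ∃ k, f (lo k) = f (hi k) ∧ w = s k}) (w : W d) :
    w ∈ Subgroup.closure S ↔ ∀ x, f (w.1 x) = f x := by
  subst hS
  constructor
  · intro h
    induction h using Subgroup.closure_induction with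
    | mem w h => obtain ⟨k, hk, rfl⟩ := h; exact label_s hn hk
    | one => simp
    | mul a b _ _ ha hb => intro x; rw [W_mul_apply, ha, hb]
    | inv a _ ha => exact label_inv ha
  · induction hN : len w using Nat.strong_induction_on generalizing w with
    | _ N ih =>
      intro h
      by_cases hw : w = 1
      · rw [hw]; exact one_mem _
      · obtain ⟨k, hk⟩ := exists_not_up hw
        have hl := label_eq_of_inv hf h (lo_lt_hi k) (not_up.1 hk)
        have := ih _ (by have := len_mul_s' hk; omega) (w * s k) rfl
          fun x => by rw [W_mul_apply, h, label_s hn hl]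
        have hm := mul_mem this (Subgroup.subset_closure
          (show s k ∈ {w | ∃ k, f (lo k) = f (hi k) ∧ w = s k} from ⟨k, hl, rfl⟩))
        rwa [mul_s_s] at hm

/-- `g` is increasing on the fibres of `f`. -/
def IncrOn (f : Seg d → α) (g : W d) : Prop := ∀ x y, x < y → f x = f y → g.1 x < g.1 y

theorem incrOn_iff (hf : Monotone f) (hn : ∀ x y, f x = f y → f (neg x) = f (neg y)) {g : W d} :
    IncrOn f g ↔ ∀ k, f (lo k) = f (hi k) → Up g k :=
  ⟨fun h k hk => h _ _ (lo_lt_hi k) hk, fun h _ _ hxy e => lt_of_up hf hn h hxy e⟩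

/-- The inversions of `w` lie in fibres, `w` preserves the fibres, and `g` keeps the order inside
each fibre; so `g` undoes none of them and lengths add. -/
theorem IncrOn.mul_inv_lt (hf : Monotone f) {g w : W d} (hg : IncrOn f g)
    (hw : ∀ x, f (w.1 x) = f x) : ∀ p ∈ inv w, g.1 (w.1 p.2) < g.1 (w.1 p.1) := by
  intro p hp
  obtain ⟨h1, h2, -⟩ := mem_inv.1 hp
  exact hg _ _ h2 (by rw [hw, hw, label_eq_of_inv hf hw h1 h2])

theorem IncrOn.len_mul (hf : Monotone f) {g w : W d} (hg : IncrOn f g)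
    (hw : ∀ x, f (w.1 x) = f x) : len (g * w) = len g + len w :=
  IotaSchur.len_mul (hg.mul_inv_lt hf hw)

theorem IncrOn.len_mul_inv (hf : Monotone f) {g w : W d} (hg : IncrOn f g⁻¹)
    (hw : ∀ x, f (w.1 x) = f x) : len (w * g) = len w + len g := by
  rw [← len_inv, mul_inv_rev, hg.len_mul hf (label_inv hw), len_inv, len_inv, add_comm]

/-- A descent of `g⁻¹` inside a fibre gives a shorter element `s k * g` of the coset; without such
descents lengths add along `H g`. -/
theorem mem_minRight_iff (hf : Monotone f) (hn : ∀ x y, f x = f y → f (neg x) = f (neg y))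
    {H : Subgroup (W d)} (hH : ∀ w, w ∈ H ↔ ∀ x, f (w.1 x) = f x) (g : W d) :
    g ∈ minRight H ↔ IncrOn f g⁻¹ := by
  constructor
  · intro h
    refine (incrOn_iff hf hn).2 fun k hk => ?_
    by_contra hu
    have h1 := len_s_mul' hu
    have h2 := h (s k) ((hH _).2 (label_s hn hk))
    omega
  · intro h x hx
    rw [h.len_mul_inv hf ((hH x).1 hx)]
    omega

end Label

end SignedPerm

/-! ### The standard basis of the Hecke algebra -/

section HeckeBasis

variable {d : ℕ}

theorem len_mul_le (w u : W d) : len (w * u) ≤ len w + len u := by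
  induction u using induction_up with
  | one => simp [len_one]
  | step u k hk ih =>
    rw [← mul_assoc, len_mul_s hk]
    by_cases h : Up (w * u) k
    · rw [len_mul_s h]; omega
    · have := len_mul_s' h; omega

theorem up_iff_len {w : W d} {k : Fin d} : Up w k ↔ len (w * s k) = len w + 1 := by
  refine ⟨len_mul_s, fun h => ?_⟩
  by_contra hc
  have := len_mul_s' hc
  omega

theorem up_inv_iff_len {w : W d} {k : Fin d} : Up w⁻¹ k ↔ len (s k * w) = len w + 1 := by
  refine ⟨len_s_mul, fun h => ?_⟩
  by_contra hc
  have := len_s_mul' hc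
  omega

/-! ### Left and right multiplication by simple reflections -/

theorem s_fix {k : Fin d} {x : Seg d} (h1 : x ≠ lo k) (h2 : x ≠ hi k) (h3 : x ≠ neg (lo k))
    (h4 : x ≠ neg (hi k)) : (s k).1 x = x := by
  rcases s_apply_cases k x with h | h | h | h | h | h | h <;> tauto

theorem s_zero {k : Fin d} (h : k.1 = 0) : (s k).1 (lo k) = lo k := by
  apply Subtype.ext; rw [s_val]; simp [h]

theorem s_zero' {k : Fin d} (h : k.1 = 0) : (s k).1 (hi k) = neg (hi k) := by
  apply Subtype.ext; rw [s_val]; simp [h]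

/-- Conjugation by `w` moves the points of a reflection by `w`; a reflection is unchanged when both
of its points are negated, hence the two alternatives. -/
theorem s_conj {w : W d} {i j : Fin d} (h : (w.1 (lo j) = lo i ∧ w.1 (hi j) = hi i) ∨
    (w.1 (lo j) = neg (lo i) ∧ w.1 (hi j) = neg (hi i))) : s i * w = w * s j := by
  -- The index `0` is the one for which `lo` is the point `0`, and every `w` fixes that point.
  have hij : i.1 = 0 ↔ j.1 = 0 := by
    have e1 : (lo i).1 = 0 ↔ i.1 = 0 := by simp
    have e2 : (lo j).1 = 0 ↔ j.1 = 0 := by simp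
    rw [← e1, ← e2]
    constructor
    · intro h0
      have := W_zero w⁻¹ h0
      rw [← this]
      congr 1
      rcases h with h | h
      · rw [← h.1, W_inv_apply_self]
      · rw [← neg_neg' (lo i), ← h.1, W_neg, W_inv_apply_self]
        symm
        rw [neg_eq_self]
        have := W_zero w⁻¹ (x := neg (lo i)) (by simpa using h0)
        rwa [← h.1, W_inv_apply_self] at this
    · intro h0
      have := W_zero w h0
      rcases h with h | h <;> rw [h.1] at this <;> simpa using this
  apply W_ext
  have hlo : (s i).1 (w.1 (lo j)) = w.1 ((s j).1 (lo j)) := by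
    by_cases h0 : i.1 = 0
    · rw [s_zero (hij.1 h0)]
      rcases h with h | h
      · rw [h.1, s_zero h0]
      · rw [h.1, W_neg, s_zero h0]
    · rw [s_lo (mt hij.2 h0)]
      rcases h with h | h
      · rw [h.1, h.2, s_lo h0]
      · rw [h.1, h.2, W_neg, s_lo h0]
  have hhi : (s i).1 (w.1 (hi j)) = w.1 ((s j).1 (hi j)) := by
    by_cases h0 : i.1 = 0
    · rw [s_zero' (hij.1 h0), W_neg]
      rcases h with h | h
      · rw [h.2, s_zero' h0]
      · rw [h.2, W_neg, s_zero' h0]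
    · rw [s_hi (mt hij.2 h0)]
      rcases h with h | h
      · rw [h.1, h.2, s_hi h0]
      · rw [h.1, h.2, W_neg, s_hi h0]
  intro x
  rw [W_mul_apply, W_mul_apply]
  by_cases h1 : x = lo j
  · rw [h1, hlo]
  by_cases h2 : x = hi j
  · rw [h2, hhi]
  by_cases h3 : x = neg (lo j)
  · rw [h3, W_neg, W_neg, W_neg, W_neg, hlo]
  by_cases h4 : x = neg (hi j)
  · rw [h4, W_neg, W_neg, W_neg, W_neg, hhi]
  rw [s_fix h1 h2 h3 h4]
  have g1 : w.1 x ≠ w.1 (lo j) := fun e => h1 ((W_inj w).1 e)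
  have g2 : w.1 x ≠ w.1 (hi j) := fun e => h2 ((W_inj w).1 e)
  have g3 : w.1 x ≠ w.1 (neg (lo j)) := fun e => h3 ((W_inj w).1 e)
  have g4 : w.1 x ≠ w.1 (neg (hi j)) := fun e => h4 ((W_inj w).1 e)
  rw [W_neg] at g3 g4
  rcases h with h | h <;> rw [h.1] at g1 g3 <;> rw [h.2] at g2 g4
  · exact s_fix g1 g2 g3 g4
  · rw [neg_neg'] at g3 g4
    exact s_fix g3 g4 g1 g2

/-- Multiplication by `s i` on the left does not change whether `s j` lengthens on the right,
unless the two multiplications agree. -/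
theorem s_mul_eq_mul_s_or (w : W d) (i j : Fin d) :
    s i * w = w * s j ∨ (Up (s i * w) j ↔ Up w j) := by
  by_cases hu : Up (s i * w) j ↔ Up w j
  · exact Or.inr hu
  refine Or.inl ?_
  -- The pair of images is not of the form `(-b, b)` left out of `inv`.
  have hne : neg (w.1 (lo j)) ≠ w.1 (hi j) := by
    rw [← W_neg, ne_eq, W_inj]
    simp only [Subtype.ext_iff, neg_val, lo_val, hi_val]
    omega
  by_cases h : Up w j
  · have h2 : ¬ Up (s i * w) j := by tauto
    -- If `s i` reverses the two images, they form one of its only two inversions, and this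
    -- identifies `s i` with the conjugate of `s j` by `w`.
    have : (w.1 (lo j), w.1 (hi j)) ∈ inv (s i) := mem_inv.2 ⟨h, not_up.1 h2, hne⟩
    simp only [inv_s, Finset.mem_insert, Finset.mem_singleton, Prod.mk.injEq] at this
    rcases this with h3 | h3
    · exact s_conj (Or.inl h3)
    -- The images are the negatives of `hi i`, `lo i` in the wrong order for `s_conj`; `s i * w` has
    -- them in the right order, provided that `s i` exchanges its two points, that is, `i ≠ 0`.
    · have hi0 : i.1 ≠ 0 := fun h0 => by
        have : (w.1 (hi j)).1 = 0 := by rw [h3.2]; simp [h0]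
        have := W_zero w⁻¹ this
        rw [W_inv_apply_self, hi_val] at this
        omega
      have := s_conj (w := s i * w) (i := i) (j := j) (Or.inr ⟨by
        rw [W_mul_apply, h3.1, W_neg, s_hi hi0], by rw [W_mul_apply, h3.2, W_neg, s_lo hi0]⟩)
      rw [s_s_mul] at this
      rw [this, mul_s_s, ← this]
  · have h2 : Up (s i * w) j := by tauto
    have : (w.1 (hi j), w.1 (lo j)) ∈ inv (s i) := mem_inv.2 ⟨not_up.1 h, h2, by
      intro h
      have h' : neg (w.1 (hi j)) = w.1 (lo j) := h
      apply hne
      rw [← h', neg_neg']⟩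
    simp only [inv_s, Finset.mem_insert, Finset.mem_singleton, Prod.mk.injEq] at this
    rcases this with h3 | h3
    · have hi0 : i.1 ≠ 0 := fun h0 => by
        have : (w.1 (hi j)).1 = 0 := by rw [h3.1]; simp [h0]
        have := W_zero w⁻¹ this
        rw [W_inv_apply_self, hi_val] at this
        omega
      have := s_conj (w := s i * w) (i := i) (j := j) (Or.inl ⟨by
        rw [W_mul_apply, h3.2, s_hi hi0], by rw [W_mul_apply, h3.1, s_lo hi0]⟩)
      rw [s_s_mul] at this
      rw [this, mul_s_s, ← this]
    · exact s_conj (Or.inr ⟨h3.2, h3.1⟩)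

theorem s_mul_eq_mul_s_or' (w : W d) (i j : Fin d) :
    s i * w = w * s j ∨ (Up (w * s j)⁻¹ i ↔ Up w⁻¹ i) := by
  rcases s_mul_eq_mul_s_or w⁻¹ j i with h | h
  · left
    rw [← inv_inj]
    simpa [mul_inv_rev, s_inv] using h.symm
  · right
    rwa [mul_inv_rev, s_inv]

open Classical in
/-- Left multiplication by `T (s i)` in coordinates. -/
def leftOp (i : Fin d) : (W d → LaurentA) →ₗ[LaurentA] (W d → LaurentA) where
  toFun h w := if Up w⁻¹ i then (q : LaurentA) * h (s i * w)
    else h (s i * w) + ((q : LaurentA) - 1) * h w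
  map_add' a b := by
    funext w
    by_cases hu : Up w⁻¹ i <;> simp only [hu, if_true, if_false, Pi.add_apply] <;> ring
  map_smul' c a := by
    funext w
    by_cases hu : Up w⁻¹ i <;>
      simp only [hu, if_true, if_false, Pi.smul_apply, smul_eq_mul, RingHom.id_apply] <;> ring

open Classical in
/-- Right multiplication by `T (s j)` in coordinates. -/
def rightOp (j : Fin d) : (W d → LaurentA) →ₗ[LaurentA] (W d → LaurentA) where
  toFun h w := if Up w j then (q : LaurentA) * h (w * s j)
    else h (w * s j) + ((q : LaurentA) - 1) * h w
  map_add' a b := by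
    funext w
    by_cases hu : Up w j <;> simp only [hu, if_true, if_false, Pi.add_apply] <;> ring
  map_smul' c a := by
    funext w
    by_cases hu : Up w j <;>
      simp only [hu, if_true, if_false, Pi.smul_apply, smul_eq_mul, RingHom.id_apply] <;> ring

theorem leftOp_up {i : Fin d} {w : W d} (hu : Up w⁻¹ i) (h : W d → LaurentA) :
    leftOp i h w = (q : LaurentA) * h (s i * w) := if_pos hu

theorem leftOp_not_up {i : Fin d} {w : W d} (hu : ¬ Up w⁻¹ i) (h : W d → LaurentA) :
    leftOp i h w = h (s i * w) + ((q : LaurentA) - 1) * h w := if_neg hu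

theorem rightOp_up {j : Fin d} {w : W d} (hu : Up w j) (h : W d → LaurentA) :
    rightOp j h w = (q : LaurentA) * h (w * s j) := if_pos hu

theorem rightOp_not_up {j : Fin d} {w : W d} (hu : ¬ Up w j) (h : W d → LaurentA) :
    rightOp j h w = h (w * s j) + ((q : LaurentA) - 1) * h w := if_neg hu

/-- Only the values at `w`, `s i * w`, `w * s j` and `s i * w * s j` enter. If `s i * w = w * s j`,
both operators follow the same rule on one pair of elements; otherwise neither multiplication
affects the ascents on the other side, and the two rules act independently. -/
theorem leftOp_rightOp (i j : Fin d) (h : W d → LaurentA) :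
    leftOp i (rightOp j h) = rightOp j (leftOp i h) := by
  funext w
  by_cases hc : s i * w = w * s j
  · have e1 : Up w⁻¹ i ↔ Up w j := by rw [up_inv_iff_len, up_iff_len, hc]
    have e2 : Up (s i * w) j ↔ ¬ Up w j := by rw [hc, up_mul_s]
    have e3 : Up (w * s j)⁻¹ i ↔ ¬ Up w⁻¹ i := by rw [← hc, up_inv_s_mul]
    have e4 : s i * w * s j = w := by rw [hc, mul_s_s]
    have e5 : s i * (w * s j) = w := by rw [← hc, s_s_mul]
    by_cases hu : Up w j
    · rw [leftOp_up (e1.2 hu), rightOp_up hu, rightOp_not_up (fun hh => e2.1 hh hu),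
        leftOp_not_up (fun hh => e3.1 hh (e1.2 hu)), e4, e5, hc]
    · rw [leftOp_not_up (fun hh => hu (e1.1 hh)), rightOp_not_up hu, rightOp_up (e2.2 hu),
        rightOp_not_up hu, leftOp_up (e3.2 fun hh => hu (e1.1 hh)),
        leftOp_not_up (fun hh => hu (e1.1 hh)), e4, e5, hc]
  · have e1 := (s_mul_eq_mul_s_or w i j).resolve_left hc
    have e2 := (s_mul_eq_mul_s_or' w i j).resolve_left hc
    by_cases hu : Up w j <;> by_cases hu' : Up w⁻¹ i
    · rw [leftOp_up hu', rightOp_up hu, rightOp_up (e1.2 hu), leftOp_up (e2.2 hu'), mul_assoc]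
    · rw [leftOp_not_up hu', rightOp_up hu, rightOp_up hu, rightOp_up (e1.2 hu),
        leftOp_not_up (mt e2.1 hu'), mul_assoc]
      ring
    · rw [leftOp_up hu', rightOp_not_up hu, leftOp_up hu', rightOp_not_up (mt e1.1 hu),
        leftOp_up (e2.2 hu'), mul_assoc]
      ring
    · rw [leftOp_not_up hu', rightOp_not_up hu, rightOp_not_up hu, leftOp_not_up hu',
        rightOp_not_up (mt e1.1 hu), leftOp_not_up (mt e2.1 hu'), mul_assoc]
      ring

open Classical in
/-- The coordinate function of `T w`. -/
def dirac (w : W d) : W d → LaurentA := Pi.single w 1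

theorem leftOp_dirac {i : Fin d} {w : W d} (h : Up w⁻¹ i) :
    leftOp i (dirac w) = dirac (s i * w) := by
  classical
  funext u
  by_cases hu : Up u⁻¹ i
  · have h1 : s i * u ≠ w := by rintro rfl; exact up_inv_s_mul.1 h hu
    have h2 : u ≠ s i * w := by rintro rfl; exact up_inv_s_mul.1 hu h
    rw [leftOp_up hu, dirac, dirac, Pi.single_eq_of_ne h1, Pi.single_eq_of_ne h2, mul_zero]
  · have h1 : u ≠ w := by rintro rfl; exact hu h
    rw [leftOp_not_up hu, dirac, dirac, Pi.single_eq_of_ne h1, mul_zero, add_zero]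
    by_cases h2 : u = s i * w
    · rw [h2, s_s_mul, Pi.single_eq_same, Pi.single_eq_same]
    · rw [Pi.single_eq_of_ne h2, Pi.single_eq_of_ne]
      rintro rfl
      simp at h2

theorem rightOp_dirac {j : Fin d} {w : W d} (h : Up w j) :
    rightOp j (dirac w) = dirac (w * s j) := by
  classical
  funext u
  by_cases hu : Up u j
  · have h1 : u * s j ≠ w := by rintro rfl; exact up_mul_s.1 h hu
    have h2 : u ≠ w * s j := by rintro rfl; exact up_mul_s.1 hu h
    rw [rightOp_up hu, dirac, dirac, Pi.single_eq_of_ne h1, Pi.single_eq_of_ne h2, mul_zero]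
  · have h1 : u ≠ w := by rintro rfl; exact hu h
    rw [rightOp_not_up hu, dirac, dirac, Pi.single_eq_of_ne h1, mul_zero, add_zero]
    by_cases h2 : u = w * s j
    · rw [h2, mul_s_s, Pi.single_eq_same, Pi.single_eq_same]
    · rw [Pi.single_eq_of_ne h2, Pi.single_eq_of_ne]
      rintro rfl
      simp at h2

theorem linearMap_ext_dirac {M : Type*} [AddCommMonoid M] [Module LaurentA M]
    {f g : (W d → LaurentA) →ₗ[LaurentA] M} (h : ∀ w, f (dirac w) = g (dirac w)) : f = g := by
  classical
  apply LinearMap.pi_ext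
  intro w a
  have : (Pi.single w a : W d → LaurentA) = a • dirac w := by
    rw [dirac, ← Pi.single_smul, smul_eq_mul, mul_one]
  rw [this, map_smul, map_smul, h]

/-- Every `dirac w` arises from `dirac 1` by right operators along ascents. This replaces a
verification of the Hecke relations on all of the module by one on a single vector. -/
theorem eq_of_commute {f g : Module.End LaurentA (W d → LaurentA)}
    (hf : ∀ j h, f (rightOp j h) = rightOp j (f h)) (hg : ∀ j h, g (rightOp j h) = rightOp j (g h))
    (h1 : f (dirac 1) = g (dirac 1)) : f = g := by
  refine linearMap_ext_dirac fun w => ?_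
  induction w using induction_up with
  | one => exact h1
  | step w k hk ih => rw [← rightOp_dirac hk, hf, hg, ih]

/-- The operator of left multiplication by `T w`. -/
theorem exists_regular (w : W d) : ∃ L : Module.End LaurentA (W d → LaurentA),
    (∀ j h, L (rightOp j h) = rightOp j (L h)) ∧
    ∀ u, len (w * u) = len w + len u → L (dirac u) = dirac (w * u) := by
  -- Passing to inverses turns the letter appended on the right by `induction_up` into a new left
  -- factor, realized by `leftOp`.
  suffices H : ∀ w : W d, ∃ L : Module.End LaurentA (W d → LaurentA),
      (∀ j h, L (rightOp j h) = rightOp j (L h)) ∧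
      ∀ u, len (w⁻¹ * u) = len w + len u → L (dirac u) = dirac (w⁻¹ * u) by
    obtain ⟨L, h1, h2⟩ := H w⁻¹
    exact ⟨L, h1, fun u hu => by simpa using h2 u (by simpa [len_inv] using hu)⟩
  intro w
  induction w using induction_up with
  | one => exact ⟨1, fun _ _ => rfl, fun u _ => by simp⟩
  | step w k hk ih =>
    obtain ⟨L, h1, h2⟩ := ih
    refine ⟨leftOp k * L, fun j h => ?_, fun u hu => ?_⟩
    · rw [Module.End.mul_apply, h1, leftOp_rightOp, Module.End.mul_apply]
    · rw [mul_inv_rev, s_inv, mul_assoc] at hu ⊢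
      rw [len_mul_s hk] at hu
      -- Subadditivity of the length forces each of the two successive products to be length
      -- additive.
      have e1 := len_mul_le w⁻¹ u
      rw [len_inv] at e1
      have e2 := len_mul_le (s k) (w⁻¹ * u)
      rw [len_s] at e2
      rw [Module.End.mul_apply, h2 u (by omega), leftOp_dirac (up_inv_iff_len.2 (by omega))]

/-- Left multiplication by `T w` in coordinates. -/
def regular (w : W d) : Module.End LaurentA (W d → LaurentA) := (exists_regular w).choose

theorem regular_rightOp (w : W d) (j : Fin d) (h : W d → LaurentA) :
    regular w (rightOp j h) = rightOp j (regular w h) := (exists_regular w).choose_spec.1 j h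

theorem regular_dirac {w u : W d} (h : len (w * u) = len w + len u) :
    regular w (dirac u) = dirac (w * u) := (exists_regular w).choose_spec.2 u h

theorem regular_dirac_one (w : W d) : regular w (dirac 1) = dirac w := by
  rw [regular_dirac (by simp [len_one]), mul_one]

theorem regular_s (i : Fin d) : regular (s i) = leftOp i :=
  eq_of_commute (regular_rightOp _) (leftOp_rightOp i) (by
    rw [regular_dirac_one, leftOp_dirac, mul_one]
    rw [_root_.inv_one]
    exact lo_lt_hi i)

theorem regular_mul {w u : W d} (h : len (w * u) = len w + len u) :
    regular w * regular u = regular (w * u) :=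
  eq_of_commute (fun j h => by simp only [Module.End.mul_apply, regular_rightOp])
    (regular_rightOp _) (by
      rw [Module.End.mul_apply, regular_dirac_one, regular_dirac h, regular_dirac_one])

theorem regular_one : regular (1 : W d) = 1 :=
  eq_of_commute (regular_rightOp _) (fun _ _ => rfl) (by rw [regular_dirac_one]; rfl)

theorem leftOp_quad (i : Fin d) (h : W d → LaurentA) :
    leftOp i (leftOp i h) = ((q : LaurentA) - 1) • leftOp i h + (q : LaurentA) • h := by
  funext w
  by_cases hu : Up w⁻¹ i
  · rw [leftOp_up hu, leftOp_not_up (by rwa [up_inv_s_mul, not_not])]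
    simp only [Pi.add_apply, Pi.smul_apply, smul_eq_mul, leftOp_up hu, s_s_mul]
    ring
  · rw [leftOp_not_up hu, leftOp_up (up_inv_s_mul.2 hu)]
    simp only [Pi.add_apply, Pi.smul_apply, smul_eq_mul, leftOp_not_up hu, s_s_mul]
    ring

/-- The left regular representation of the Hecke algebra in coordinates. -/
def regularRep (d : ℕ) : Hecke d →ₐ[LaurentA] Module.End LaurentA (W d → LaurentA) :=
  RingQuot.liftAlgHom LaurentA ⟨FreeAlgebra.lift LaurentA regular, by
    intro a b h
    cases h with
    | one => simp [regular_one]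
    | mul w u h => simp [regular_mul h]
    | quad i =>
      simp only [map_mul, map_add, map_sub, FreeAlgebra.lift_ι_apply, map_one, map_zero,
        AlgHom.commutes, regular_s]
      refine LinearMap.ext fun h => ?_
      simp only [Module.End.mul_apply, LinearMap.add_apply, LinearMap.sub_apply, map_sub,
        Module.algebraMap_end_apply, Module.End.one_apply, LinearMap.zero_apply, leftOp_quad,
        map_smul, sub_smul, one_smul, smul_add]
      abel⟩

theorem regularRep_T (w : W d) : regularRep d (T w) = regular w := by
  rw [regularRep, T, RingQuot.liftAlgHom_mkAlgHom_apply, FreeAlgebra.lift_ι_apply]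

/-! ### Multiplication rules and freeness over the Laurent polynomials -/

theorem T_one : T (1 : W d) = 1 := by
  rw [T, RingQuot.mkAlgHom_rel LaurentA HeckeRel.one, map_one]

theorem T_mul {w u : W d} (h : len (w * u) = len w + len u) : T w * T u = T (w * u) := by
  rw [T, T, T, ← map_mul, RingQuot.mkAlgHom_rel LaurentA (HeckeRel.mul w u h)]

theorem mul_self_of_quad {R A : Type*} [CommRing R] [Ring A] [Algebra R A] {t : A} {c : R}
    (h : (t + 1) * (t - algebraMap R A c) = 0) : t * t = (c - 1) • t + c • (1 : A) := by
  rw [mul_sub, add_mul, one_mul, sub_eq_zero, ← Algebra.commutes, mul_add, mul_one,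
    ← Algebra.smul_def] at h
  rw [← eq_sub_iff_add_eq] at h
  rw [h, Algebra.algebraMap_eq_smul_one, sub_smul, one_smul]
  abel

theorem T_s_mul_T_s (i : Fin d) : T (s i) * T (s i) =
    ((q : LaurentA) - 1) • T (s i) + (q : LaurentA) • 1 := by
  have := RingQuot.mkAlgHom_rel LaurentA (HeckeRel.quad i)
  simp only [map_mul, map_add, map_sub, map_one, map_zero, AlgHom.commutes] at this
  exact mul_self_of_quad (A := Hecke d) (t := T (s i)) (c := (q : LaurentA)) this

theorem T_s_mul_up {i : Fin d} {w : W d} (h : Up w⁻¹ i) : T (s i) * T w = T (s i * w) :=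
  T_mul (by rw [len_s_mul h, len_s, add_comm])

theorem T_mul_s_up {i : Fin d} {w : W d} (h : Up w i) : T w * T (s i) = T (w * s i) :=
  T_mul (by rw [len_mul_s h, len_s])

theorem T_s_mul_not_up {i : Fin d} {w : W d} (h : ¬ Up w⁻¹ i) :
    T (s i) * T w = ((q : LaurentA) - 1) • T w + (q : LaurentA) • T (s i * w) := by
  have h1 := T_s_mul_up (up_inv_s_mul.2 h)
  rw [s_s_mul] at h1
  rw [← h1, ← mul_assoc, T_s_mul_T_s, add_mul, smul_mul_assoc, smul_mul_assoc, one_mul]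

theorem T_mul_s_not_up {i : Fin d} {w : W d} (h : ¬ Up w i) :
    T w * T (s i) = ((q : LaurentA) - 1) • T w + (q : LaurentA) • T (w * s i) := by
  have h1 := T_mul_s_up (up_mul_s.2 h)
  rw [mul_s_s] at h1
  rw [← h1, mul_assoc, T_s_mul_T_s, mul_add, mul_smul_comm, mul_smul_comm, mul_one]

/-- Letting the regular representation act on `dirac 1` sends the `T w` to the standard basis
vectors. -/
theorem linearIndependent_T : LinearIndependent LaurentA (T : W d → Hecke d) := by
  classical
  have h : LinearIndependent LaurentA (dirac : W d → W d → LaurentA) :=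
    Pi.linearIndependent_single_one _ _
  refine LinearIndependent.of_comp
    ((LinearMap.applyₗ (dirac 1)).comp (regularRep d).toLinearMap) ?_
  convert h using 1
  funext w
  simp [regularRep_T, regular_dirac_one]

theorem T_mul_mem_span (w : W d) {h : Hecke d} (hh : h ∈ Submodule.span LaurentA (Set.range T)) :
    T w * h ∈ Submodule.span LaurentA (Set.range (T : W d → Hecke d)) := by
  induction w using induction_up generalizing h with
  | one => rwa [T_one, one_mul]
  | step w k hk ih =>
    rw [← T_mul_s_up hk, mul_assoc]
    apply ih
    clear ih
    induction hh using Submodule.span_induction with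
    | mem x hx =>
      obtain ⟨u, rfl⟩ := hx
      by_cases hu : Up u⁻¹ k
      · rw [T_s_mul_up hu]
        exact Submodule.subset_span ⟨_, rfl⟩
      · rw [T_s_mul_not_up hu]
        exact add_mem (Submodule.smul_mem _ _ (Submodule.subset_span ⟨_, rfl⟩))
          (Submodule.smul_mem _ _ (Submodule.subset_span ⟨_, rfl⟩))
    | zero => simp
    | add x y _ _ hx hy => rw [mul_add]; exact add_mem hx hy
    | smul a x _ hx => rw [mul_smul_comm]; exact Submodule.smul_mem _ _ hx

/-- The span contains `1` and is stable under left multiplication by the algebra generators `T w`,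
so it is everything. -/
theorem span_T : ⊤ ≤ Submodule.span LaurentA (Set.range (T : W d → Hecke d)) := by
  rintro h -
  obtain ⟨a, rfl⟩ := RingQuot.mkAlgHom_surjective LaurentA (HeckeRel d) h
  suffices H : ∀ b ∈ Submodule.span LaurentA (Set.range (T : W d → Hecke d)),
      RingQuot.mkAlgHom LaurentA (HeckeRel d) a * b ∈
        Submodule.span LaurentA (Set.range (T : W d → Hecke d)) by
    have := H 1 (by rw [← T_one]; exact Submodule.subset_span ⟨1, rfl⟩)
    rwa [mul_one] at this
  induction a using FreeAlgebra.induction with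
  | grade0 r =>
    intro b hb
    rw [AlgHom.commutes, Algebra.algebraMap_eq_smul_one, smul_mul_assoc, one_mul]
    exact Submodule.smul_mem _ _ hb
  | grade1 w => exact fun b hb => T_mul_mem_span w hb
  | mul x y hx hy =>
    intro b hb
    rw [map_mul, mul_assoc]
    exact hx _ (hy _ hb)
  | add x y hx hy =>
    intro b hb
    rw [map_add, add_mul]
    exact add_mem (hx _ hb) (hy _ hb)

/-- The standard basis of the Hecke algebra. -/
def heckeBasis (d : ℕ) : Module.Basis (W d) LaurentA (Hecke d) :=
  Module.Basis.mk linearIndependent_T span_T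

theorem heckeBasis_apply (w : W d) : heckeBasis d w = T w := by
  simp [heckeBasis]

/-- The coefficient of `T w`. -/
def coef (w : W d) : Hecke d →ₗ[LaurentA] LaurentA := (heckeBasis d).coord w

open Classical in
theorem coef_T (w u : W d) : coef w (T u) = if u = w then 1 else 0 := by
  rw [coef, ← heckeBasis_apply, Module.Basis.coord_apply, Module.Basis.repr_self,
    Finsupp.single_apply]

theorem hecke_ext {a b : Hecke d} (h : ∀ w, coef w a = coef w b) : a = b :=
  (heckeBasis d).ext_elem h

theorem hecke_induction {P : Hecke d → Prop} (hT : ∀ w, P (T w))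
    (hadd : ∀ a b, P a → P b → P (a + b)) (hsmul : ∀ (c : LaurentA) a, P a → P (c • a))
    (a : Hecke d) : P a := by
  have : a ∈ Submodule.span LaurentA (Set.range (T : W d → Hecke d)) := span_T trivial
  induction this using Submodule.span_induction with
  | mem x hx => obtain ⟨w, rfl⟩ := hx; exact hT w
  | zero => simpa using hsmul 0 (T 1) (hT 1)
  | add x y _ _ hx hy => exact hadd x y hx hy
  | smul c x _ hx => exact hsmul c x hx

/-! ### Multiplication by generators in coordinates -/

theorem coef_T_s_mul (i : Fin d) (w : W d) (h : Hecke d) :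
    coef w (T (s i) * h) = leftOp i (fun u => coef u h) w := by
  classical
  induction h using hecke_induction with
  | hT u =>
    have e1 : (fun x => coef x (T u)) = dirac u := by
      funext x; rw [coef_T, dirac, Pi.single_apply]; simp only [eq_comm]
    have e2 : ∀ u x : W d, coef x (T u) = dirac u x := by
      intro u x; rw [coef_T, dirac, Pi.single_apply]; simp only [eq_comm]
    rw [e1]
    by_cases hu : Up u⁻¹ i
    · rw [leftOp_dirac hu, T_s_mul_up hu, e2]
    · have := leftOp_dirac (up_inv_s_mul.2 hu)
      rw [s_s_mul] at this
      rw [T_s_mul_not_up hu, ← this, leftOp_quad, this]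
      simp [e2]
  | hadd a b ha hb =>
    have : (fun u => coef u (a + b)) = (fun u => coef u a) + fun u => coef u b := by
      funext u; simp
    rw [mul_add, map_add, ha, hb, this, map_add]; rfl
  | hsmul c a ha =>
    have : (fun u => coef u (c • a)) = c • (fun u => coef u a) := by
      funext u; simp
    rw [mul_smul_comm, map_smul, ha, this, map_smul]; rfl

theorem rightOp_quad (i : Fin d) (h : W d → LaurentA) :
    rightOp i (rightOp i h) = ((q : LaurentA) - 1) • rightOp i h + (q : LaurentA) • h := by
  funext w
  by_cases hu : Up w i
  · rw [rightOp_up hu, rightOp_not_up (by rwa [up_mul_s, not_not])]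
    simp only [Pi.add_apply, Pi.smul_apply, smul_eq_mul, rightOp_up hu, mul_s_s]
    ring
  · rw [rightOp_not_up hu, rightOp_up (up_mul_s.2 hu)]
    simp only [Pi.add_apply, Pi.smul_apply, smul_eq_mul, rightOp_not_up hu, mul_s_s]
    ring

theorem coef_mul_T_s (i : Fin d) (w : W d) (h : Hecke d) :
    coef w (h * T (s i)) = rightOp i (fun u => coef u h) w := by
  classical
  induction h using hecke_induction with
  | hT u =>
    have e1 : (fun x => coef x (T u)) = dirac u := by
      funext x; rw [coef_T, dirac, Pi.single_apply]; simp only [eq_comm]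
    have e2 : ∀ u x : W d, coef x (T u) = dirac u x := by
      intro u x; rw [coef_T, dirac, Pi.single_apply]; simp only [eq_comm]
    rw [e1]
    by_cases hu : Up u i
    · rw [rightOp_dirac hu, T_mul_s_up hu, e2]
    · have := rightOp_dirac (up_mul_s.2 hu)
      rw [mul_s_s] at this
      rw [T_mul_s_not_up hu, ← this, rightOp_quad, this]
      simp [e2]
  | hadd a b ha hb =>
    have : (fun u => coef u (a + b)) = (fun u => coef u a) + fun u => coef u b := by
      funext u; simp
    rw [add_mul, map_add, ha, hb, this, map_add]; rfl
  | hsmul c a ha =>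
    have : (fun u => coef u (c • a)) = c • (fun u => coef u a) := by
      funext u; simp
    rw [smul_mul_assoc, map_smul, ha, this, map_smul]; rfl

end HeckeBasis

/-! ### Blocks of a composition -/

section Blocks

variable {m n d : ℕ}

theorem partialSum_mono (l : Comp m n d) : Monotone (partialSum l) := fun a b h =>
  Finset.sum_le_sum_of_subset fun j hj => by
    simp only [Finset.mem_filter, Finset.mem_univ, true_and] at hj ⊢
    omega

theorem partialSum_last (l : Comp m n d) : partialSum l (m + n) = d := by
  rw [partialSum, Finset.filter_true_of_mem fun j _ => by omega]
  exact l.2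

theorem psum_eq_partialSum (l : Comp m n d) (i : Fin (m + n + 1)) :
    psum l.1 i = partialSum l i.1 := rfl

/-- The index of the block that contains the natural number `t ≤ d`. -/
def blkNat (l : Comp m n d) (t : ℕ) : ℕ := sInf {k | t ≤ partialSum l k}

theorem blkNat_le_iff (l : Comp m n d) {t : ℕ} (ht : t ≤ d) (k : ℕ) :
    blkNat l t ≤ k ↔ t ≤ partialSum l k := by
  constructor
  · intro h
    -- The index `m + n` shows that the set is nonempty, so the infimum is attained and is not a
    -- default value.
    have : t ≤ partialSum l (blkNat l t) :=
      Nat.sInf_mem (s := {k | t ≤ partialSum l k}) ⟨m + n, by simpa [partialSum_last] using ht⟩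
    exact this.trans (partialSum_mono l h)
  · exact fun h => Nat.sInf_le h

theorem blkNat_le (l : Comp m n d) {t : ℕ} (ht : t ≤ d) : blkNat l t ≤ m + n := by
  rw [blkNat_le_iff l ht, partialSum_last]; exact ht

theorem blkNat_zero (l : Comp m n d) : blkNat l 0 = 0 := by
  have := (blkNat_le_iff l (Nat.zero_le d) 0).2 (Nat.zero_le _)
  omega

theorem natAbs_le {d : ℕ} (x : Seg d) : x.1.natAbs ≤ d := by
  have := x.2.1; have := x.2.2; omega

/-- The index `i` of the block `R_i` that contains `x`. -/
def blk (l : Comp m n d) (x : Seg d) : Seg (m + n) :=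
  ⟨if 0 ≤ x.1 then (blkNat l x.1.natAbs : ℤ) else -(blkNat l x.1.natAbs : ℤ), by
    have := blkNat_le l (natAbs_le x)
    split_ifs <;> constructor <;> omega⟩

theorem blk_val (l : Comp m n d) (x : Seg d) : (blk l x).1 =
    if 0 ≤ x.1 then (blkNat l x.1.natAbs : ℤ) else -(blkNat l x.1.natAbs : ℤ) := rfl

theorem blk_neg (l : Comp m n d) (x : Seg d) : blk l (neg x) = neg (blk l x) := by
  apply Subtype.ext
  simp only [blk_val, neg_val, Int.natAbs_neg]
  rcases lt_trichotomy x.1 0 with h | h | h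
  · rw [if_pos (by omega), if_neg (by omega), _root_.neg_neg]
  · simp [h, blkNat_zero]
  · rw [if_neg (by omega), if_pos h.le]

theorem blk_le_iff (l : Comp m n d) (x : Seg d) (k : ℕ) :
    (blk l x).1 ≤ k ↔ x.1 ≤ partialSum l k := by
  rw [blk_val]
  have := blkNat_le_iff l (natAbs_le x) k
  split_ifs <;> omega

theorem blk_mono (l : Comp m n d) : Monotone (blk l) := by
  have key : ∀ x y : Seg d, x ≤ y → 0 ≤ (blk l y).1 → blk l x ≤ blk l y := by
    intro x y h h0
    have hy := (blk_le_iff l y (blk l y).1.toNat).1 (by omega)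
    have hxy : x.1 ≤ y.1 := h
    have hx := (blk_le_iff l x (blk l y).1.toNat).2 (hxy.trans hy)
    rw [← Subtype.coe_le_coe]
    omega
  intro x y h
  by_cases h0 : 0 ≤ (blk l y).1
  · exact key x y h h0
  · by_cases h1 : 0 ≤ (blk l x).1
    -- Both points are negative and `x` lies in the central block, hence so does `y`, which is
    -- closer to `0`.
    · exfalso
      have hxy : x.1 ≤ y.1 := h
      rw [blk_val] at h0 h1
      have hx : ¬ 0 ≤ y.1 := fun hh => by rw [if_pos hh] at h0; omega
      rw [if_neg (by omega)] at h1
      have e := (blkNat_le_iff l (natAbs_le x) 0).1 (by omega)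
      have := (blkNat_le_iff l (natAbs_le y) 0).2 (by omega)
      rw [if_neg hx] at h0
      omega
    · rw [← neg_le_neg', ← blk_neg, ← blk_neg]
      apply key _ _ (neg_le_neg'.2 h)
      rw [blk_neg, neg_val]; omega

theorem mem_R (l : Comp m n d) (i : Seg (m + n)) (x : Seg d) : x ∈ R l i ↔ blk l x = i := by
  have key : ∀ (i : Seg (m + n)) (x : Seg d), 0 < i.1 →
      (((partialSum l (i.1.natAbs - 1) : ℤ) < x.1 ∧ x.1 ≤ partialSum l i.1.natAbs) ↔
        blk l x = i) := by
    intro i x hi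
    have h1 := blk_le_iff l x (i.1.natAbs - 1)
    have h2 := blk_le_iff l x i.1.natAbs
    rw [← h2, ← not_le, ← h1, Subtype.ext_iff]
    omega
  rw [R, Finset.mem_filter]
  simp only [Finset.mem_univ, true_and]
  split_ifs with h0 h1
  · have h1 := blk_le_iff l x 0
    have h2 := blk_le_iff l (neg x) 0
    rw [blk_neg, neg_val, neg_val] at h2
    rw [Subtype.ext_iff, h0]
    push_cast at h1 h2
    omega
  · exact key i x h1
  · rw [← neg_inj (x := blk l x), ← blk_neg, ← key (neg i) (neg x) (by rw [neg_val]; omega),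
      neg_val, neg_val, Int.natAbs_neg]

/-- A nonnegative `k < d` is the last point of its block precisely when it is a partial sum; this
translates the generators of a parabolic subgroup into the labelling `blk`. -/
theorem blk_lo_eq_iff (l : Comp m n d) (k : Fin d) :
    blk l (lo k) = blk l (hi k) ↔ ∀ i, k.1 ≠ psum l.1 i := by
  have h1 := blk_le_iff l (lo k)
  have h2 := blk_le_iff l (hi k)
  simp only [lo_val, hi_val] at h1 h2
  constructor
  · intro h i hi
    rw [psum_eq_partialSum] at hi
    have := (h1 i.1).2 (by omega)
    rw [h, h2] at this
    omega
  · intro h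
    apply le_antisymm (blk_mono l (lo_lt_hi k).le)
    have h0 : 0 ≤ (blk l (lo k)).1 := by rw [blk_val]; simp
    have hk := (h1 (blk l (lo k)).1.toNat).1 (by omega)
    have hne : k.1 ≠ partialSum l (blk l (lo k)).1.toNat :=
      h ⟨(blk l (lo k)).1.toNat, by have := (blk l (lo k)).2.2; omega⟩
    have := (h2 (blk l (lo k)).1.toNat).2 (by omega)
    rw [← Subtype.coe_le_coe]
    omega

theorem blk_neg_congr (l : Comp m n d) (x y : Seg d) (h : blk l x = blk l y) :
    blk l (neg x) = blk l (neg y) := by rw [blk_neg, blk_neg, h]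

theorem mem_Wl (l : Comp m n d) (w : W d) : w ∈ Wl l ↔ ∀ x, blk l (w.1 x) = blk l x :=
  mem_closure_iff_label (blk_mono l) (blk_neg_congr l) (by simp only [blk_lo_eq_iff]) w

/-! ### The even and the odd part -/

/-- The odd indices in `𝕀`. -/
def IsOdd (m : ℕ) {n : ℕ} (i : Seg (m + n)) : Prop := (m : ℤ) < |i.1|

theorem isOdd_neg (i : Seg (m + n)) : IsOdd m (neg i) ↔ IsOdd m i := by
  rw [IsOdd, neg_val, abs_neg, IsOdd]

theorem parity_ne_iff (i j : Seg (m + n)) :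
    parity m i ≠ parity m j ↔ ¬ (IsOdd m i ↔ IsOdd m j) := by
  unfold parity IsOdd
  split_ifs <;> simp <;> omega

open Classical in
/-- The labelling that refines `blk` by splitting the blocks whose index satisfies `P` into
points. -/
def refine (P : Seg (m + n) → Prop) (l : Comp m n d) (x : Seg d) : Seg (m + n) ×ₗ Seg d :=
  toLex (blk l x, if P (blk l x) then x else zeroIdx d)

theorem refine_eq_iff {P : Seg (m + n) → Prop} {l : Comp m n d} {x y : Seg d} :
    refine P l x = refine P l y ↔ blk l x = blk l y ∧ (P (blk l x) → x = y) := by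
  rw [refine, refine, toLex_inj, Prod.mk.injEq]
  refine and_congr_right fun h => ?_
  rw [← h]
  split_ifs with hP <;> simp [hP]

theorem refine_mono (P : Seg (m + n) → Prop) (l : Comp m n d) : Monotone (refine P l) := by
  intro x y h
  rw [refine, refine, Prod.Lex.toLex_le_toLex]
  rcases (blk_mono l h).lt_or_eq with h1 | h1
  · exact Or.inl h1
  · refine Or.inr ⟨h1, ?_⟩
    dsimp only
    rw [h1]
    by_cases hP : P (blk l y)
    · rwa [if_pos hP, if_pos hP]
    · rw [if_neg hP, if_neg hP]

theorem refine_neg_congr {P : Seg (m + n) → Prop} (hP : ∀ i, P (neg i) ↔ P i) (l : Comp m n d)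
    (x y : Seg d) (h : refine P l x = refine P l y) :
    refine P l (neg x) = refine P l (neg y) := by
  rw [refine_eq_iff] at h ⊢
  rw [blk_neg, blk_neg, h.1, hP]
  exact ⟨rfl, fun hh => by rw [h.2 (h.1 ▸ hh)]⟩

theorem refine_stab_iff {P : Seg (m + n) → Prop} {l : Comp m n d} {w : W d} :
    (∀ x, refine P l (w.1 x) = refine P l x) ↔
      ∀ x, blk l (w.1 x) = blk l x ∧ (P (blk l x) → w.1 x = x) := by
  refine forall_congr' fun x => ?_
  rw [refine_eq_iff]
  refine and_congr_right fun h => ?_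
  rw [h]

theorem isOdd_blk_hi (l : Comp m n d) (k : Fin d) :
    IsOdd m (blk l (hi k)) ↔ partialSum l m ≤ k.1 := by
  have h2 := blk_le_iff l (hi k) m
  have h0 : 0 ≤ (blk l (hi k)).1 := by
    rw [blk_val, hi_val, if_pos (by omega)]; omega
  rw [hi_val] at h2
  rw [IsOdd, abs_of_nonneg h0]
  omega

theorem lo_ne_hi (k : Fin d) : lo k ≠ hi k := (lo_lt_hi k).ne

theorem not_partialSum {l : Comp m n d} {k : Fin d} (h : ∀ i, k.1 ≠ psum l.1 i) (j : ℕ)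
    (hj : j ≤ m + n) : k.1 ≠ partialSum l j := h ⟨j, by omega⟩

/-- Splitting the odd blocks into points leaves, among the stabilizing simple reflections, those
inside an even block, which are those with `k` below the partial sum at `m`. -/
theorem mem_Weven (l : Comp m n d) (w : W d) : w ∈ Weven l ↔
    ∀ x, blk l (w.1 x) = blk l x ∧ (IsOdd m (blk l x) → w.1 x = x) := by
  rw [← refine_stab_iff (P := IsOdd m)]
  refine mem_closure_iff_label (refine_mono _ l) (refine_neg_congr isOdd_neg l) ?_ w
  ext u
  refine exists_congr fun k => ?_
  rw [refine_eq_iff, ← and_assoc]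
  refine and_congr_left fun _ => ?_
  rw [blk_lo_eq_iff]
  refine and_congr_right fun h => ?_
  rw [(blk_lo_eq_iff l k).2 h, isOdd_blk_hi, imp_iff_not (lo_ne_hi k), not_le]

theorem mem_Wodd (l : Comp m n d) (w : W d) : w ∈ Wodd l ↔
    ∀ x, blk l (w.1 x) = blk l x ∧ (¬ IsOdd m (blk l x) → w.1 x = x) := by
  rw [← refine_stab_iff (P := fun i => ¬ IsOdd m i)]
  refine mem_closure_iff_label (refine_mono _ l)
    (refine_neg_congr (fun i => not_congr (isOdd_neg i)) l) ?_ w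
  ext u
  refine exists_congr fun k => ?_
  rw [refine_eq_iff, ← and_assoc]
  refine and_congr_left fun _ => ?_
  rw [blk_lo_eq_iff]
  refine and_congr_right fun h => ?_
  rw [(blk_lo_eq_iff l k).2 h, isOdd_blk_hi, imp_iff_not (lo_ne_hi k), not_not]
  -- A generator has `k` different from the partial sum at `m`, so the weak and the strict
  -- inequality agree.
  have := not_partialSum h m (by omega)
  omega

theorem Weven_le (l : Comp m n d) : Weven l ≤ Wl l := fun w h =>
  (mem_Wl l w).2 fun x => ((mem_Weven l w).1 h x).1

theorem Wodd_le (l : Comp m n d) : Wodd l ≤ Wl l := fun w h =>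
  (mem_Wl l w).2 fun x => ((mem_Wodd l w).1 h x).1

theorem Weven_mul_apply {l : Comp m n d} {a b : W d} (ha : a ∈ Weven l) (hb : b ∈ Wodd l)
    (x : Seg d) : (IsOdd m (blk l x) → (a * b).1 x = b.1 x) ∧
      (¬ IsOdd m (blk l x) → (a * b).1 x = a.1 x) := by
  rw [mem_Weven] at ha
  rw [mem_Wodd] at hb
  constructor <;> intro h <;> rw [W_mul_apply]
  · exact (ha _).2 (by rwa [(hb x).1])
  · rw [(hb x).2 h]

theorem Weven_comm {l : Comp m n d} {a b : W d} (ha : a ∈ Weven l) (hb : b ∈ Wodd l) :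
    a * b = b * a := by
  apply W_ext
  intro x
  by_cases h : IsOdd m (blk l x)
  · rw [(Weven_mul_apply ha hb x).1 h, W_mul_apply, ((mem_Weven l a).1 ha x).2 h]
  · rw [(Weven_mul_apply ha hb x).2 h, W_mul_apply, ((mem_Wodd l b).1 hb _).2]
    rwa [((mem_Weven l a).1 ha x).1]

theorem Weven_mul_inj {l : Comp m n d} {a b a' b' : W d} (ha : a ∈ Weven l) (hb : b ∈ Wodd l)
    (ha' : a' ∈ Weven l) (hb' : b' ∈ Wodd l) (h : a * b = a' * b') : a = a' ∧ b = b' := by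
  have : a = a' := by
    apply W_ext
    intro x
    by_cases hx : IsOdd m (blk l x)
    · rw [((mem_Weven l a).1 ha x).2 hx, ((mem_Weven l a').1 ha' x).2 hx]
    · rw [← (Weven_mul_apply ha hb x).2 hx, h, (Weven_mul_apply ha' hb' x).2 hx]
  subst this
  exact ⟨rfl, mul_left_cancel h⟩

theorem exists_even_odd {l : Comp m n d} {w : W d} (hw : w ∈ Wl l) :
    ∃ a ∈ Weven l, ∃ b ∈ Wodd l, a * b = w := by
  rw [Wl, parabolic] at hw
  induction hw using Subgroup.closure_induction with
  | mem w h =>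
    obtain ⟨k, hk, rfl⟩ := h
    have := not_partialSum hk m (by omega)
    rcases lt_or_gt_of_ne this with h | h
    · exact ⟨s k, Subgroup.subset_closure ⟨k, hk, h, rfl⟩, 1, one_mem _, mul_one _⟩
    · exact ⟨1, one_mem _, s k, Subgroup.subset_closure ⟨k, hk, h, rfl⟩, one_mul _⟩
  | one => exact ⟨1, one_mem _, 1, one_mem _, mul_one _⟩
  | mul u w _ _ hu hw =>
    obtain ⟨a, ha, b, hb, rfl⟩ := hu
    obtain ⟨a', ha', b', hb', rfl⟩ := hw
    refine ⟨a * a', mul_mem ha ha', b * b', mul_mem hb hb', ?_⟩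
    rw [mul_assoc, mul_assoc, ← mul_assoc a' b, Weven_comm ha' hb, mul_assoc]
  | inv w _ hw =>
    obtain ⟨a, ha, b, hb, rfl⟩ := hw
    exact ⟨a⁻¹, inv_mem ha, b⁻¹, inv_mem hb, by
      rw [Weven_comm (inv_mem ha) (inv_mem hb), mul_inv_rev]⟩

/-- In the labelling that defines the odd part, two points share a fibre only inside odd blocks, and
there `a` is the identity. -/
theorem incrOn_even {l : Comp m n d} {a : W d} (ha : a ∈ Weven l) :
    IncrOn (refine (fun i => ¬ IsOdd m i) l) a := by
  intro x y hxy h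
  rw [refine_eq_iff] at h
  have hx : IsOdd m (blk l x) := by
    by_contra hc
    exact hxy.ne (h.2 hc)
  rw [((mem_Weven l a).1 ha x).2 hx, ((mem_Weven l a).1 ha y).2 (h.1 ▸ hx)]
  exact hxy

theorem len_even_mul_odd {l : Comp m n d} {a b : W d} (ha : a ∈ Weven l) (hb : b ∈ Wodd l) :
    len (a * b) = len a + len b :=
  (incrOn_even ha).len_mul (refine_mono _ l) (refine_stab_iff.2 ((mem_Wodd l b).1 hb))

/-! ### The matrix of a double coset -/

theorem kappa_apply (l : Comp m n d) (g : W d) (μ : Comp m n d) (i j : Seg (m + n)) :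
    kappa l g μ i j =
      (Finset.univ.filter fun x : Seg d => blk l (g.1 x) = i ∧ blk μ x = j).card := by
  rw [kappa, ← Finset.card_image_of_injective (Finset.univ.filter _) g.1.injective]
  congr 1
  ext x
  simp only [Finset.mem_inter, mem_R, Finset.mem_image, Finset.mem_filter, Finset.mem_univ,
    true_and]
  constructor
  · rintro ⟨h1, y, h2, rfl⟩
    exact ⟨y, ⟨h1, h2⟩, rfl⟩
  · rintro ⟨y, ⟨h1, h2⟩, rfl⟩
    exact ⟨h1, y, h2, rfl⟩

theorem kappa_mul (l : Comp m n d) (g : W d) (μ : Comp m n d) {a b : W d} (ha : a ∈ Wl l)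
    (hb : b ∈ Wl μ) : kappa l (a * g * b) μ = kappa l g μ := by
  rw [mem_Wl] at ha hb
  ext i j
  rw [kappa_apply, kappa_apply]
  refine Finset.card_bij' (fun x _ => b.1 x) (fun x _ => (b⁻¹).1 x) ?_ ?_ ?_ ?_
  · intro x hx
    simp only [Finset.mem_filter, Finset.mem_univ, true_and, W_mul_apply, ha] at hx ⊢
    rwa [hb]
  · intro x hx
    simp only [Finset.mem_filter, Finset.mem_univ, true_and, W_mul_apply, ha] at hx ⊢
    rwa [W_apply_inv_self, label_inv hb]
  · intro x _; simp
  · intro x _; simp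

theorem kappa_mul_right (l : Comp m n d) (g : W d) (μ : Comp m n d) {b : W d}
    (hb : b ∈ Wl μ) : kappa l (g * b) μ = kappa l g μ := by
  simpa using kappa_mul l g μ (one_mem _) hb

theorem kappa_inv (l : Comp m n d) (g : W d) (μ : Comp m n d) (i j : Seg (m + n)) :
    kappa μ g⁻¹ l j i = kappa l g μ i j := by
  rw [kappa_apply, kappa_apply]
  refine Finset.card_bij' (fun x _ => (g⁻¹).1 x) (fun x _ => g.1 x) ?_ ?_ ?_ ?_
  · intro x hx
    simp only [Finset.mem_filter, Finset.mem_univ, true_and] at hx ⊢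
    rw [W_apply_inv_self]; tauto
  · intro x hx
    simp only [Finset.mem_filter, Finset.mem_univ, true_and] at hx ⊢
    rw [W_inv_apply_self]; tauto
  · intro x _; simp
  · intro x _; simp

theorem kappa_neg (l : Comp m n d) (g : W d) (μ : Comp m n d) (i j : Seg (m + n)) :
    kappa l g μ (neg i) (neg j) = kappa l g μ i j := by
  rw [kappa_apply, kappa_apply]
  refine Finset.card_bij' (fun x _ => neg x) (fun x _ => neg x) ?_ ?_ ?_ ?_
  · intro x hx
    simp only [Finset.mem_filter, Finset.mem_univ, true_and] at hx ⊢
    rw [W_neg, blk_neg, blk_neg, hx.1, hx.2, neg_neg', neg_neg']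
    exact ⟨rfl, rfl⟩
  · intro x hx
    simp only [Finset.mem_filter, Finset.mem_univ, true_and] at hx ⊢
    rw [W_neg, blk_neg, blk_neg, hx.1, hx.2]
    exact ⟨rfl, rfl⟩
  · intro x _; simp
  · intro x _; simp

/-- Monotone maps with equally large fibres are equal. -/
theorem eq_of_monotone_of_card {X α : Type*} [Fintype X] [LinearOrder X] [LinearOrder α]
    {f g : X → α} (hf : Monotone f) (hg : Monotone g)
    (h : ∀ a, (Finset.univ.filter fun x => f x = a).card =
      (Finset.univ.filter fun x => g x = a).card) : f = g := by
  classical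
  have hle : ∀ a, (Finset.univ.filter fun x => f x ≤ a).card =
      (Finset.univ.filter fun x => g x ≤ a).card := by
    intro a
    -- The target may be infinite; only values taken by one of the two maps contribute.
    set S : Finset α := Finset.univ.image f ∪ Finset.univ.image g
    have key : ∀ k : X → α, (∀ x, k x ∈ S) → (Finset.univ.filter fun x => k x ≤ a).card =
        ∑ b ∈ S with b ≤ a, (Finset.univ.filter fun x => k x = b).card := by
      intro k hk
      rw [Finset.card_eq_sum_card_fiberwise (f := k) (t := S.filter (· ≤ a))]
      · refine Finset.sum_congr rfl fun b hb => congrArg Finset.card ?_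
        ext x
        simp only [Finset.mem_filter, Finset.mem_univ, true_and] at hb ⊢
        constructor
        · exact fun hh => hh.2
        · rintro rfl; exact ⟨hb.2, rfl⟩
      · intro x hx
        simp only [Finset.coe_filter, Finset.mem_univ, true_and, Set.mem_ofPred_eq] at hx ⊢
        exact ⟨hk x, hx⟩
    rw [key f fun x => by simp [S], key g fun x => by simp [S]]
    exact Finset.sum_congr rfl fun b _ => h b
  have main : ∀ f g : X → α, Monotone f → Monotone g →
      (∀ a, (Finset.univ.filter fun x => f x ≤ a).card =
        (Finset.univ.filter fun x => g x ≤ a).card) → ∀ x, g x ≤ f x := by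
    intro f g hf hg hle x
    by_contra hc
    rw [not_le] at hc
    -- If `f x < g x`, then at level `f x` the map `f` catches all `y ≤ x` while `g` catches only
    -- some `y < x`, against the equality of counts.
    have h1 : (Finset.univ.filter fun y => y ≤ x) ⊆ (Finset.univ.filter fun y => f y ≤ f x) := by
      intro y hy
      simp only [Finset.mem_filter, Finset.mem_univ, true_and] at hy ⊢
      exact hf hy
    have h2 : (Finset.univ.filter fun y => g y ≤ f x) ⊂ (Finset.univ.filter fun y => y ≤ x) := by
      refine Finset.ssubset_iff_subset_ne.2 ⟨fun y hy => ?_, fun he => ?_⟩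
      · simp only [Finset.mem_filter, Finset.mem_univ, true_and] at hy ⊢
        by_contra hxy
        exact absurd (hg (not_le.1 hxy).le) (not_le.2 (hy.trans_lt hc))
      · have : x ∈ Finset.univ.filter fun y => g y ≤ f x := by rw [he]; simp
        simp only [Finset.mem_filter, Finset.mem_univ, true_and] at this
        exact absurd hc (not_lt.2 this)
    have := Finset.card_le_card h1
    have := Finset.card_lt_card h2
    have := hle (f x)
    omega
  funext x
  exact le_antisymm (main g f hg hf (fun a => (hle a).symm) x) (main f g hf hg hle x)

/-- The labelling of `[-d..d]` by the entries of `κ(μ, g, ν)`, column by column. -/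
def entry (μ : Comp m n d) (g : W d) (ν : Comp m n d) (x : Seg d) :
    Seg (m + n) ×ₗ Seg (m + n) := toLex (blk ν x, blk μ (g.1 x))

theorem entry_eq_iff {μ : Comp m n d} {g : W d} {ν : Comp m n d} {x y : Seg d} :
    entry μ g ν x = entry μ g ν y ↔
      blk ν x = blk ν y ∧ blk μ (g.1 x) = blk μ (g.1 y) := by
  rw [entry, entry, toLex_inj, Prod.mk.injEq]

theorem entry_eq_iff' {μ : Comp m n d} {g : W d} {ν : Comp m n d} {x : Seg d}
    {p : Seg (m + n) ×ₗ Seg (m + n)} : entry μ g ν x = p ↔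
      blk ν x = (ofLex p).1 ∧ blk μ (g.1 x) = (ofLex p).2 := by
  rw [entry, ← toLex_ofLex p, toLex_inj, Prod.ext_iff]
  rfl

theorem entry_mono {μ : Comp m n d} {g : W d} {ν : Comp m n d} (hg : IncrOn (blk ν) g) :
    Monotone (entry μ g ν) := by
  intro x y h
  rw [entry, entry, Prod.Lex.toLex_le_toLex]
  rcases (blk_mono ν h).lt_or_eq with h1 | h1
  · exact Or.inl h1
  · refine Or.inr ⟨h1, ?_⟩
    rcases h.lt_or_eq with h2 | h2
    · exact blk_mono μ (hg x y h2 h1).le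
    · rw [h2]

theorem entry_neg_congr (μ : Comp m n d) (g : W d) (ν : Comp m n d) (x y : Seg d)
    (h : entry μ g ν x = entry μ g ν y) : entry μ g ν (neg x) = entry μ g ν (neg y) := by
  rw [entry_eq_iff] at h ⊢
  rw [W_neg, W_neg, blk_neg, blk_neg, blk_neg, blk_neg, h.1, h.2]
  exact ⟨rfl, rfl⟩

theorem card_entry (μ : Comp m n d) (g : W d) (ν : Comp m n d)
    (p : Seg (m + n) ×ₗ Seg (m + n)) :
    (Finset.univ.filter fun x => entry μ g ν x = p).card =
      kappa μ g ν (ofLex p).2 (ofLex p).1 := by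
  rw [kappa_apply]
  congr 1
  ext x
  rw [Finset.mem_filter, Finset.mem_filter, entry_eq_iff', and_comm (a := blk ν x = _)]

/-- Elements increasing on the blocks of `ν` with equal matrices map the points into the same
blocks of `μ`. -/
theorem blk_eq_of_kappa {μ ν : Comp m n d} {g u : W d} (hg : IncrOn (blk ν) g)
    (hu : IncrOn (blk ν) u) (h : kappa μ g ν = kappa μ u ν) (x : Seg d) :
    blk μ (g.1 x) = blk μ (u.1 x) := by
  have := eq_of_monotone_of_card (entry_mono (μ := μ) hg) (entry_mono (μ := μ) hu) fun a => by
    have := card_entry μ g ν a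
    rw [h, ← card_entry μ u ν a] at this
    convert this
  have := congrFun this x
  rw [entry, entry, toLex_inj, Prod.mk.injEq] at this
  exact this.2

end Blocks

/-! ### The composition `δ` -/

section Delta

variable {m n d : ℕ}

theorem card_pos_le {t : ℕ} (ht : t ≤ d) :
    (Finset.univ.filter fun x : Seg d => 0 < x.1 ∧ x.1 ≤ t).card = t := by
  have : (Finset.univ.filter fun x : Seg d => 0 < x.1 ∧ x.1 ≤ t).image Subtype.val =
      Finset.Ioc (0 : ℤ) t := by
    ext z
    simp only [Finset.mem_image, Finset.mem_filter, Finset.mem_univ, true_and, Finset.mem_Ioc]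
    constructor
    · rintro ⟨x, hx, rfl⟩; exact hx
    · intro hz; exact ⟨⟨z, by constructor <;> omega⟩, hz, rfl⟩
  rw [← Finset.card_image_of_injective _ Subtype.val_injective, this]
  simp

theorem blk_zero (l : Comp m n d) {x : Seg d} (h : x.1 = 0) : blk l x = zeroIdx (m + n) := by
  apply Subtype.ext
  rw [blk_val, h]
  simp [blkNat_zero, zeroIdx]

theorem entry_zero (μ : Comp m n d) (g : W d) (ν : Comp m n d) {x : Seg d} (h : x.1 = 0) :
    entry μ g ν x = toLex (zeroIdx (m + n), zeroIdx (m + n)) := by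
  rw [entry, blk_zero ν h, blk_zero μ (W_zero g h)]

/-- Negation pairs the positive with the negative elements and `0` is left over. -/
theorem card_eq_of_neg_mem (S : Finset (Seg d)) (hS : ∀ x, x ∈ S → neg x ∈ S)
    (h0 : zeroIdx d ∈ S) : S.card = 2 * (S.filter fun x => 0 < x.1).card + 1 := by
  have h1 := Finset.card_filter_add_card_filter_not (s := S) fun x => 0 < x.1
  have h2 := Finset.card_filter_add_card_filter_not (s := S.filter fun x => ¬ 0 < x.1)
    fun x => x.1 < 0
  have h3 : (S.filter fun x => ¬ 0 < x.1).filter (fun x => ¬ x.1 < 0) = {zeroIdx d} := by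
    ext x
    simp only [Finset.mem_filter, Finset.mem_singleton, Subtype.ext_iff, zeroIdx]
    constructor
    · rintro ⟨⟨-, h⟩, h'⟩; omega
    · intro h
      have : x = zeroIdx d := Subtype.ext h
      exact ⟨⟨this ▸ h0, by omega⟩, by omega⟩
  have h4 : ((S.filter fun x => ¬ 0 < x.1).filter fun x => x.1 < 0).card =
      (S.filter fun x => 0 < x.1).card := by
    refine Finset.card_bij' (fun x _ => neg x) (fun x _ => neg x) ?_ ?_ ?_ ?_
    · intro x hx
      simp only [Finset.mem_filter, neg_val] at hx ⊢
      exact ⟨hS _ hx.1.1, by omega⟩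
    · intro x hx
      simp only [Finset.mem_filter, neg_val] at hx ⊢
      exact ⟨⟨hS _ hx.1, by omega⟩, by omega⟩
    · intro x _; simp
    · intro x _; simp
  rw [h3, Finset.card_singleton] at h2
  omega

theorem zeroIdx_neg (k : ℕ) : neg (zeroIdx k) = zeroIdx k := neg_eq_self.2 rfl

-- The central entry counts a symmetric set containing `0`, so `(a₀₀ - 1) / 2` is its positive half.
-- An index above `(0, 0)` is attained only at positive points, because the labelling is monotone
-- and takes the value `(0, 0)` at the point `0`.
open Classical in
theorem delta_eq {μ : Comp m n d} {g : W d} {ν : Comp m n d} (hg : IncrOn (blk ν) g)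
    (p : DeltaIdx (m + n)) : delta (kappa μ g ν) p =
      (Finset.univ.filter fun x => 0 < x.1 ∧ entry μ g ν x = p.1).card := by
  rw [delta]
  split_ifs with hp
  · have := card_eq_of_neg_mem (Finset.univ.filter fun x => entry μ g ν x = p.1) (by
      intro x hx
      simp only [Finset.mem_filter, Finset.mem_univ, true_and] at hx ⊢
      rw [entry_eq_iff', hp] at hx ⊢
      rw [W_neg, blk_neg, blk_neg, hx.1, hx.2]
      exact ⟨zeroIdx_neg _, zeroIdx_neg _⟩) (by
      simp only [Finset.mem_filter, Finset.mem_univ, true_and]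
      rw [entry_zero μ g ν rfl]
      exact (congrArg toLex hp).symm)
    rw [Finset.filter_filter] at this
    have e := card_entry μ g ν p.1
    rw [hp] at e
    simp only [and_comm] at this ⊢
    rw [← e]
    convert congrArg (fun t => (t - 1) / 2) this using 1
    simp
  · rw [← card_entry μ g ν p.1]
    congr 1
    ext x
    simp only [Finset.mem_filter, Finset.mem_univ, true_and]
    refine ⟨fun h => ⟨?_, h⟩, fun h => h.2⟩
    by_contra hx
    have hx' : x ≤ zeroIdx d := by
      rw [← Subtype.coe_le_coe]; exact not_lt.1 hx
    have h1 := entry_mono (μ := μ) hg hx'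
    rw [h, entry_zero μ g ν rfl] at h1
    apply hp
    rw [le_antisymm h1 p.2]
    rfl

open Classical in
theorem psum_delta {μ : Comp m n d} {g : W d} {ν : Comp m n d} (hg : IncrOn (blk ν) g)
    (p : DeltaIdx (m + n)) : psum (delta (kappa μ g ν)) p =
      (Finset.univ.filter fun x => 0 < x.1 ∧ entry μ g ν x ≤ p.1).card := by
  rw [psum]
  have hpos : ∀ x : Seg d, 0 < x.1 → toLex (zeroIdx (m + n), zeroIdx (m + n)) ≤ entry μ g ν x := by
    intro x hx
    rw [← entry_zero μ g ν (x := zeroIdx d) rfl]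
    exact entry_mono hg (by rw [← Subtype.coe_le_coe]; exact hx.le)
  -- The value `p` at nonpositive points is a filler; these points are not counted.
  let F : Seg d → DeltaIdx (m + n) := fun x =>
    if h : 0 < x.1 then ⟨entry μ g ν x, hpos x h⟩ else p
  have hF : ∀ x, 0 < x.1 → (F x).1 = entry μ g ν x := by
    intro x hx
    simp only [F, dif_pos hx]
  rw [Finset.card_eq_sum_card_fiberwise (f := F) (t := Finset.univ.filter (· ≤ p))]
  · refine Finset.sum_congr (by ext; simp) fun j hj => ?_
    simp only [Finset.mem_filter, Finset.mem_univ, true_and] at hj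
    rw [delta_eq hg]
    congr 1
    ext x
    simp only [Finset.mem_filter, Finset.mem_univ, true_and]
    constructor
    · rintro ⟨h1, h2⟩
      exact ⟨⟨h1, h2 ▸ hj⟩, Subtype.ext (by rw [hF x h1, h2])⟩
    · rintro ⟨⟨h1, -⟩, rfl⟩
      exact ⟨h1, (hF x h1).symm⟩
  · intro x hx
    simp only [Finset.coe_filter, Finset.mem_univ, true_and, Set.mem_ofPred_eq] at hx ⊢
    rw [← Subtype.coe_le_coe, hF x hx.1]
    exact hx.2

/-- The partial sum at `p` counts the positive points with label at most `p`. They form an initial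
segment of `1, …, d`, so its end lies at `k` for some `p` precisely when the label changes between
`k` and `k + 1`. -/
theorem ne_psum_delta_iff {μ : Comp m n d} {g : W d} {ν : Comp m n d} (hg : IncrOn (blk ν) g)
    (k : Fin d) : entry μ g ν (lo k) = entry μ g ν (hi k) ↔
      ∀ p, k.1 ≠ psum (delta (kappa μ g ν)) p := by
  classical
  have hm := entry_mono (μ := μ) hg
  constructor
  · intro h p hp
    rw [psum_delta hg] at hp
    by_cases hi' : entry μ g ν (hi k) ≤ p.1
    · have := card_pos_le (d := d) (t := k.1 + 1) k.2
      have hs := Finset.card_le_card (s := Finset.univ.filter fun x : Seg d =>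
        0 < x.1 ∧ x.1 ≤ ((k.1 + 1 : ℕ) : ℤ)) (t := Finset.univ.filter fun x : Seg d =>
        0 < x.1 ∧ entry μ g ν x ≤ p.1) (by
          intro x hx
          simp only [Finset.mem_filter, Finset.mem_univ, true_and] at hx ⊢
          refine ⟨hx.1, le_trans (hm ?_) hi'⟩
          rw [← Subtype.coe_le_coe, hi_val]
          have := hx.2
          push_cast at this
          exact this)
      omega
    -- For `k = 0` the label of `lo k` would be the least index, which is at most `p`. So `k - 1`
    -- below is a true subtraction.
    · have h0 : k.1 ≠ 0 := fun h0 => by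
        apply hi'
        rw [← h, entry_zero μ g ν (by simp [h0])]
        exact p.2
      have := card_pos_le (d := d) (t := k.1 - 1) (by omega)
      have hs := Finset.card_le_card (t := Finset.univ.filter fun x : Seg d =>
        0 < x.1 ∧ x.1 ≤ ((k.1 - 1 : ℕ) : ℤ)) (s := Finset.univ.filter fun x : Seg d =>
        0 < x.1 ∧ entry μ g ν x ≤ p.1) (by
          intro x hx
          simp only [Finset.mem_filter, Finset.mem_univ, true_and] at hx ⊢
          refine ⟨hx.1, ?_⟩
          by_contra hc
          apply hi'
          rw [← h]
          refine le_trans (hm ?_) hx.2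
          rw [← Subtype.coe_le_coe, lo_val]
          omega)
      omega
  · intro h
    by_contra hne
    have hlt := lt_of_le_of_ne (hm (lo_lt_hi k).le) hne
    have h0 : toLex (zeroIdx (m + n), zeroIdx (m + n)) ≤ entry μ g ν (lo k) := by
      rw [← entry_zero μ g ν (x := zeroIdx d) rfl]
      exact hm (by rw [← Subtype.coe_le_coe, lo_val]; simp [zeroIdx])
    apply h ⟨_, h0⟩
    rw [psum_delta hg]
    have := card_pos_le (d := d) (t := k.1) k.2.le
    conv_lhs => rw [← this]
    congr 1
    ext x
    simp only [Finset.mem_filter, Finset.mem_univ, true_and]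
    refine and_congr_right fun _ => ⟨fun hx => hm ?_, fun hx => ?_⟩
    · rw [← Subtype.coe_le_coe, lo_val]; exact hx
    · by_contra hc
      refine absurd hlt (not_lt.2 (le_trans (hm ?_) hx))
      rw [← Subtype.coe_le_coe, hi_val]
      omega

/-- Preserving `entry` means preserving the blocks of `ν` and, after conjugation by `g`, those of
`μ`: the parabolic subgroup of `δ` is `g⁻¹ W_μ g ∩ W_ν`. -/
theorem mem_parabolic_delta {μ : Comp m n d} {g : W d} {ν : Comp m n d}
    (hg : IncrOn (blk ν) g) (w : W d) : w ∈ parabolic d (delta (kappa μ g ν)) ↔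
      ∀ x, entry μ g ν (w.1 x) = entry μ g ν x :=
  mem_closure_iff_label (entry_mono hg) (entry_neg_congr μ g ν)
    (by simp only [ne_psum_delta_iff hg]) w

theorem mem_minRight_delta {μ : Comp m n d} {g : W d} {ν : Comp m n d}
    (hg : IncrOn (blk ν) g) (w : W d) : w ∈ minRight (parabolic d (delta (kappa μ g ν))) ↔
      IncrOn (entry μ g ν) w⁻¹ :=
  mem_minRight_iff (entry_mono hg) (entry_neg_congr μ g ν) (mem_parabolic_delta hg) w

/-! ### Minimal double coset representatives -/

/-- `g` is increasing on the blocks of `ν` and `g⁻¹` is increasing on the blocks of `μ`. -/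
def LocMin (μ : Comp m n d) (g : W d) (ν : Comp m n d) : Prop :=
  IncrOn (blk ν) g ∧ IncrOn (blk μ) g⁻¹

theorem incrOn_blk_iff (l : Comp m n d) {g : W d} :
    IncrOn (blk l) g ↔ ∀ k, blk l (lo k) = blk l (hi k) → Up g k :=
  incrOn_iff (blk_mono l) (blk_neg_congr l)

theorem s_mem_Wl {l : Comp m n d} {k : Fin d} (hk : blk l (lo k) = blk l (hi k)) : s k ∈ Wl l :=
  (mem_Wl l _).2 (label_s (blk_neg_congr l) hk)

theorem locMin_of_forall_le {μ : Comp m n d} {g : W d} {ν : Comp m n d}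
    (hr : ∀ y ∈ Wl ν, len g ≤ len (g * y)) (hl : ∀ x ∈ Wl μ, len g ≤ len (x * g)) :
    LocMin μ g ν := by
  constructor
  · rw [incrOn_blk_iff]
    intro k hk
    by_contra hu
    have := len_mul_s' hu
    have := hr _ (s_mem_Wl hk)
    omega
  · rw [incrOn_blk_iff]
    intro k hk
    by_contra hu
    have := len_s_mul' hu
    have := hl _ (s_mem_Wl hk)
    omega

theorem locMin_of_mem_minDouble {μ : Comp m n d} {g : W d} {ν : Comp m n d}
    (h : g ∈ minDouble μ ν) : LocMin μ g ν :=
  locMin_of_forall_le (fun y hy => by simpa using h 1 (one_mem _) y hy)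
    (fun x hx => by simpa using h x hx 1 (one_mem _))

/-- If `u⁻¹` is increasing on the blocks of `μ` and has the matrix of `g`, it differs from `g` by
an element of `W_ν`. -/
theorem inv_mul_mem_of_kappa {μ ν : Comp m n d} {g u : W d} (hg : IncrOn (blk μ) g⁻¹)
    (hu : IncrOn (blk μ) u⁻¹) (h : kappa μ g ν = kappa μ u ν) : g⁻¹ * u ∈ Wl ν := by
  rw [mem_Wl]
  intro x
  have h' : kappa ν g⁻¹ μ = kappa ν u⁻¹ μ := by
    ext i j; rw [kappa_inv, kappa_inv, h]
  rw [W_mul_apply, blk_eq_of_kappa hg hu h', W_inv_apply_self]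

/-- The two elements differ by some `w ∈ W_ν`, and each is shortest in its coset by `W_ν`; each is
therefore longer than the other by `len w`, so `w = 1`. -/
theorem LocMin.eq {μ ν : Comp m n d} {g u : W d} (hg : LocMin μ g ν) (hu : LocMin μ u ν)
    (h : kappa μ g ν = kappa μ u ν) : g = u := by
  have hw := inv_mul_mem_of_kappa hg.2 hu.2 h
  rw [mem_Wl] at hw
  have h1 := hg.1.len_mul (blk_mono ν) hw
  have h2 := hu.1.len_mul (blk_mono ν) (label_inv hw)
  rw [mul_inv_cancel_left] at h1
  rw [mul_inv_rev, inv_inv, mul_inv_cancel_left] at h2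
  have := eq_one_of_len (w := g⁻¹ * u) (by omega)
  rwa [inv_mul_eq_one] at this

/-- The elements with a given matrix form a set stable under `W_μ` and `W_ν`, so one of least length
in it is minimal in its double coset. -/
theorem exists_minDouble_of_kappa (μ : Comp m n d) (w : W d) (ν : Comp m n d) :
    ∃ g ∈ minDouble μ ν, kappa μ g ν = kappa μ w ν := by
  obtain ⟨g, hg, hmin⟩ := Set.exists_min_image {g | kappa μ g ν = kappa μ w ν} len
    (Set.toFinite _) ⟨w, rfl⟩
  refine ⟨g, fun x hx y hy => hmin _ ?_, hg⟩
  change kappa μ (x * g * y) ν = kappa μ w ν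
  rw [kappa_mul μ g ν hx hy]
  exact hg

/-- Minimality on each side separately suffices: by uniqueness, such an element equals the shortest
one with the same matrix. -/
theorem mem_minDouble_iff {μ : Comp m n d} {g : W d} {ν : Comp m n d} :
    g ∈ minDouble μ ν ↔ LocMin μ g ν := by
  refine ⟨locMin_of_mem_minDouble, fun h => ?_⟩
  obtain ⟨u, hu, he⟩ := exists_minDouble_of_kappa μ g ν
  rwa [h.eq (locMin_of_mem_minDouble hu) he.symm]

end Delta

/-! ### The even-odd trivial intersection property -/

section Circ

variable {m n d : ℕ}

/-- Two points that `w` carries from one block into one block lie in blocks of equal parity. -/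
def ParityCompatible (μ : Comp m n d) (w : W d) (ν : Comp m n d) : Prop :=
  ∀ x y, x ≠ y → blk ν x = blk ν y → blk μ (w.1 x) = blk μ (w.1 y) →
    (IsOdd m (blk ν x) ↔ IsOdd m (blk μ (w.1 x)))

theorem parityCompatible_iff {μ : Comp m n d} {w : W d} {ν : Comp m n d} :
    ParityCompatible μ w ν ↔ ∀ i j, parity m i ≠ parity m j →
      kappa μ w ν i j = 0 ∨ kappa μ w ν i j = 1 := by
  simp only [parity_ne_iff, ← Nat.le_one_iff_eq_zero_or_eq_one, kappa_apply, Finset.card_le_one,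
    Finset.mem_filter, Finset.mem_univ, true_and]
  constructor
  · intro h i j hij x hx y hy
    by_contra hne
    have := h x y hne (hx.2.trans hy.2.symm) (hx.1.trans hy.1.symm)
    rw [hx.1, hx.2] at this
    exact hij this.symm
  · intro h x y hne h1 h2
    by_contra hc
    exact hne (h _ _ (fun h' => hc h'.symm) x ⟨rfl, rfl⟩ y ⟨h2.symm, h1.symm⟩)

/-! ### Sums of the entries and membership in `Ξ` -/

theorem card_seg (d : ℕ) : Fintype.card (Seg d) = 2 * d + 1 := by
  have := card_eq_of_neg_mem (Finset.univ : Finset (Seg d)) (fun _ _ => Finset.mem_univ _)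
    (Finset.mem_univ _)
  rw [← Finset.card_univ, this]
  have h := card_pos_le (d := d) le_rfl
  have e : (Finset.univ.filter fun x : Seg d => 0 < x.1) =
      Finset.univ.filter fun x : Seg d => 0 < x.1 ∧ x.1 ≤ d := by
    ext x
    simp only [Finset.mem_filter, Finset.mem_univ, true_and]
    exact ⟨fun h => ⟨h, x.2.2⟩, fun h => h.1⟩
  rw [e, h]

theorem sum_kappa_row (μ : Comp m n d) (w : W d) (ν : Comp m n d) (i : Seg (m + n)) :
    ∑ j, kappa μ w ν i j = (Finset.univ.filter fun x : Seg d => blk μ x = i).card := by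
  have e : (Finset.univ.filter fun x : Seg d => blk μ x = i).card =
      (Finset.univ.filter fun x : Seg d => blk μ (w.1 x) = i).card := by
    refine Finset.card_bij' (fun x _ => (w⁻¹).1 x) (fun x _ => w.1 x) ?_ ?_ ?_ ?_ <;> simp
  rw [e, Finset.card_eq_sum_card_fiberwise (f := blk ν) (t := Finset.univ) (by simp)]
  refine Finset.sum_congr rfl fun j _ => ?_
  rw [kappa_apply, Finset.filter_filter]

theorem sum_kappa (μ : Comp m n d) (w : W d) (ν : Comp m n d) :
    ∑ i, ∑ j, kappa μ w ν i j = 2 * d + 1 := by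
  simp only [sum_kappa_row]
  rw [← Finset.card_eq_sum_card_fiberwise (f := blk μ) (t := Finset.univ) (by simp),
    Finset.card_univ, card_seg]

theorem kappa_mem_Xi {μ : Comp m n d} {w : W d} {ν : Comp m n d} :
    kappa μ w ν ∈ Xi m n d ↔ ParityCompatible μ w ν := by
  rw [parityCompatible_iff]
  exact ⟨fun h => h.2.2, fun h => ⟨sum_kappa μ w ν, kappa_neg μ w ν, h⟩⟩

/-- The signed transposition of `x` and `y`. -/
def signedSwap (x y : Seg d) (hx : x ≠ neg x) (hy : y ≠ neg y) (hxy : x ≠ neg y) : W d :=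
  ⟨Equiv.swap x y * Equiv.swap (neg x) (neg y), by
    have key : ∀ (a b z : Seg d), neg (Equiv.swap a b z) = Equiv.swap (neg a) (neg b) (neg z) := by
      intro a b z
      simp only [Equiv.swap_apply_def, neg_inj]
      split_ifs <;> rfl
    have hd : (Equiv.swap x y * Equiv.swap (neg x) (neg y) : Equiv.Perm (Seg d)) =
        Equiv.swap (neg x) (neg y) * Equiv.swap x y := by
      apply Equiv.Perm.Disjoint.commute
      intro z
      by_cases hz : z = x ∨ z = y
      · right
        have hyx : y ≠ neg x := fun h => hxy (by rw [h, neg_neg'])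
        apply Equiv.swap_apply_of_ne_of_ne <;> rcases hz with rfl | rfl <;> assumption
      · left
        push Not at hz
        exact Equiv.swap_apply_of_ne_of_ne hz.1 hz.2
    intro z
    rw [Equiv.Perm.mul_apply, Equiv.Perm.mul_apply, key, key, neg_neg', neg_neg',
      ← Equiv.Perm.mul_apply, hd, Equiv.Perm.mul_apply]⟩

theorem signedSwap_left {x y : Seg d} (hx : x ≠ neg x) (hy : y ≠ neg y) (hxy : x ≠ neg y) :
    (signedSwap x y hx hy hxy).1 x = y := by
  rw [signedSwap, Equiv.Perm.mul_apply, Equiv.swap_apply_of_ne_of_ne hx hxy, Equiv.swap_apply_left]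

theorem signedSwap_cases {x y : Seg d} (hx : x ≠ neg x) (hy : y ≠ neg y) (hxy : x ≠ neg y)
    (z : Seg d) : (signedSwap x y hx hy hxy).1 z = z ∨
      (z = x ∧ (signedSwap x y hx hy hxy).1 z = y) ∨
      (z = y ∧ (signedSwap x y hx hy hxy).1 z = x) ∨
      (z = neg x ∧ (signedSwap x y hx hy hxy).1 z = neg y) ∨
      (z = neg y ∧ (signedSwap x y hx hy hxy).1 z = neg x) := by
  have hyx : y ≠ neg x := fun h => hxy (by rw [h, neg_neg'])
  by_cases h1 : z = x
  · exact Or.inr (Or.inl ⟨h1, by rw [h1, signedSwap_left]⟩)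
  by_cases h2 : z = y
  · refine Or.inr (Or.inr (Or.inl ⟨h2, ?_⟩))
    rw [h2, signedSwap, Equiv.Perm.mul_apply, Equiv.swap_apply_of_ne_of_ne hyx hy,
      Equiv.swap_apply_right]
  by_cases h3 : z = neg x
  · refine Or.inr (Or.inr (Or.inr (Or.inl ⟨h3, ?_⟩)))
    rw [h3, W_neg, signedSwap_left]
  by_cases h4 : z = neg y
  · refine Or.inr (Or.inr (Or.inr (Or.inr ⟨h4, ?_⟩)))
    rw [h4, W_neg, signedSwap, Equiv.Perm.mul_apply, Equiv.swap_apply_of_ne_of_ne hyx hy,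
      Equiv.swap_apply_right]
  left
  rw [signedSwap, Equiv.Perm.mul_apply, Equiv.swap_apply_of_ne_of_ne h3 h4,
    Equiv.swap_apply_of_ne_of_ne h1 h2]

theorem not_isOdd_of_neg {l : Comp m n d} {x : Seg d} (h : blk l (neg x) = blk l x) :
    ¬ IsOdd m (blk l x) := by
  rw [blk_neg, neg_eq_self] at h
  rw [IsOdd, h, abs_zero]
  omega

/-- Two points that share a block on both sides, with unequal parities, give a signed transposition
in the forbidden intersection. Conversely, a point `x` moved by an element `w` of the intersection
forms such a pair with `w x`. -/
theorem mem_minDoubleCirc_iff {μ : Comp m n d} {g : W d} {ν : Comp m n d} :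
    g ∈ minDoubleCirc μ ν ↔ LocMin μ g ν ∧ ParityCompatible μ g ν := by
  rw [minDoubleCirc, Set.mem_ofPred_eq, mem_minDouble_iff]
  refine and_congr_right fun _ => ⟨fun ⟨h1, h2⟩ x y hne hν hμ => ?_, fun h => ⟨?_, ?_⟩⟩
  · by_contra hc
    -- A point that shares both blocks with its negative lies in the central blocks, which are even
    -- on both sides. This excludes the degenerate positions in which the signed transposition is
    -- not available.
    have h0 : ∀ z : Seg d, blk ν z = blk ν x → blk μ (g.1 z) = blk μ (g.1 x) →
        blk ν (neg z) = blk ν x → blk μ (g.1 (neg z)) = blk μ (g.1 x) → False := by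
      intro z e1 e2 e3 e4
      have o1 := not_isOdd_of_neg (e3.trans e1.symm)
      rw [W_neg] at e4
      have o2 := not_isOdd_of_neg (e4.trans e2.symm)
      rw [e1] at o1
      rw [e2] at o2
      tauto
    have hx : x ≠ neg x := fun h => h0 x rfl rfl (by rw [← h]) (by rw [← h])
    have hy : y ≠ neg y := fun h => h0 y hν.symm hμ.symm (by rw [← h, hν]) (by rw [← h, hμ])
    have hxy : x ≠ neg y := fun h => h0 y hν.symm hμ.symm (by rw [← h]) (by rw [← h])
    have hw : signedSwap x y hx hy hxy ≠ 1 := fun h => hne (by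
      have := signedSwap_left hx hy hxy
      rwa [h, W_one_apply] at this)
    -- Applied with `u = 1` for `ν` and with `u = g` for `μ`: the conjugate preserves blocks and
    -- moves points only in blocks of the parity of `u x`.
    have key : ∀ (l : Comp m n d) (u : W d), blk l (u.1 x) = blk l (u.1 y) → ∀ z,
        blk l ((u * signedSwap x y hx hy hxy * u⁻¹).1 z) = blk l z ∧
        (¬ (IsOdd m (blk l z) ↔ IsOdd m (blk l (u.1 x))) →
          (u * signedSwap x y hx hy hxy * u⁻¹).1 z = z) := by
      intro l u e z
      obtain ⟨z, rfl⟩ := u.1.surjective z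
      rw [W_mul_apply, W_mul_apply, W_inv_apply_self]
      rcases signedSwap_cases hx hy hxy z with h | ⟨rfl, h⟩ | ⟨rfl, h⟩ | ⟨rfl, h⟩ | ⟨rfl, h⟩
      all_goals rw [h]
      · exact ⟨rfl, fun _ => rfl⟩
      · exact ⟨e.symm, fun hh => absurd Iff.rfl hh⟩
      · exact ⟨e, fun hh => absurd (by rw [e]) hh⟩
      · rw [W_neg, W_neg, blk_neg, blk_neg, e]
        exact ⟨rfl, fun hh => absurd (by rw [isOdd_neg]) hh⟩
      · rw [W_neg, W_neg, blk_neg, blk_neg, e]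
        exact ⟨rfl, fun hh => absurd (by rw [isOdd_neg]) hh⟩
    have k1 := key ν 1 hν
    simp only [one_mul, _root_.inv_one, mul_one, W_one_apply] at k1
    have k2 := key μ g hμ
    by_cases ho : IsOdd m (blk ν x)
    · refine hw (h2 _ ((mem_Wodd ν _).2 fun z => ⟨(k1 z).1, fun hz => (k1 z).2 ?_⟩)
        ((mem_Weven μ _).2 fun z => ⟨(k2 z).1, fun hz => (k2 z).2 ?_⟩)) <;> tauto
    · refine hw (h1 _ ((mem_Weven ν _).2 fun z => ⟨(k1 z).1, fun hz => (k1 z).2 ?_⟩)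
        ((mem_Wodd μ _).2 fun z => ⟨(k2 z).1, fun hz => (k2 z).2 ?_⟩)) <;> tauto
  · intro w hw hw'
    apply W_ext
    intro x
    rw [W_one_apply]
    by_contra hne
    have e1 := (mem_Weven ν w).1 hw x
    have e2 := (mem_Wodd μ _).1 hw' (g.1 x)
    rw [W_mul_apply, W_mul_apply, W_inv_apply_self, W_inj] at e2
    have := h x (w.1 x) (Ne.symm hne) e1.1.symm e2.1.symm
    tauto
  · intro w hw hw'
    apply W_ext
    intro x
    rw [W_one_apply]
    by_contra hne
    have e1 := (mem_Wodd ν w).1 hw x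
    have e2 := (mem_Weven μ _).1 hw' (g.1 x)
    rw [W_mul_apply, W_mul_apply, W_inv_apply_self, W_inj] at e2
    have := h x (w.1 x) (Ne.symm hne) e1.1.symm e2.1.symm
    tauto

theorem parityCompatible_congr {μ ν : Comp m n d} {w u : W d} (h : kappa μ w ν = kappa μ u ν) :
    ParityCompatible μ w ν ↔ ParityCompatible μ u ν := by
  rw [← kappa_mem_Xi, ← kappa_mem_Xi, h]

/-! ### The odd weight -/

/-- Both entries of the pair lie in the same odd block. -/
def OddPair (l : Comp m n d) (p : Seg d × Seg d) : Prop :=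
  blk l p.1 = blk l p.2 ∧ IsOdd m (blk l p.1)

open Classical in
/-- Half the number of inversions of `w` that lie in an odd block of `ν` or are carried into an odd
block of `μ`. -/
def oddWeight (μ : Comp m n d) (w : W d) (ν : Comp m n d) : ℕ :=
  ((inv w).filter fun p => OddPair ν p ∨ OddPair μ (w.1 p.1, w.1 p.2)).card / 2

theorem oddPair_neg {l : Comp m n d} {x y : Seg d} :
    OddPair l (neg y, neg x) ↔ OddPair l (x, y) := by
  simp only [OddPair, blk_neg, neg_inj, isOdd_neg]
  constructor <;> rintro ⟨h1, h2⟩ <;> exact ⟨h1.symm, h1 ▸ h2⟩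

theorem oddPair_swap {l : Comp m n d} {x y : Seg d} : OddPair l (y, x) ↔ OddPair l (x, y) := by
  simp only [OddPair]
  constructor <;> rintro ⟨h1, h2⟩ <;> exact ⟨h1.symm, h1 ▸ h2⟩

theorem oddPair_stab {l : Comp m n d} {w : W d} (hw : ∀ x, blk l (w.1 x) = blk l x)
    (p : Seg d × Seg d) : OddPair l (w.1 p.1, w.1 p.2) ↔ OddPair l p := by
  simp only [OddPair, hw]

-- The inversions of `w` are transported and the two of `s k` are added. The new ones count if the
-- block of `ν` is odd; if it is even, parity compatibility keeps them from being carried into an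
-- odd block of `μ`.
open Classical in
theorem oddWeight_mul_s {μ : Comp m n d} {w : W d} {ν : Comp m n d}
    (hp : ParityCompatible μ w ν) {k : Fin d} (hk : blk ν (lo k) = blk ν (hi k)) (hu : Up w k) :
    oddWeight μ (w * s k) ν = oddWeight μ w ν + if IsOdd m (blk ν (lo k)) then 1 else 0 := by
  have hs := label_s (blk_neg_congr ν) hk
  have h := card_inv_mul_filter w (s k) (up_pairs hu)
    fun p => OddPair ν p ∨ OddPair μ (w.1 ((s k).1 p.1), w.1 ((s k).1 p.2))
  have e : ((inv w).filter fun p => OddPair ν (((s k)⁻¹).1 p.1, ((s k)⁻¹).1 p.2) ∨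
      OddPair μ (w.1 ((s k).1 (((s k)⁻¹).1 p.1)), w.1 ((s k).1 (((s k)⁻¹).1 p.2)))) =
      (inv w).filter fun p => OddPair ν p ∨ OddPair μ (w.1 p.1, w.1 p.2) :=
    Finset.filter_congr fun p _ => by
      rw [oddPair_stab (label_inv hs), W_apply_inv_self, W_apply_inv_self]
  change ((inv (w * s k)).filter fun p => OddPair ν p ∨
    OddPair μ (w.1 ((s k).1 p.1), w.1 ((s k).1 p.2))).card / 2 = _
  rw [h, e, add_comm, oddWeight]
  have hp' : ParityCompatible μ (w * s k) ν :=
    (parityCompatible_congr (kappa_mul_right μ w ν (s_mem_Wl hk))).2 hp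
  have hlo : OddPair ν (lo k, hi k) ↔ IsOdd m (blk ν (lo k)) := by
    simp [OddPair, hk]
  split_ifs with ho
  · rw [Finset.filter_true_of_mem (s := inv (s k)), inv_s, Finset.card_pair (inv_s_ne k), Nat.add_div_right _ two_pos]
    intro p hp
    rw [inv_s, Finset.mem_insert, Finset.mem_singleton] at hp
    left
    rcases hp with rfl | rfl
    · exact hlo.2 ho
    · exact oddPair_neg.2 (hlo.2 ho)
  · rw [Finset.filter_false_of_mem (s := inv (s k)), Finset.card_empty]
    · simp
    have key : ¬ (OddPair ν (lo k, hi k) ∨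
        OddPair μ (w.1 ((s k).1 (lo k)), w.1 ((s k).1 (hi k)))) := by
      rintro (h | h)
      · exact ho (hlo.1 h)
      · exact ho ((hp' (lo k) (hi k) (lo_ne_hi k) hk h.1).2 h.2)
    intro p hp
    rw [inv_s, Finset.mem_insert, Finset.mem_singleton] at hp
    rcases hp with rfl | rfl
    · exact key
    · simpa only [W_neg, oddPair_neg] using key

/-- The map `(x, y) ↦ (w y, w x)` matches the inversions of `w` with those of `w⁻¹` and exchanges
the two conditions. -/
theorem oddWeight_inv (μ : Comp m n d) (w : W d) (ν : Comp m n d) :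
    oddWeight ν w⁻¹ μ = oddWeight μ w ν := by
  classical
  rw [oddWeight, oddWeight]
  congr 1
  have key : ∀ (μ ν : Comp m n d) (w : W d) (p : Seg d × Seg d),
      p ∈ (inv w).filter (fun p => OddPair ν p ∨ OddPair μ (w.1 p.1, w.1 p.2)) →
      (w.1 p.2, w.1 p.1) ∈ (inv w⁻¹).filter
        (fun p => OddPair μ p ∨ OddPair ν ((w⁻¹).1 p.1, (w⁻¹).1 p.2)) := by
    rintro μ ν w ⟨x, y⟩ hp
    simp only [Finset.mem_filter, mem_inv, W_inv_apply_self] at hp ⊢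
    refine ⟨⟨hp.1.2.1, hp.1.1, ?_⟩, by rw [oddPair_swap, oddPair_swap (l := ν)]; tauto⟩
    rw [← W_neg, ne_eq, W_inj]
    intro h
    exact hp.1.2.2 (by rw [← h, neg_neg'])
  refine Finset.card_bij' (fun p _ => ((w⁻¹).1 p.2, (w⁻¹).1 p.1)) (fun p _ => (w.1 p.2, w.1 p.1))
    (fun p hp => ?_) (fun p hp => key μ ν w p hp) (fun p _ => by simp) (fun p _ => by simp)
  have := key ν μ w⁻¹ p hp
  simpa only [inv_inv] using this

-- All inversions of `b` lie in odd blocks, since `b` fixes the even points; no inversion of `a`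
-- does, since `a` fixes the odd ones.
open Classical in
theorem card_oddPair_inv {l : Comp m n d} {a b : W d} (ha : a ∈ Weven l) (hb : b ∈ Wodd l) :
    ((inv (a * b)).filter fun p => OddPair l p).card = 2 * len b := by
  have h := card_inv_mul_filter a b ((incrOn_even ha).mul_inv_lt (refine_mono _ l)
    (refine_stab_iff.2 ((mem_Wodd l b).1 hb))) (OddPair l)
  rw [h, ← card_inv]
  have hb' := (mem_Wodd l b).1 hb
  have ha' := (mem_Weven l a).1 ha
  rw [Finset.filter_true_of_mem, Finset.filter_false_of_mem, Finset.card_empty, add_zero]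
  · intro p hp
    rw [oddPair_stab (label_inv fun x => (hb' x).1)]
    intro ho
    obtain ⟨h1, h2, -⟩ := mem_inv.1 hp
    rw [(ha' _).2 ho.2, (ha' _).2 (ho.1 ▸ ho.2)] at h2
    exact lt_asymm h1 h2
  · intro p hp
    obtain ⟨h1, h2, -⟩ := mem_inv.1 hp
    refine ⟨label_eq_of_inv (blk_mono l) (fun x => (hb' x).1) h1 h2, ?_⟩
    by_contra ho
    have hl := label_eq_of_inv (blk_mono l) (fun x => (hb' x).1) h1 h2
    rw [(hb' _).2 ho, (hb' _).2 (hl ▸ ho)] at h2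
    exact lt_asymm h1 h2

theorem oddWeight_parabolic {l : Comp m n d} {a b : W d} (ha : a ∈ Weven l) (hb : b ∈ Wodd l) :
    oddWeight l (a * b) l = len b := by
  classical
  have hab := (mem_Wl l _).1 (mul_mem (Weven_le l ha) (Wodd_le l hb))
  rw [oddWeight]
  simp only [oddPair_stab hab, or_self]
  rw [card_oddPair_inv ha hb]
  omega

/-- No inversion is carried into a block of `μ`, because the inverse is increasing there, and `g`
has no inversion inside a block of `ν`. Only the inversions of `b` count. -/
theorem oddWeight_minRight {μ : Comp m n d} {g : W d} {ν : Comp m n d} (hg : IncrOn (blk ν) g)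
    {a b : W d} (ha : a ∈ Weven ν) (hb : b ∈ Wodd ν) (hu : IncrOn (blk μ) (g * (a * b))⁻¹) :
    oddWeight μ (g * (a * b)) ν = len b := by
  classical
  have hab := (mem_Wl ν _).1 (mul_mem (Weven_le ν ha) (Wodd_le ν hb))
  have h := card_inv_mul_filter g (a * b) (hg.mul_inv_lt (blk_mono ν) hab) (OddPair ν)
  rw [oddWeight]
  have e : (inv (g * (a * b))).filter (fun p => OddPair ν p ∨
      OddPair μ ((g * (a * b)).1 p.1, (g * (a * b)).1 p.2)) =
      (inv (g * (a * b))).filter fun p => OddPair ν p := by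
    refine Finset.filter_congr fun p hp => or_iff_left fun ho => ?_
    obtain ⟨h1, h2, -⟩ := mem_inv.1 hp
    have := hu _ _ h2 ho.1.symm
    rw [W_inv_apply_self, W_inv_apply_self] at this
    exact lt_asymm h1 this
  rw [e, h, card_oddPair_inv ha hb, Finset.filter_false_of_mem (s := inv g)]
  · simp
  · intro p hp
    rw [oddPair_stab (label_inv hab)]
    intro ho
    obtain ⟨h1, h2, -⟩ := mem_inv.1 hp
    exact lt_asymm h2 (hg _ _ h1 ho.1)

end Circ

/-! ### Functions on the group with a left or right sign rule -/

section Eigen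

variable {m n d : ℕ}

theorem negQPow_add (a b : ℕ) : negQPow (a + b) = negQPow a * negQPow b := by
  rw [negQPow, negQPow, negQPow, ← Units.val_mul, ← zpow_add]
  congr 2
  push_cast
  ring

theorem negQPow_zero : negQPow 0 = 1 := by simp [negQPow]

theorem q_mul_negQPow_one : (q : LaurentA) * negQPow 1 = -1 := by
  have : (((-q : LaurentAˣ) * (-q) ^ (-((1 : ℕ) : ℤ)) : LaurentAˣ) : LaurentA) = 1 := by
    rw [Nat.cast_one, zpow_neg_one, mul_inv_cancel, Units.val_one]
  rw [Units.val_mul, Units.val_neg] at this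
  rw [negQPow]
  linear_combination -this

theorem q_ne_zero : (q : LaurentA) ≠ 0 := q.ne_zero

theorem negQPow_ne_one {k : ℕ} (hk : k ≠ 0) : negQPow k ≠ 1 := by
  intro h
  have h1 : ((-q : LaurentAˣ) : LaurentA) ^ k = 1 := by
    rw [negQPow, Units.val_eq_one, zpow_neg, inv_eq_one, zpow_natCast] at h
    rw [← Units.val_pow_eq_pow_val, h, Units.val_one]
  -- Squaring removes the sign `(-1) ^ k` and leaves a power of `v`, which is `1` only for exponent
  -- `0`.
  have h2 : ((q : LaurentA) ^ k) ^ 2 = 1 := by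
    rw [Units.val_neg, neg_pow] at h1
    have : ((-1 : LaurentA) ^ k) ^ 2 = 1 := by rw [← pow_mul, mul_comm, pow_mul]; simp
    have h3 := congrArg (· ^ 2) h1
    simpa [mul_pow, this] using h3
  have h3 : (q : LaurentA) = LaurentPolynomial.T 2 := by
    rw [q, Units.val_pow_eq_pow_val]
    change LaurentPolynomial.T 1 ^ 2 = _
    rw [LaurentPolynomial.T_pow]
    norm_num
  rw [h3, LaurentPolynomial.T_pow, LaurentPolynomial.T_pow, ← LaurentPolynomial.T_zero] at h2
  have h4 : (2 : ℤ) * (k * 2) = 0 :=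
    AddMonoidAlgebra.single_left_injective (R := ℤ) one_ne_zero h2
  omega

open Classical in
/-- The factor by which a coefficient changes under the reflection `s k`: `1` if `k` is even,
`-q⁻¹` if `k` is odd. -/
def sgn (l : Comp m n d) (k : Fin d) : LaurentA :=
  if IsOdd m (blk l (lo k)) then negQPow 1 else 1

/-- Multiplied by `q`, this says that the eigenvalue `q * sgn l k`, which is `q` or `-1`, is a root
of the quadratic relation. -/
theorem sgn_quad (l : Comp m n d) (k : Fin d) :
    1 + ((q : LaurentA) - 1) * sgn l k = (q : LaurentA) * sgn l k * sgn l k := by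
  rw [sgn]
  split_ifs
  · linear_combination (1 - negQPow 1) * q_mul_negQPow_one
  · ring

/-- `F` is the coordinate function of an element on which the generators of `W_l` act from the right
through the sign rule. -/
def RightSign (l : Comp m n d) (F : W d → LaurentA) : Prop :=
  ∀ k, blk l (lo k) = blk l (hi k) → ∀ w, Up w k → F (w * s k) = sgn l k * F w

/-- The left version of `RightSign`. -/
def LeftSign (l : Comp m n d) (F : W d → LaurentA) : Prop :=
  ∀ k, blk l (lo k) = blk l (hi k) → ∀ w, Up w⁻¹ k → F (s k * w) = sgn l k * F w

theorem LeftSign.right {l : Comp m n d} {F : W d → LaurentA} (h : LeftSign l F) :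
    RightSign l fun w => F w⁻¹ := fun k hk w hu => by
  change F (w * s k)⁻¹ = _
  rw [mul_inv_rev, s_inv]
  exact h k hk w⁻¹ (by rwa [inv_inv])

theorem RightSign.left {l : Comp m n d} {F : W d → LaurentA} (h : RightSign l F) :
    LeftSign l fun w => F w⁻¹ := fun k hk w hu => by
  change F (s k * w)⁻¹ = _
  rw [mul_inv_rev, s_inv]
  exact h k hk w⁻¹ hu

theorem RightSign.sub {l : Comp m n d} {F G : W d → LaurentA} (hF : RightSign l F)
    (hG : RightSign l G) : RightSign l (F - G) := fun k hk w hu => by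
  rw [Pi.sub_apply, Pi.sub_apply, hF k hk w hu, hG k hk w hu, mul_sub]

/-- Removing descents at generators of `W_l` leads from any `w` to an element increasing on the
blocks, and the rule propagates zero back. -/
theorem RightSign.eq_zero {l : Comp m n d} {F : W d → LaurentA} (h : RightSign l F)
    (h0 : ∀ u, IncrOn (blk l) u → F u = 0) (w : W d) : F w = 0 := by
  induction hN : len w using Nat.strong_induction_on generalizing w with
  | _ N ih =>
    by_cases hw : IncrOn (blk l) w
    · exact h0 w hw
    · rw [incrOn_blk_iff] at hw
      push Not at hw
      obtain ⟨k, hk, hu⟩ := hw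
      have := h k hk (w * s k) (up_mul_s.2 hu)
      rw [mul_s_s] at this
      rw [this, ih _ (by have := len_mul_s' hu; omega) (w * s k) rfl, mul_zero]

theorem RightSign.ext {l : Comp m n d} {F G : W d → LaurentA} (hF : RightSign l F)
    (hG : RightSign l G) (h : ∀ u, IncrOn (blk l) u → F u = G u) : F = G := by
  funext w
  exact sub_eq_zero.1 ((hF.sub hG).eq_zero (fun u hu => sub_eq_zero.2 (h u hu)) w)

theorem LeftSign.ext {l : Comp m n d} {F G : W d → LaurentA} (hF : LeftSign l F)
    (hG : LeftSign l G) (h : ∀ u, IncrOn (blk l) u⁻¹ → F u = G u) : F = G := by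
  have := hF.right.ext hG.right fun u hu => h u⁻¹ (by rwa [inv_inv])
  funext w
  simpa using congrFun this w⁻¹

/-- Since `g` is increasing on the fibres, a reduced word of `w` lengthens `g` letter by letter, and
each letter contributes the same factor `c`. -/
theorem RightSign.mul {α : Type*} [LinearOrder α] {f : Seg d → α} (hf : Monotone f)
    (hn : ∀ x y, f x = f y → f (neg x) = f (neg y)) {l : Comp m n d} {F : W d → LaurentA}
    (h : RightSign l F) {c : LaurentA}
    (hfl : ∀ k, f (lo k) = f (hi k) → blk l (lo k) = blk l (hi k) ∧ sgn l k = c)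
    {g w : W d} (hg : IncrOn f g) (hw : ∀ x, f (w.1 x) = f x) :
    F (g * w) = c ^ len w * F g := by
  induction hN : len w using Nat.strong_induction_on generalizing w with
  | _ N ih =>
    by_cases h1 : w = 1
    · rw [← hN, h1, len_one, mul_one, pow_zero, one_mul]
    · obtain ⟨k, hk⟩ := exists_not_up h1
      have hl := label_eq_of_inv hf hw (lo_lt_hi k) (not_up.1 hk)
      have hlen := len_mul_s' hk
      have hw' : ∀ x, f ((w * s k).1 x) = f x := fun x => by
        rw [W_mul_apply, hw, label_s hn hl]
      have e := ih _ (by omega) hw' rfl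
      have hup : Up (g * (w * s k)) k := by
        have := up_mul_s.2 hk
        exact hg _ _ this (by rw [hw', hw', hl])
      have := h k (hfl k hl).1 _ hup
      rw [mul_assoc, mul_s_s, e, (hfl k hl).2] at this
      rw [this, ← hN, ← hlen, pow_succ]
      ring

theorem IncrOn.refine {P : Seg (m + n) → Prop} {l : Comp m n d} {g : W d}
    (h : IncrOn (blk l) g) : IncrOn (IotaSchur.refine P l) g := fun x y hxy e =>
  h x y hxy (refine_eq_iff.1 e).1

theorem RightSign.mul_even {l : Comp m n d} {F : W d → LaurentA} (h : RightSign l F) {g w : W d}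
    (hg : IncrOn (blk l) g) (hw : w ∈ Weven l) : F (g * w) = F g := by
  rw [h.mul (refine_mono (IsOdd m) l) (refine_neg_congr isOdd_neg l) (c := 1) ?_ hg.refine
    (refine_stab_iff.2 ((mem_Weven l w).1 hw)), one_pow, one_mul]
  intro k hk
  rw [refine_eq_iff] at hk
  exact ⟨hk.1, if_neg fun ho => lo_ne_hi k (hk.2 ho)⟩

theorem negQPow_one_pow (k : ℕ) : negQPow 1 ^ k = negQPow k := by
  induction k with
  | zero => rw [pow_zero, negQPow_zero]
  | succ k ih => rw [pow_succ, ih, negQPow_add]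

theorem RightSign.mul_odd {l : Comp m n d} {F : W d → LaurentA} (h : RightSign l F) {g w : W d}
    (hg : IncrOn (blk l) g) (hw : w ∈ Wodd l) : F (g * w) = negQPow (len w) * F g := by
  rw [h.mul (refine_mono (fun i => ¬ IsOdd m i) l)
    (refine_neg_congr (fun i => not_congr (isOdd_neg i)) l) (c := negQPow 1) ?_ hg.refine
    (refine_stab_iff.2 ((mem_Wodd l w).1 hw)), negQPow_one_pow]
  intro k hk
  rw [refine_eq_iff] at hk
  exact ⟨hk.1, if_pos (by by_contra ho; exact lo_ne_hi k (hk.2 ho))⟩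

theorem LeftSign.mul_even {l : Comp m n d} {F : W d → LaurentA} (h : LeftSign l F) {g w : W d}
    (hg : IncrOn (blk l) g⁻¹) (hw : w ∈ Weven l) : F (w * g) = F g := by
  have := h.right.mul_even hg (inv_mem hw)
  simpa [mul_inv_rev] using this

theorem LeftSign.mul_odd {l : Comp m n d} {F : W d → LaurentA} (h : LeftSign l F) {g w : W d}
    (hg : IncrOn (blk l) g⁻¹) (hw : w ∈ Wodd l) : F (w * g) = negQPow (len w) * F g := by
  have := h.right.mul_odd hg (inv_mem hw)
  simpa [mul_inv_rev, len_inv] using this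

theorem eq_zero_of_eq_negQPow_mul {k : ℕ} (hk : k ≠ 0) {a : LaurentA} (h : a = negQPow k * a) :
    a = 0 := by
  have : (negQPow k - 1) * a = 0 := by rw [sub_mul, one_mul, ← h, sub_self]
  exact (mul_eq_zero.1 this).resolve_left (sub_ne_zero.2 (negQPow_ne_one hk))

/-- A function with sign rules on both sides is determined by its values on `𝒟°`. -/
theorem eq_zero_of_signs {μ ν : Comp m n d} {F : W d → LaurentA} (hl : LeftSign μ F)
    (hr : RightSign ν F) (h0 : ∀ g ∈ minDoubleCirc μ ν, F g = 0) (w : W d) : F w = 0 := by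
  induction hN : len w using Nat.strong_induction_on generalizing w with
  | _ N ih =>
    by_cases h1 : IncrOn (blk ν) w
    · by_cases h2 : IncrOn (blk μ) w⁻¹
      · by_cases hc : w ∈ minDoubleCirc μ ν
        · exact h0 w hc
        · have hd : w ∈ minDouble μ ν := mem_minDouble_iff.2 ⟨h1, h2⟩
          have : ¬ ((∀ u ∈ Weven ν, w * u * w⁻¹ ∈ Wodd μ → u = 1) ∧
              ∀ u ∈ Wodd ν, w * u * w⁻¹ ∈ Weven μ → u = 1) := fun h => hc ⟨hd, h⟩
          rw [not_and_or] at this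
          push Not at this
          rcases this with ⟨u, hu, hu', hne⟩ | ⟨u, hu, hu', hne⟩
          -- Here `u` is even and its conjugate is odd, so `F (w * u)` equals `F w` by the right
          -- rule and a proper power of `-q⁻¹` times `F w` by the left rule.
          · have e1 := hr.mul_even h1 hu
            have e2 := hl.mul_odd h2 hu'
            rw [inv_mul_cancel_right, e1] at e2
            refine eq_zero_of_eq_negQPow_mul (fun h => hne ?_) e2
            have := eq_one_of_len h
            rwa [mul_inv_eq_one, mul_eq_left] at this
          · have e1 := hr.mul_odd h1 hu
            have e2 := hl.mul_even h2 hu'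
            rw [inv_mul_cancel_right, e1] at e2
            exact eq_zero_of_eq_negQPow_mul (fun h => hne (eq_one_of_len h)) e2.symm
      · rw [incrOn_blk_iff] at h2
        push Not at h2
        obtain ⟨k, hk, hu⟩ := h2
        have := hl k hk (s k * w) (up_inv_s_mul.2 hu)
        rw [s_s_mul] at this
        rw [this, ih _ (by have := len_s_mul' hu; omega) (s k * w) rfl, mul_zero]
    · rw [incrOn_blk_iff] at h1
      push Not at h1
      obtain ⟨k, hk, hu⟩ := h1
      have := hr k hk (w * s k) (up_mul_s.2 hu)
      rw [mul_s_s] at this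
      rw [this, ih _ (by have := len_mul_s' hu; omega) (w * s k) rfl, mul_zero]

/-! ### The sign rules in the Hecke algebra -/

/-- At an ascent the eigenvector equation is the sign rule up to the factor `q`; at a descent it
follows from the rule by `sgn_quad`. -/
theorem leftSign_iff (l : Comp m n d) (h : Hecke d) : LeftSign l (fun w => coef w h) ↔
    ∀ k, blk l (lo k) = blk l (hi k) → T (s k) * h = ((q : LaurentA) * sgn l k) • h := by
  constructor
  · intro H k hk
    replace H : ∀ w, Up w⁻¹ k → coef (s k * w) h = sgn l k * coef w h := H k hk
    refine hecke_ext fun w => ?_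
    rw [coef_T_s_mul, map_smul, smul_eq_mul]
    by_cases hu : Up w⁻¹ k
    · rw [leftOp_up hu, H w hu, mul_assoc]
    · have := H (s k * w) (up_inv_s_mul.2 hu)
      rw [s_s_mul] at this
      rw [leftOp_not_up hu, this]
      linear_combination coef (s k * w) h * sgn_quad l k
  · intro H k hk w hu
    have := congrArg (coef w) (H k hk)
    rw [coef_T_s_mul, leftOp_up hu, map_smul, smul_eq_mul, mul_assoc] at this
    exact mul_left_cancel₀ q_ne_zero this

theorem rightSign_iff (l : Comp m n d) (h : Hecke d) : RightSign l (fun w => coef w h) ↔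
    ∀ k, blk l (lo k) = blk l (hi k) → h * T (s k) = ((q : LaurentA) * sgn l k) • h := by
  constructor
  · intro H k hk
    replace H : ∀ w, Up w k → coef (w * s k) h = sgn l k * coef w h := H k hk
    refine hecke_ext fun w => ?_
    rw [coef_mul_T_s, map_smul, smul_eq_mul]
    by_cases hu : Up w k
    · rw [rightOp_up hu, H w hu, mul_assoc]
    · have := H (w * s k) (up_mul_s.2 hu)
      rw [mul_s_s] at this
      rw [rightOp_not_up hu, this]
      linear_combination coef (w * s k) h * sgn_quad l k
  · intro H k hk w hu
    have := congrArg (coef w) (H k hk)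
    rw [coef_mul_T_s, rightOp_up hu, map_smul, smul_eq_mul, mul_assoc] at this
    exact mul_left_cancel₀ q_ne_zero this

theorem LeftSign.mul_right {l : Comp m n d} {h : Hecke d} (H : LeftSign l fun w => coef w h)
    (a : Hecke d) : LeftSign l fun w => coef w (h * a) := by
  rw [leftSign_iff] at H ⊢
  intro k hk
  rw [← mul_assoc, H k hk, smul_mul_assoc]

open Classical in
/-- The coordinates of `T_{W_μ g W_ν}`, in terms of the matrix `A = κ(μ, g, ν)`. -/
def cosetFun (μ : Comp m n d) (A : Mat m n) (ν : Comp m n d) (w : W d) : LaurentA :=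
  if kappa μ w ν = A then negQPow (oddWeight μ w ν) else 0

theorem cosetFun_rightSign {μ : Comp m n d} {A : Mat m n} {ν : Comp m n d} (hA : A ∈ Xi m n d) :
    RightSign ν (cosetFun μ A ν) := by
  intro k hk w hu
  rw [cosetFun, cosetFun, kappa_mul_right μ w ν (s_mem_Wl hk)]
  split_ifs with h
  · rw [← h, kappa_mem_Xi] at hA
    rw [oddWeight_mul_s hA hk hu, sgn]
    split_ifs
    · rw [negQPow_add, mul_comm]
    · rw [add_zero, one_mul]
  · rw [mul_zero]

theorem transpose_mem_Xi {A : Mat m n} (hA : A ∈ Xi m n d) : A.transpose ∈ Xi m n d := by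
  refine ⟨?_, fun i j => hA.2.1 j i, fun i j h => hA.2.2 j i h.symm⟩
  change ∑ i, ∑ j, A j i = _
  rw [Finset.sum_comm]
  exact hA.1

theorem cosetFun_inv (μ : Comp m n d) (A : Mat m n) (ν : Comp m n d) (w : W d) :
    cosetFun ν A.transpose μ w⁻¹ = cosetFun μ A ν w := by
  rw [cosetFun, cosetFun, oddWeight_inv]
  have : kappa ν w⁻¹ μ = A.transpose ↔ kappa μ w ν = A := by
    constructor
    · intro h; ext i j; rw [← kappa_inv, h, Matrix.transpose_apply]
    · intro h; ext i j; rw [kappa_inv, h, Matrix.transpose_apply]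
  simp only [this]

/-- Inversion in the group transposes the matrix and preserves the odd weight, so the right rule for
the transpose gives the left rule. -/
theorem cosetFun_leftSign {μ : Comp m n d} {A : Mat m n} {ν : Comp m n d} (hA : A ∈ Xi m n d) :
    LeftSign μ (cosetFun μ A ν) := by
  have := (cosetFun_rightSign (μ := ν) (ν := μ) (transpose_mem_Xi hA)).left
  simpa only [cosetFun_inv] using this

theorem oddWeight_one (μ ν : Comp m n d) : oddWeight μ 1 ν = 0 := by
  classical
  rw [oddWeight, Finset.filter_false_of_mem, Finset.card_empty, Nat.zero_div]
  simp [inv_one]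

end Eigen

/-! ### Coordinates of `[xy]_λ` and of `T_{W_μ g W_ν}` -/

section Coordinates

variable {m n d : ℕ}

theorem hecke_expand (h : Hecke d) : h = ∑ w, coef w h • T w := by
  conv_lhs => rw [← (heckeBasis d).sum_repr h]
  exact Finset.sum_congr rfl fun w _ => by rw [heckeBasis_apply]; rfl

open Classical in
/-- The part of `[xy]_l` supported in `P`. -/
def xyPart (l : Comp m n d) (P : Set (W d)) : Hecke d :=
  ∑ p : W d × W d with p.1 ∈ Weven l ∧ p.2 ∈ Wodd l ∧ p.1 * p.2 ∈ P,
    negQPow (len p.2) • T (p.1 * p.2)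

open Classical in
theorem coef_xyPart (l : Comp m n d) (P : Set (W d)) (w : W d) :
    coef w (xyPart l P) = if w ∈ Wl l ∧ w ∈ P then negQPow (oddWeight l w l) else 0 := by
  rw [xyPart, map_sum]
  simp only [map_smul, coef_T, smul_eq_mul]
  split_ifs with h
  · obtain ⟨hw, hP⟩ := h
    obtain ⟨a, ha, b, hb, rfl⟩ := exists_even_odd hw
    rw [Finset.sum_eq_single (a, b)]
    · rw [if_pos rfl, mul_one, oddWeight_parabolic ha hb]
    · rintro ⟨a', b'⟩ hp hne
      rw [Finset.mem_filter] at hp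
      rw [if_neg, mul_zero]
      intro he
      obtain ⟨h1, h2⟩ := Weven_mul_inj hp.2.1 hp.2.2.1 ha hb he
      exact hne (Prod.ext h1 h2)
    · intro hp
      exact absurd (Finset.mem_filter.2 ⟨Finset.mem_univ _, ha, hb, hP⟩) hp
  · refine Finset.sum_eq_zero fun p hp => ?_
    rw [Finset.mem_filter] at hp
    rw [if_neg, mul_zero]
    rintro rfl
    exact h ⟨mul_mem (Weven_le l hp.2.1) (Wodd_le l hp.2.2.1), hp.2.2.2⟩

theorem xy_eq (l : Comp m n d) : xy l = xyPart l Set.univ := by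
  classical
  rw [xy, x, y, Finset.sum_mul_sum, ← Finset.sum_product', xyPart]
  refine Finset.sum_congr ?_ fun p hp => ?_
  · ext p
    simp
  · simp only [Finset.mem_filter, Finset.mem_univ, true_and] at hp
    rw [mul_smul_comm, T_mul (len_even_mul_odd hp.1 hp.2.1)]

theorem TD_eq (μ : Comp m n d) (g : W d) (ν : Comp m n d) :
    TD μ g ν = xyPart ν (minRight (parabolic d (delta (kappa μ g ν)))) := rfl

theorem kappa_self_eq_iff (l : Comp m n d) (w : W d) :
    kappa l w l = kappa l 1 l ↔ w ∈ Wl l := by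
  constructor
  · intro h
    rw [mem_Wl]
    intro x
    by_contra hne
    have h1 : kappa l 1 l (blk l (w.1 x)) (blk l x) = 0 := by
      rw [kappa_apply, Finset.card_eq_zero, Finset.filter_eq_empty_iff]
      rintro y - ⟨h1, h2⟩
      exact hne (h1.symm.trans h2)
    rw [← h, kappa_apply, Finset.card_eq_zero, Finset.filter_eq_empty_iff] at h1
    exact h1 (Finset.mem_univ x) ⟨rfl, rfl⟩
  · intro h
    simpa using kappa_mul_right l 1 l h

theorem kappa_one_mem_Xi (l : Comp m n d) : kappa l 1 l ∈ Xi m n d :=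
  kappa_mem_Xi.2 fun _ _ _ _ _ => Iff.rfl

/-- The generator `[xy]_l` is the case of the trivial double coset `W_l`, so it inherits both sign
rules. -/
theorem coef_xy (l : Comp m n d) (w : W d) : coef w (xy l) = cosetFun l (kappa l 1 l) l w := by
  classical
  rw [xy_eq, coef_xyPart, cosetFun]
  simp only [kappa_self_eq_iff, Set.mem_univ, and_true]

theorem xy_leftSign (l : Comp m n d) : LeftSign l fun w => coef w (xy l) := by
  simp only [coef_xy]
  exact cosetFun_leftSign (kappa_one_mem_Xi l)

theorem xy_rightSign (l : Comp m n d) : RightSign l fun w => coef w (xy l) := by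
  simp only [coef_xy]
  exact cosetFun_rightSign (kappa_one_mem_Xi l)

theorem coef_xy_of_not_mem {l : Comp m n d} {w : W d} (h : w ∉ Wl l) : coef w (xy l) = 0 := by
  classical
  rw [coef_xy, cosetFun, if_neg (mt (kappa_self_eq_iff l w).1 h)]

theorem coef_one_xy (l : Comp m n d) : coef 1 (xy l) = 1 := by
  classical
  rw [coef_xy, cosetFun, if_pos rfl, oddWeight_one, negQPow_zero]

-- Lengths add, so `[xy]_l T_g` is supported on the coset `W_l g`; its only shortest element is `g`,
-- which receives the coefficient `1`.
open Classical in
theorem coef_xy_mul_T {l : Comp m n d} {g u : W d} (hg : IncrOn (blk l) g⁻¹)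
    (hu : IncrOn (blk l) u⁻¹) : coef u (xy l * T g) = if g = u then 1 else 0 := by
  conv_lhs => rw [hecke_expand (xy l)]
  rw [Finset.sum_mul, map_sum, Finset.sum_eq_single 1]
  · rw [coef_one_xy, one_smul, T_one, one_mul, coef_T]
  · intro w _ hw
    rw [smul_mul_assoc, map_smul, smul_eq_mul]
    by_cases hm : w ∈ Wl l
    · have hm' := (mem_Wl l w).1 hm
      have h1 := hg.len_mul_inv (blk_mono l) hm'
      rw [T_mul h1, coef_T, if_neg, mul_zero]
      rintro rfl
      have h2 := hu.len_mul_inv (blk_mono l) (label_inv hm')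
      rw [inv_mul_cancel_left, len_inv] at h2
      exact hw (eq_one_of_len (by omega))
    · rw [coef_xy_of_not_mem hm, zero_mul]
  · intro h; exact absurd (Finset.mem_univ _) h

open Classical in
theorem coef_T_mul_xy {l : Comp m n d} {g u : W d} (hg : IncrOn (blk l) g)
    (hu : IncrOn (blk l) u) : coef u (T g * xy l) = if g = u then 1 else 0 := by
  conv_lhs => rw [hecke_expand (xy l)]
  rw [Finset.mul_sum, map_sum, Finset.sum_eq_single 1]
  · rw [coef_one_xy, one_smul, T_one, mul_one, coef_T]
  · intro w _ hw
    rw [mul_smul_comm, map_smul, smul_eq_mul]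
    by_cases hm : w ∈ Wl l
    · have hm' := (mem_Wl l w).1 hm
      have h1 := hg.len_mul (blk_mono l) hm'
      rw [T_mul h1, coef_T, if_neg, mul_zero]
      rintro rfl
      have h2 := hu.len_mul (blk_mono l) (label_inv hm')
      rw [mul_inv_cancel_right, len_inv] at h2
      exact hw (eq_one_of_len (by omega))
    · rw [coef_xy_of_not_mem hm, zero_mul]
  · intro h; exact absurd (Finset.mem_univ _) h

/-- An element of `ℋ` with the right sign rule is a left multiple of `[xy]_l`. -/
theorem exists_eq_mul_xy {l : Comp m n d} {z : Hecke d} (hz : RightSign l fun w => coef w z) :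
    ∃ a, z = a * xy l := by
  classical
  -- The left factor is the part of `z` supported on the shortest representatives of the cosets of
  -- `W_l`; both sides obey the right rule, so comparing them there is enough.
  refine ⟨∑ g with IncrOn (blk l) g, coef g z • T g, hecke_ext fun w => ?_⟩
  have hr : RightSign l fun w =>
      coef w ((∑ g with IncrOn (blk l) g, coef g z • T g) * xy l) := by
    have h1 := (rightSign_iff l _).1 (xy_rightSign l)
    rw [rightSign_iff]
    intro k hk
    rw [mul_assoc, h1 k hk, mul_smul_comm]
  refine congrFun (hz.ext hr fun u hu => ?_) w
  rw [Finset.sum_mul, map_sum, Finset.sum_eq_single u]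
  · rw [smul_mul_assoc, map_smul, coef_T_mul_xy hu hu, if_pos rfl, smul_eq_mul, mul_one]
  · intro g hg hne
    rw [Finset.mem_filter] at hg
    rw [smul_mul_assoc, map_smul, coef_T_mul_xy hg.2 hu, if_neg hne, smul_zero]
  · intro h
    exact absurd (Finset.mem_filter.2 ⟨Finset.mem_univ _, hu⟩) h

/-- The product of a minimal double coset representative with an element of `𝒟_δ ∩ W_ν` is a
shortest representative of its right coset by `W_μ`. -/
theorem incrOn_mul {μ : Comp m n d} {g : W d} {ν : Comp m n d} (hg : LocMin μ g ν) {w : W d}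
    (hw : w ∈ Wl ν) (hd : IncrOn (entry μ g ν) w⁻¹) : IncrOn (blk μ) (g * w)⁻¹ := by
  intro x y hxy h
  have h1 := hg.2 x y hxy h
  rw [mul_inv_rev, W_mul_apply, W_mul_apply]
  have hw' := label_inv ((mem_Wl ν w).1 hw)
  rcases (blk_mono ν h1.le).lt_or_eq with h2 | h2
  · exact label_lt (blk_mono ν) (by rwa [hw', hw'])
  · exact hd _ _ h1 (entry_eq_iff.2 ⟨h2, by simpa using h⟩)

theorem incrOn_entry_of_mul {μ : Comp m n d} {g : W d} {ν : Comp m n d} (hg : LocMin μ g ν)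
    {w : W d} (hu : IncrOn (blk μ) (g * w)⁻¹) : IncrOn (entry μ g ν) w⁻¹ := by
  intro x y hxy h
  rw [entry_eq_iff] at h
  have := hu _ _ (hg.1 x y hxy h.1) h.2
  simpa [mul_inv_rev] using this

/-- Both sides obey the left rule for `μ`, so they are compared at elements `u` shortest in `W_μ u`.
In the expansion of the product only the term with `g w = u` contributes, and its exponent, the
length of the odd part of `w`, is the odd weight of `u`. The right sign rule, invisible in the
definition of `TWgW`, becomes available in this way. -/
theorem coef_TWgW {μ : Comp m n d} {g : W d} {ν : Comp m n d} (hg : g ∈ minDoubleCirc μ ν)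
    (w : W d) : coef w (TWgW μ g ν) = cosetFun μ (kappa μ g ν) ν w := by
  classical
  obtain ⟨hg, hp⟩ := mem_minDoubleCirc_iff.1 hg
  have hl : LeftSign μ fun w => coef w (TWgW μ g ν) := by
    rw [TWgW, mul_assoc]
    exact (xy_leftSign μ).mul_right _
  refine congrFun (hl.ext (cosetFun_leftSign (kappa_mem_Xi.2 hp)) fun u hu => ?_) w
  set P := minRight (parabolic d (delta (kappa μ g ν))) with hP
  have hmem : ∀ w, w ∈ P ↔ IncrOn (entry μ g ν) w⁻¹ := mem_minRight_delta hg.1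
  have hT : ∀ w ∈ Wl ν, w ∈ P → coef u (xy μ * T g * T w) = if g * w = u then 1 else 0 := by
    intro w hw hwP
    rw [mul_assoc, T_mul (hg.1.len_mul (blk_mono ν) ((mem_Wl ν w).1 hw)),
      coef_xy_mul_T (incrOn_mul hg hw ((hmem w).1 hwP)) hu]
  rw [TWgW, TD_eq, ← hP]
  conv_lhs => rw [hecke_expand (xyPart ν P)]
  rw [Finset.mul_sum, map_sum, Finset.sum_eq_single (g⁻¹ * u)]
  · rw [mul_smul_comm, map_smul, smul_eq_mul, coef_xyPart, cosetFun]
    by_cases hk : kappa μ u ν = kappa μ g ν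
    · have hw := inv_mul_mem_of_kappa hg.2 hu hk.symm
      have hwP : g⁻¹ * u ∈ P := (hmem _).2 (incrOn_entry_of_mul hg (by rwa [mul_inv_cancel_left]))
      rw [if_pos hk, if_pos ⟨hw, hwP⟩, hT _ hw hwP, mul_inv_cancel_left, if_pos rfl, mul_one]
      obtain ⟨a, ha, b, hb, hab⟩ := exists_even_odd hw
      rw [← hab, oddWeight_parabolic ha hb]
      have hu' : g * (a * b) = u := by rw [hab, mul_inv_cancel_left]
      rw [← hu', oddWeight_minRight hg.1 ha hb (by rwa [hu'])]
    · rw [if_neg hk, if_neg, zero_mul]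
      rintro ⟨hw, -⟩
      apply hk
      have := kappa_mul_right μ g ν hw
      rwa [mul_inv_cancel_left] at this
  · intro w _ hne
    rw [mul_smul_comm, map_smul, smul_eq_mul, coef_xyPart]
    split_ifs with h
    · rw [hT w h.1 h.2, if_neg, mul_zero]
      rintro rfl
      exact hne (by rw [inv_mul_cancel_left])
    · rw [zero_mul]
  · intro h; exact absurd (Finset.mem_univ _) h

theorem TWgW_rightSign {μ : Comp m n d} {g : W d} {ν : Comp m n d}
    (hg : g ∈ minDoubleCirc μ ν) : RightSign ν fun w => coef w (TWgW μ g ν) := by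
  simp only [coef_TWgW hg]
  exact cosetFun_rightSign (kappa_mem_Xi.2 (mem_minDoubleCirc_iff.1 hg).2)

theorem coef_TWgW_self {μ : Comp m n d} {g : W d} {ν : Comp m n d}
    (hg : g ∈ minDoubleCirc μ ν) : coef g (TWgW μ g ν) = 1 := by
  classical
  obtain ⟨hl, -⟩ := mem_minDoubleCirc_iff.1 hg
  have h := oddWeight_minRight (μ := μ) hl.1 (one_mem (Weven ν)) (one_mem (Wodd ν))
    (by simpa using hl.2)
  rw [mul_one, mul_one, len_one] at h
  rw [coef_TWgW hg, cosetFun, if_pos rfl, h, negQPow_zero]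

/-! ### Endomorphisms -/

/-- Left multiplication, as a homomorphism of right modules. -/
def leftMul (a : Hecke d) : Hecke d →ₗ[(Hecke d)ᵐᵒᵖ] Hecke d where
  toFun b := a * b
  map_add' := mul_add a
  map_smul' c b := (mul_assoc a b c.unop).symm

theorem exists_eq_of_mem {l : Comp m n d} {z : Hecke d} (hz : z ∈ XYH l) : ∃ h, z = xy l * h := by
  obtain ⟨a, rfl⟩ := Submodule.mem_span_singleton.1 hz
  exact ⟨a.unop, rfl⟩

/-- Writing `T_{W_μ g W_ν} = a [xy]_ν` turns the prescription on `[xy]_ν h` into left multiplication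
by `a`, so independence of the choice of `h` is automatic. -/
theorem exists_isPhi {μ : Comp m n d} {g : W d} {ν : Comp m n d}
    (hg : g ∈ minDoubleCirc μ ν) : ∃ f : SchurJ m n d, IsPhi μ g ν f := by
  obtain ⟨a, ha⟩ := exists_eq_mul_xy (TWgW_rightSign hg)
  have hmem : ∀ z ∈ XYH ν, leftMul a z ∈ XYH μ := by
    intro z hz
    obtain ⟨h, rfl⟩ := exists_eq_of_mem hz
    change a * (xy ν * h) ∈ _
    rw [← mul_assoc, ← ha]
    exact TWgW_mul_mem μ g ν h
  refine ⟨incl μ ∘ₗ (leftMul a).restrict hmem ∘ₗ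
    DirectSum.component (Hecke d)ᵐᵒᵖ (Comp m n d) (fun l => XYH l) ν, fun l h => ?_⟩
  rw [LinearMap.comp_apply, LinearMap.comp_apply]
  by_cases hl : ν = l
  · subst hl
    rw [if_pos rfl, DirectSum.component.lof_self]
    congr 1
    apply Subtype.ext
    change a * (xy ν * h) = _
    rw [← mul_assoc, ← ha]
  · rw [if_neg hl, DirectSum.component.of, dif_neg (fun h => hl h.symm), map_zero, map_zero]

/-- The component in `[xy]_μ ℋ` of the image of the generator `[xy]_ν`. -/
def comp (f : SchurJ m n d) (μ ν : Comp m n d) : XYH μ :=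
  DirectSum.component (Hecke d)ᵐᵒᵖ (Comp m n d) (fun l => XYH l) μ
    (f (incl ν ⟨xy ν * 1, xy_mul_mem ν 1⟩))

theorem comp_add (f f' : SchurJ m n d) (μ ν : Comp m n d) :
    comp (f + f') μ ν = comp f μ ν + comp f' μ ν := by
  rw [comp, LinearMap.add_apply, map_add]; rfl

theorem comp_smul (a : LaurentA) (f : SchurJ m n d) (μ ν : Comp m n d) :
    comp (a • f) μ ν = a • comp f μ ν := rfl

theorem comp_leftSign (f : SchurJ m n d) (μ ν : Comp m n d) :
    LeftSign μ fun w => coef w (comp f μ ν).1 := by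
  obtain ⟨h, hh⟩ := exists_eq_of_mem (comp f μ ν).2
  rw [hh]
  exact (xy_leftSign μ).mul_right h

/-- The generator `[xy]_ν` is an eigenvector for right multiplication by `T (s k)`, and a right
linear map preserves eigenvectors together with their eigenvalues. -/
theorem comp_rightSign (f : SchurJ m n d) (μ ν : Comp m n d) :
    RightSign ν fun w => coef w (comp f μ ν).1 := by
  rw [rightSign_iff]
  intro k hk
  have h1 := (rightSign_iff ν _).1 (xy_rightSign ν) k hk
  -- The eigenvalue is written as right multiplication by a central element of the Hecke algebra,
  -- with which `f` commutes by right linearity.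
  have h2 : MulOpposite.op (T (s k)) • (⟨xy ν * 1, xy_mul_mem ν 1⟩ : XYH ν) =
      MulOpposite.op (algebraMap LaurentA (Hecke d) ((q : LaurentA) * sgn ν k)) •
        (⟨xy ν * 1, xy_mul_mem ν 1⟩ : XYH ν) := by
    apply Subtype.ext
    change xy ν * 1 * T (s k) = xy ν * 1 * algebraMap LaurentA (Hecke d) _
    rw [mul_one, h1, ← Algebra.commutes, ← Algebra.smul_def]
  have h3 : MulOpposite.op (T (s k)) • comp f μ ν =
      MulOpposite.op (algebraMap LaurentA (Hecke d) ((q : LaurentA) * sgn ν k)) • comp f μ ν := by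
    rw [comp, ← map_smul, ← map_smul, ← map_smul, ← map_smul, h2, map_smul, map_smul]
  have h4 : (comp f μ ν).1 * T (s k) = (comp f μ ν).1 * algebraMap LaurentA (Hecke d) _ :=
    congrArg Subtype.val h3
  rw [h4, ← Algebra.commutes, ← Algebra.smul_def]

theorem eq_zero_of_comp {f : SchurJ m n d} (h : ∀ μ ν, comp f μ ν = 0) : f = 0 := by
  refine DirectSum.linearMap_ext _ fun ν => LinearMap.ext fun z => ?_
  obtain ⟨b, hb⟩ := exists_eq_of_mem z.2
  have h0 : f (incl ν ⟨xy ν * 1, xy_mul_mem ν 1⟩) = 0 := DFinsupp.ext fun μ => h μ ν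
  have hz : z = MulOpposite.op b • (⟨xy ν * 1, xy_mul_mem ν 1⟩ : XYH ν) := by
    apply Subtype.ext
    change z.1 = xy ν * 1 * b
    rw [hb, mul_one]
  change f (incl ν z) = 0
  rw [hz, map_smul, map_smul, h0, smul_zero]

theorem eq_zero_of_coef {f : SchurJ m n d}
    (h : ∀ μ ν, ∀ g ∈ minDoubleCirc μ ν, coef g (comp f μ ν).1 = 0) : f = 0 := by
  refine eq_zero_of_comp fun μ ν => Subtype.ext (hecke_ext fun w => ?_)
  rw [ZeroMemClass.coe_zero, map_zero]
  exact eq_zero_of_signs (comp_leftSign f μ ν) (comp_rightSign f μ ν) (h μ ν) w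

theorem comp_of_isPhi {μ : Comp m n d} {g : W d} {ν : Comp m n d} {f : SchurJ m n d}
    (h : IsPhi μ g ν f) (μ' ν' : Comp m n d) :
    (comp f μ' ν').1 = if μ = μ' ∧ ν = ν' then TWgW μ g ν else 0 := by
  rw [comp, h ν' 1]
  by_cases hν : ν = ν'
  · rw [if_pos hν]
    by_cases hμ : μ = μ'
    · subst hμ hν
      rw [DirectSum.component.lof_self, if_pos ⟨rfl, rfl⟩]
      exact mul_one _
    · rw [if_neg fun hh => hμ hh.1, DirectSum.component.of, dif_neg hμ]
      rfl
  · rw [if_neg hν, if_neg fun hh => hν hh.2, map_zero]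
    rfl

end Coordinates

/-! ### Every matrix is the matrix of a double coset -/

section Matrices

variable {m n d : ℕ}

theorem sum_le_eq_sum_lt_add (l : Fin (m + n + 1) → ℕ) (k : Fin (m + n + 1)) :
    ∑ j with j.1 ≤ k.1, l j = (∑ j with j.1 < k.1, l j) + l k := by
  rw [← Finset.sum_filter_add_sum_filter_not (Finset.univ.filter fun j : Fin (m + n + 1) =>
    j.1 ≤ k.1) fun j => j.1 < k.1, Finset.filter_filter, Finset.filter_filter]
  congr 1
  · refine Finset.sum_congr ?_ fun _ _ => rfl
    ext j
    simp only [Finset.mem_filter, Finset.mem_univ, true_and]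
    omega
  · rw [← Finset.sum_singleton l k]
    refine Finset.sum_congr ?_ fun _ _ => rfl
    ext j
    simp only [Finset.mem_filter, Finset.mem_univ, true_and, Finset.mem_singleton, Fin.ext_iff]
    omega

theorem comp_ext {l l' : Comp m n d} (h : ∀ k, partialSum l k = partialSum l' k) : l = l' := by
  apply Subtype.ext
  funext k
  have h1 := sum_le_eq_sum_lt_add l.1 k
  have h2 := sum_le_eq_sum_lt_add l'.1 k
  have h3 := h k.1
  rw [partialSum, partialSum, h1, h2] at h3
  have h4 : ∑ j with j.1 < k.1, l.1 j = ∑ j with j.1 < k.1, l'.1 j := by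
    rcases Nat.eq_zero_or_pos k.1 with h0 | h0
    · simp [h0]
    · have := h (k.1 - 1)
      rw [partialSum, partialSum] at this
      have e : ∀ j : Fin (m + n + 1), j.1 ≤ k.1 - 1 ↔ j.1 < k.1 := fun j => by omega
      simpa only [e] using this
  omega

theorem comp_eq_of_blk {l l' : Comp m n d} (h : blk l = blk l') : l = l' := by
  refine comp_ext fun k => ?_
  have key : ∀ l l' : Comp m n d, blk l = blk l' → partialSum l k ≤ partialSum l' k := by
    intro l l' h
    have hd : partialSum l k ≤ d := by
      exact (Finset.sum_le_sum_of_subset (Finset.filter_subset _ _)).trans l.2.le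
    have h1 := blk_le_iff l (pt (partialSum l k) hd) k
    rw [h, blk_le_iff] at h1
    have := h1.2 le_rfl
    simpa [pt] using this
  exact le_antisymm (key _ _ h) (key _ _ h.symm)

/-- Every monotone odd map is the block labelling of a composition. -/
theorem exists_comp_blk_eq (F : Seg d → Seg (m + n)) (hF : Monotone F)
    (hn : ∀ x, F (neg x) = neg (F x)) : ∃ l : Comp m n d, blk l = F := by
  classical
  have h0 : ∀ x : Seg d, x.1 = 0 → (F x).1 = 0 := by
    intro x hx
    rw [← neg_eq_self, ← hn, neg_eq_self.2 hx]
  have hpos : ∀ x : Seg d, 0 ≤ x.1 → 0 ≤ (F x).1 := by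
    intro x hx
    rw [← h0 (zeroIdx d) rfl]
    exact hF (show zeroIdx d ≤ x from hx)
  let f : Seg d → Fin (m + n + 1) := fun x => ⟨(F x).1.toNat, by have := (F x).2.2; omega⟩
  have hps : ∀ k : ℕ, (Finset.univ.filter fun x : Seg d => 0 < x.1 ∧ (F x).1 ≤ k).card =
      ∑ j : Fin (m + n + 1) with j.1 ≤ k,
        (Finset.univ.filter fun x : Seg d => 0 < x.1 ∧ f x = j).card := by
    intro k
    rw [Finset.card_eq_sum_card_fiberwise (f := f) (t := Finset.univ.filter fun j => j.1 ≤ k)]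
    · refine Finset.sum_congr rfl fun j hj => ?_
      simp only [Finset.mem_filter, Finset.mem_univ, true_and] at hj
      congr 1
      ext x
      simp only [Finset.mem_filter, Finset.mem_univ, true_and]
      constructor
      · rintro ⟨⟨h1, -⟩, h2⟩; exact ⟨h1, h2⟩
      · rintro ⟨h1, rfl⟩
        refine ⟨⟨h1, ?_⟩, rfl⟩
        simp only [f] at hj
        omega
    · intro x hx
      simp only [Finset.coe_filter, Finset.mem_univ, true_and, Set.mem_ofPred_eq] at hx ⊢
      simp only [f]
      omega
  have hd : (Finset.univ.filter fun x : Seg d => 0 < x.1 ∧ x.1 ≤ d).card = d := card_pos_le le_rfl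
  let l : Comp m n d :=
    ⟨fun j => (Finset.univ.filter fun x : Seg d => 0 < x.1 ∧ f x = j).card, by
      have := hps (m + n)
      rw [show (Finset.univ.filter fun j : Fin (m + n + 1) => j.1 ≤ m + n) = Finset.univ from
        Finset.filter_true_of_mem fun j _ => by omega] at this
      rw [← this]
      conv_rhs => rw [← hd]
      congr 1
      ext x
      simp only [Finset.mem_filter, Finset.mem_univ, true_and]
      have h1 := x.2.2
      have h2 := (F x).2.2
      push_cast at h2 ⊢
      tauto⟩
  have hl : ∀ k, partialSum l k =
      (Finset.univ.filter fun x : Seg d => 0 < x.1 ∧ (F x).1 ≤ k).card := fun k => (hps k).symm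
  have key : ∀ x : Seg d, 0 < x.1 → blk l x = F x := by
    intro x hx
    -- By monotonicity the positive points with value at most `k` form an initial segment, and the
    -- partial sum is its size.
    have hk : ∀ k : ℕ, (blk l x).1 ≤ k ↔ (F x).1 ≤ k := by
      intro k
      rw [blk_le_iff, hl]
      constructor
      · intro h
        by_contra hc
        have h1 := card_pos_le (d := d) (t := x.1.toNat - 1) (by have := x.2.2; omega)
        have h2 := Finset.card_le_card (s := Finset.univ.filter fun y : Seg d =>
          0 < y.1 ∧ (F y).1 ≤ k) (t := Finset.univ.filter fun y : Seg d =>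
          0 < y.1 ∧ y.1 ≤ ((x.1.toNat - 1 : ℕ) : ℤ)) (by
            intro y hy
            simp only [Finset.mem_filter, Finset.mem_univ, true_and] at hy ⊢
            refine ⟨hy.1, ?_⟩
            by_contra hyx
            have : (F x).1 ≤ (F y).1 := hF (show x.1 ≤ y.1 by omega)
            omega)
        omega
      · intro h
        have h1 := card_pos_le (d := d) (t := x.1.toNat) (by have := x.2.2; omega)
        have h2 := Finset.card_le_card (t := Finset.univ.filter fun y : Seg d =>
          0 < y.1 ∧ (F y).1 ≤ k) (s := Finset.univ.filter fun y : Seg d =>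
          0 < y.1 ∧ y.1 ≤ (x.1.toNat : ℤ)) (by
            intro y hy
            simp only [Finset.mem_filter, Finset.mem_univ, true_and] at hy ⊢
            refine ⟨hy.1, ?_⟩
            have : (F y).1 ≤ (F x).1 := hF (show y.1 ≤ x.1 by omega)
            omega)
        omega
    have e1 := hpos x hx.le
    have e2 : 0 ≤ (blk l x).1 := by rw [blk_val, if_pos hx.le]; omega
    have e3 := hk (F x).1.toNat
    have e4 := hk (blk l x).1.toNat
    apply Subtype.ext
    omega
  refine ⟨l, funext fun x => ?_⟩
  rcases lt_trichotomy x.1 0 with h | h | h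
  · rw [← neg_inj, ← blk_neg, ← hn]
    exact key _ (by rw [neg_val]; omega)
  · rw [blk_zero l h]
    exact Subtype.ext (h0 x h).symm
  · exact key x h

/-- The cells of a matrix of natural numbers: each position is split into as many cells as its
entry says. -/
abbrev Cell (A : Seg (m + n) → Seg (m + n) → ℕ) : Type := Σ i, Σ j, Fin (A i j)

/-- The key that orders the cells row by row. -/
def rowKey {A : Seg (m + n) → Seg (m + n) → ℕ} (t : Cell A) : Seg (m + n) ×ₗ (Seg (m + n) ×ₗ ℕ) :=
  toLex (t.1, toLex (t.2.1, t.2.2.1))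

/-- The key that orders the cells column by column. -/
def colKey {A : Seg (m + n) → Seg (m + n) → ℕ} (t : Cell A) : Seg (m + n) ×ₗ (Seg (m + n) ×ₗ ℕ) :=
  toLex (t.2.1, toLex (t.1, t.2.2.1))

theorem rowKey_injective (A : Seg (m + n) → Seg (m + n) → ℕ) : Function.Injective (rowKey : Cell A → _) := by
  rintro ⟨i, j, k⟩ ⟨i', j', k'⟩ h
  simp only [rowKey, toLex_inj, Prod.mk.injEq] at h
  obtain ⟨rfl, rfl, h⟩ := h
  rw [Fin.ext h]

theorem colKey_injective (A : Seg (m + n) → Seg (m + n) → ℕ) : Function.Injective (colKey : Cell A → _) := by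
  rintro ⟨i, j, k⟩ ⟨i', j', k'⟩ h
  simp only [colKey, toLex_inj, Prod.mk.injEq] at h
  obtain ⟨rfl, rfl, h⟩ := h
  rw [Fin.ext h]

/-- The point reflection of the cells of a centrally symmetric matrix. -/
def cellNeg {A : Seg (m + n) → Seg (m + n) → ℕ} (hA : ∀ i j, A (neg i) (neg j) = A i j) (t : Cell A) : Cell A :=
  ⟨neg t.1, neg t.2.1, ⟨A t.1 t.2.1 - 1 - t.2.2.1, by
    have := t.2.2.2
    rw [hA]; omega⟩⟩

theorem cellNeg_cellNeg {A : Seg (m + n) → Seg (m + n) → ℕ} (hA : ∀ i j, A (neg i) (neg j) = A i j) (t : Cell A) :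
    cellNeg hA (cellNeg hA t) = t := by
  apply rowKey_injective
  have := t.2.2.2
  refine congrArg toLex (Prod.ext (neg_neg' _) (congrArg toLex (Prod.ext (neg_neg' _) ?_)))
  change A (neg t.1) (neg t.2.1) - 1 - (A t.1 t.2.1 - 1 - t.2.2.1) = t.2.2.1
  rw [hA]
  omega

theorem rowKey_cellNeg_lt {A : Seg (m + n) → Seg (m + n) → ℕ} (hA : ∀ i j, A (neg i) (neg j) = A i j) {a b : Cell A}
    (h : rowKey a < rowKey b) : rowKey (cellNeg hA b) < rowKey (cellNeg hA a) := by
  obtain ⟨i, j, k⟩ := a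
  obtain ⟨i', j', k'⟩ := b
  simp only [rowKey, cellNeg, Prod.Lex.toLex_lt_toLex, neg_lt_neg, neg_inj] at h ⊢
  rcases h with h | ⟨rfl, h | ⟨rfl, h⟩⟩
  · exact Or.inl h
  · exact Or.inr ⟨rfl, Or.inl h⟩
  · refine Or.inr ⟨rfl, Or.inr ⟨rfl, ?_⟩⟩
    have := k'.2
    omega

theorem colKey_cellNeg_lt {A : Seg (m + n) → Seg (m + n) → ℕ} (hA : ∀ i j, A (neg i) (neg j) = A i j) {a b : Cell A}
    (h : colKey a < colKey b) : colKey (cellNeg hA b) < colKey (cellNeg hA a) := by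
  obtain ⟨i, j, k⟩ := a
  obtain ⟨i', j', k'⟩ := b
  simp only [colKey, cellNeg, Prod.Lex.toLex_lt_toLex, neg_lt_neg, neg_inj] at h ⊢
  rcases h with h | ⟨rfl, h | ⟨rfl, h⟩⟩
  · exact Or.inl h
  · exact Or.inr ⟨rfl, Or.inl h⟩
  · refine Or.inr ⟨rfl, Or.inr ⟨rfl, ?_⟩⟩
    have := k'.2
    omega

/-- A finite set with `2d + 1` elements, ordered by a key that is reversed by an involution, is
enumerated by `[-d..d]`, compatibly with the negation. -/
theorem exists_enumeration {X L : Type*} [Fintype X] [LinearOrder L] (hX : Fintype.card X = 2 * d + 1)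
    {key : X → L} (hk : Function.Injective key) {ν : X → X} (hν : ∀ t, ν (ν t) = t)
    (hr : ∀ a b, key a < key b → key (ν b) < key (ν a)) :
    ∃ e : Seg d ≃ X, StrictMono (key ∘ e) ∧ ∀ x, e (neg x) = ν (e x) := by
  let _ : LinearOrder X := LinearOrder.lift' key hk
  let e : Seg d ≃o X := (Fintype.orderIsoFinOfCardEq (Seg d) (card_seg d)).symm.trans
    (Fintype.orderIsoFinOfCardEq X hX)
  have he : StrictMono e := e.strictMono
  refine ⟨e.toEquiv, fun a b h => he h, fun x => ?_⟩
  let νe : X ≃ X := ⟨ν, ν, hν, hν⟩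
  let ne : Seg d ≃ Seg d := ⟨neg, neg, neg_neg', neg_neg'⟩
  -- Reversing the order on both sides gives a second increasing enumeration, and a finite chain has
  -- only one.
  have hm : StrictMono ((ne.trans e.toEquiv).trans νe) := fun a b h =>
    hr _ _ (he (neg_lt_neg.2 h))
  have hs : hm.orderIsoOfSurjective _ (Equiv.surjective _) = e := Subsingleton.elim _ _
  have hx : ν (e (neg x)) = e x := DFunLike.congr_fun hs x
  change e (neg x) = ν (e x)
  rw [← hx, hν]

/-- Let `[-d..d]` list the cells of `A` once by rows and once by columns; `g` passes from the column
list to the row list. Along the row list the row index is monotone and odd, so it is the block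
labelling of some `μ`; the column list gives `ν` likewise. -/
theorem exists_kappa_eq {A : Seg (m + n) → Seg (m + n) → ℕ} (hsum : ∑ i, ∑ j, A i j = 2 * d + 1)
    (hA : ∀ i j, A (neg i) (neg j) = A i j) :
    ∃ (μ : Comp m n d) (g : W d) (ν : Comp m n d), kappa μ g ν = A := by
  classical
  have hcard : Fintype.card (Cell A) = 2 * d + 1 := by
    simp only [Fintype.card_sigma, Fintype.card_fin, hsum]
  obtain ⟨r, hr, hrn⟩ := exists_enumeration hcard (rowKey_injective A) (cellNeg_cellNeg hA)
    fun _ _ => rowKey_cellNeg_lt hA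
  obtain ⟨c, hc, hcn⟩ := exists_enumeration hcard (colKey_injective A) (cellNeg_cellNeg hA)
    fun _ _ => colKey_cellNeg_lt hA
  obtain ⟨μ, hμ⟩ := exists_comp_blk_eq (m := m) (n := n) (fun x => (r x).1) (fun x y h => by
    have := hr.monotone h
    simp only [Function.comp_apply, rowKey, Prod.Lex.toLex_le_toLex] at this
    rcases this with h | h
    · exact h.le
    · exact h.1.le) fun x => by rw [hrn]; rfl
  obtain ⟨ν, hν⟩ := exists_comp_blk_eq (m := m) (n := n) (fun x => (c x).2.1) (fun x y h => by
    have := hc.monotone h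
    simp only [Function.comp_apply, colKey, Prod.Lex.toLex_le_toLex] at this
    rcases this with h | h
    · exact h.le
    · exact h.1.le) fun x => by rw [hcn]; rfl
  let g : W d := ⟨c.trans r.symm, fun x => by
    change r.symm (c (neg x)) = neg (r.symm (c x))
    rw [Equiv.symm_apply_eq, hrn, Equiv.apply_symm_apply, hcn]⟩
  refine ⟨μ, g, ν, ?_⟩
  ext i j
  rw [kappa_apply]
  have hg : ∀ x, blk μ (g.1 x) = (c x).1 := fun x => by
    rw [hμ]
    change (r (r.symm (c x))).1 = _
    rw [Equiv.apply_symm_apply]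
  simp only [hg, hν]
  rw [← Finset.card_map c.toEmbedding]
  have : (Finset.univ.filter fun x => (c x).1 = i ∧ (c x).2.1 = j).map c.toEmbedding =
      (Finset.univ : Finset (Fin (A i j))).image fun k => (⟨i, j, k⟩ : Cell A) := by
    ext t
    simp only [Finset.mem_map, Finset.mem_filter, Finset.mem_univ, true_and, Finset.mem_image]
    constructor
    · rintro ⟨x, ⟨h1, h2⟩, rfl⟩
      change ∃ k, (⟨i, j, k⟩ : Cell A) = c x
      generalize c x = t at *
      obtain ⟨i', j', k⟩ := t
      obtain rfl : i' = i := h1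
      obtain rfl : j' = j := h2
      exact ⟨k, rfl⟩
    · rintro ⟨k, rfl⟩
      refine ⟨c.symm ⟨i, j, k⟩, ?_, c.apply_symm_apply _⟩
      rw [c.apply_symm_apply]
      exact ⟨rfl, rfl⟩
  rw [this, Finset.card_image_of_injective, Finset.card_univ, Fintype.card_fin]
  intro k k' h
  simpa using h

/-! ### Bijectivity of `κ` -/

theorem triple_eq_of_kappa_eq {μ ν μ' ν' : Comp m n d} {g g' : W d} (h : g ∈ minDoubleCirc μ ν)
    (h' : g' ∈ minDoubleCirc μ' ν') (e : kappa μ g ν = kappa μ' g' ν') :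
    μ = μ' ∧ g = g' ∧ ν = ν' := by
  -- The row sums are the block sizes of `μ`, and these determine its monotone labelling; inverses
  -- give the same for the columns.
  have hr : ∀ (μ μ' ν ν' : Comp m n d) (g g' : W d), kappa μ g ν = kappa μ' g' ν' → μ = μ' := by
    intro μ μ' ν ν' g g' e
    refine comp_eq_of_blk (eq_of_monotone_of_card (blk_mono μ) (blk_mono μ') fun i => ?_)
    have h1 := sum_kappa_row μ g ν i
    have h2 := sum_kappa_row μ' g' ν' i
    rw [e, h2] at h1
    convert h1.symm
  obtain rfl := hr _ _ _ _ _ _ e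
  obtain rfl : ν = ν' := by
    refine hr ν ν' μ μ g⁻¹ g'⁻¹ ?_
    ext i j
    rw [kappa_inv, kappa_inv, e]
  exact ⟨rfl, (mem_minDoubleCirc_iff.1 h).1.eq (mem_minDoubleCirc_iff.1 h').1 e, rfl⟩

theorem exists_triple {A : Mat m n} (hA : A ∈ Xi m n d) :
    ∃ (μ : Comp m n d) (g : W d) (ν : Comp m n d), g ∈ minDoubleCirc μ ν ∧ kappa μ g ν = A := by
  obtain ⟨μ, w, ν, rfl⟩ := exists_kappa_eq hA.1 hA.2.1
  obtain ⟨g, hg, e⟩ := exists_minDouble_of_kappa μ w ν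
  refine ⟨μ, g, ν, mem_minDoubleCirc_iff.2 ⟨mem_minDouble_iff.1 hg, ?_⟩, e⟩
  rw [← kappa_mem_Xi]
  exact e ▸ hA

theorem kappa_mem_Xi_of_mem {μ ν : Comp m n d} {g : W d} (h : g ∈ minDoubleCirc μ ν) :
    kappa μ g ν ∈ Xi m n d :=
  kappa_mem_Xi.2 (mem_minDoubleCirc_iff.1 h).2

theorem kappa_bijOn (m n d : ℕ) : Set.BijOn
    (fun t : Comp m n d × W d × Comp m n d => kappa t.1 t.2.1 t.2.2)
    {t | t.2.1 ∈ minDoubleCirc t.1 t.2.2} (Xi m n d) := by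
  refine ⟨fun t ht => kappa_mem_Xi_of_mem ht, ?_, ?_⟩
  · rintro ⟨μ, g, ν⟩ h ⟨μ', g', ν'⟩ h' e
    obtain ⟨rfl, rfl, rfl⟩ := triple_eq_of_kappa_eq h h' e
    rfl
  · intro A hA
    obtain ⟨μ, g, ν, hg, e⟩ := exists_triple hA
    exact ⟨(μ, g, ν), hg, e⟩

end Matrices

/-! ### The basis -/

section Basis

variable {m n d : ℕ}

/-- Existence of an endomorphism makes the choice in `e` meaningful, and uniqueness of the triple
makes it refer to the given one. -/
theorem isPhi_e (A : Xi m n d) (μ : Comp m n d) (g : W d) (ν : Comp m n d)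
    (hg : g ∈ minDoubleCirc μ ν) (h : kappa μ g ν = A.1) : IsPhi μ g ν (e A) := by
  obtain ⟨f, hf⟩ := exists_isPhi hg
  obtain ⟨μ', g', ν', hg', h', he⟩ := Classical.epsilon_spec
    (p := fun f : SchurJ m n d => ∃ (μ : Comp m n d) (g : W d) (ν : Comp m n d),
      g ∈ minDoubleCirc μ ν ∧ kappa μ g ν = A.1 ∧ IsPhi μ g ν f) ⟨f, μ, g, ν, hg, h, hf⟩
  obtain ⟨rfl, rfl, rfl⟩ := triple_eq_of_kappa_eq hg' hg (h'.trans h.symm)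
  exact he

instance finite_comp (m n d : ℕ) : Finite (Comp m n d) := by
  refine Finite.of_injective (β := Fin (m + n + 1) → Fin (d + 1))
    (fun l i => ⟨l.1 i, ?_⟩) fun l l' h => ?_
  · have := Finset.single_le_sum (f := l.1) (fun _ _ => Nat.zero_le _) (Finset.mem_univ i)
    have := l.2
    omega
  · apply Subtype.ext
    funext i
    exact congrArg Fin.val (congrFun h i)

instance finite_Xi (m n d : ℕ) : Finite (Xi m n d) := by
  rw [← (kappa_bijOn m n d).image_eq]
  exact ((Set.toFinite _).image _).to_subtype

/-- The composition `μ` of the triple `(μ, g, ν)` with `κ(μ, g, ν) = A`. -/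
def rowComp (A : Xi m n d) : Comp m n d := (exists_triple A.2).choose

/-- The minimal double coset representative `g` of the triple `(μ, g, ν)` with
`κ(μ, g, ν) = A`. -/
def rep (A : Xi m n d) : W d := (exists_triple A.2).choose_spec.choose

/-- The composition `ν` of the triple `(μ, g, ν)` with `κ(μ, g, ν) = A`. -/
def colComp (A : Xi m n d) : Comp m n d := (exists_triple A.2).choose_spec.choose_spec.choose

theorem rep_mem (A : Xi m n d) : rep A ∈ minDoubleCirc (rowComp A) (colComp A) :=
  (exists_triple A.2).choose_spec.choose_spec.choose_spec.1

theorem kappa_rep (A : Xi m n d) : kappa (rowComp A) (rep A) (colComp A) = A.1 :=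
  (exists_triple A.2).choose_spec.choose_spec.choose_spec.2

/-- The coordinates of an endomorphism. -/
def coords (m n d : ℕ) : SchurJ m n d →ₗ[LaurentA] Xi m n d → LaurentA where
  toFun f A := coef (rep A) (comp f (rowComp A) (colComp A)).1
  map_add' f f' := by
    funext A
    rw [comp_add]
    exact map_add (coef _) _ _
  map_smul' a f := by
    funext A
    rw [comp_smul]
    exact map_smul (coef _) a _

theorem eq_zero_of_coords {f : SchurJ m n d} (hf : coords m n d f = 0) : f = 0 := by
  refine eq_zero_of_coef fun μ ν g hg => ?_
  obtain ⟨A, hA⟩ : ∃ A : Xi m n d, kappa μ g ν = A.1 := ⟨⟨_, kappa_mem_Xi_of_mem hg⟩, rfl⟩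
  obtain ⟨rfl, rfl, rfl⟩ := triple_eq_of_kappa_eq hg (rep_mem A) (hA.trans (kappa_rep A).symm)
  exact congrFun hf A

theorem coords_injective (m n d : ℕ) : Function.Injective (coords m n d) := by
  intro f f' h
  have h0 : f + (-1 : LaurentA) • f' = 0 := eq_zero_of_coords (by
    rw [map_add, map_smul, h, neg_smul, one_smul, add_neg_cancel])
  calc f = f + ((-1 : LaurentA) + 1) • f' := by rw [neg_add_cancel, zero_smul, add_zero]
    _ = f' := by rw [add_smul, one_smul, ← add_assoc, h0, zero_add]

open Classical in
theorem coords_e (A : Xi m n d) : coords m n d (e A) = Pi.single A 1 := by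
  funext B
  have h := isPhi_e A _ _ _ (rep_mem A) (kappa_rep A)
  change coef (rep B) (comp (e A) (rowComp B) (colComp B)).1 = _
  rw [comp_of_isPhi h]
  by_cases hAB : B = A
  · subst hAB
    rw [if_pos ⟨rfl, rfl⟩, Pi.single_eq_same]
    exact coef_TWgW_self (rep_mem B)
  · rw [Pi.single_eq_of_ne hAB]
    split_ifs with hc
    -- With equal outer compositions, different matrices mean different double cosets, so `rep B` is
    -- outside the support.
    · rw [coef_TWgW (rep_mem A), cosetFun, if_neg, ]
      rw [hc.1, hc.2, kappa_rep, ← hc.1, ← hc.2, kappa_rep]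
      exact fun hh => hAB (Subtype.ext hh)
    · exact map_zero _

theorem coords_bijective (m n d : ℕ) : Function.Bijective (coords m n d) := by
  classical
  refine ⟨coords_injective m n d, ?_⟩
  have _ := Fintype.ofFinite (Xi m n d)
  intro c
  refine ⟨∑ A, c A • e A, ?_⟩
  rw [map_sum]
  simp only [map_smul, coords_e]
  funext B
  simp [Finset.sum_apply, Pi.single_apply]

theorem exists_basis (m n d : ℕ) :
    ∃ b : Module.Basis (Xi m n d) LaurentA (SchurJ m n d), ∀ A, b A = e A := by
  classical
  refine ⟨.ofEquivFun (.ofBijective (coords m n d) (coords_bijective m n d)), fun A => ?_⟩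
  rw [Module.Basis.coe_ofEquivFun, LinearEquiv.symm_apply_eq, LinearEquiv.ofBijective_apply,
    coords_e]

end Basis

/-! ### The number of matrices -/

section Counting

theorem card_piAntidiag_nat {ι : Type*} [DecidableEq ι] (s : Finset ι) (k : ℕ) :
    (s.piAntidiag k).card = (s.card + k - 1).choose k := by
  rw [← Finset.card_finsuppAntidiag_nat_eq_choose, Finset.finsuppAntidiag, Finset.card_map,
    Finset.card_attach]

open Classical in
/-- The pairs `(f, S)` of a function `f` with support in `s` and a subset `S` of `t`, such that the
sum of `f` plus the size of `S` is `d`. -/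
def sumAndSubset {X : Type*} [DecidableEq X] (s t : Finset X) (d : ℕ) :
    Finset ((X → ℕ) × Finset X) :=
  (Finset.range (d + 1)).biUnion fun k => s.piAntidiag k ×ˢ t.powersetCard (d - k)

theorem mem_sumAndSubset {X : Type*} [DecidableEq X] {s t : Finset X} {d : ℕ}
    {p : (X → ℕ) × Finset X} : p ∈ sumAndSubset s t d ↔
      s.sum p.1 + p.2.card = d ∧ (∀ x, p.1 x ≠ 0 → x ∈ s) ∧ p.2 ⊆ t := by
  simp only [sumAndSubset, Finset.mem_biUnion, Finset.mem_range, Finset.mem_product,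
    Finset.mem_piAntidiag, Finset.mem_powersetCard]
  constructor
  · rintro ⟨k, hk, ⟨rfl, h1⟩, h2, h3⟩
    exact ⟨by omega, h1, h2⟩
  · rintro ⟨h1, h2, h3⟩
    exact ⟨_, by omega, ⟨rfl, h2⟩, h3, by omega⟩

theorem card_sumAndSubset {X : Type*} [DecidableEq X] (s t : Finset X) (d : ℕ) :
    (sumAndSubset s t d).card =
      ∑ k ∈ Finset.range (d + 1), (s.card + k - 1).choose k * t.card.choose (d - k) := by
  classical
  rw [sumAndSubset, Finset.card_biUnion]
  · simp only [Finset.card_product, card_piAntidiag_nat, Finset.card_powersetCard]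
  · intro k _ k' _ hne
    rw [Function.onFun, Finset.disjoint_left]
    rintro ⟨f, S⟩ h h'
    simp only [Finset.mem_product, Finset.mem_piAntidiag] at h h'
    exact hne (h.1.1.symm.trans h'.1.1)

variable {X : Type*} [DecidableEq X] {ρ : X → X} {o : X} {p : X → Prop}
  [DecidablePred p]

/-- The extension of a pair of a function and a subset to an invariant function. -/
def symmetrize (ρ : X → X) (o : X) (p : X → Prop) [DecidablePred p] (g : (X → ℕ) × Finset X)
    (x : X) : ℕ :=
  if x = o then 2 * g.1 o + 1 else
    g.1 (if p x then x else ρ x) + if (if p x then x else ρ x) ∈ g.2 then 1 else 0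

theorem symmetrize_self (g : (X → ℕ) × Finset X) : symmetrize ρ o p g o = 2 * g.1 o + 1 :=
  if_pos rfl

theorem symmetrize_of_pos (hpo : ¬p o) (g : (X → ℕ) × Finset X) {x : X} (hx : p x) :
    symmetrize ρ o p g x = g.1 x + if x ∈ g.2 then 1 else 0 := by
  have hxo : x ≠ o := fun h => hpo (h ▸ hx)
  rw [symmetrize, if_neg hxo, if_pos hx]

theorem symmetrize_involution (hρ : ∀ x, ρ (ρ x) = x) (ho : ρ o = o)
    (hp : ∀ x, x ≠ o → (p (ρ x) ↔ ¬p x)) (g : (X → ℕ) × Finset X) (x : X) :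
    symmetrize ρ o p g (ρ x) = symmetrize ρ o p g x := by
  by_cases hx : x = o
  · rw [hx, ho]
  · have hx' : ρ x ≠ o := fun h => hx (by rw [← hρ x, h, ho])
    rw [symmetrize, symmetrize, if_neg hx, if_neg hx']
    by_cases h : p x
    · rw [if_pos h, if_neg fun hh => (hp x hx).1 hh h, hρ]
    · rw [if_neg h, if_pos ((hp x hx).2 h)]

variable [Fintype X]

theorem sum_eq_of_involution (hρ : ∀ x, ρ (ρ x) = x) (ho : ρ o = o) (hpo : ¬p o)
    (hp : ∀ x, x ≠ o → (p (ρ x) ↔ ¬p x)) {f : X → ℕ} (hf : ∀ x, f (ρ x) = f x) :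
    ∑ x, f x = f o + 2 * ∑ x with p x, f x := by
  have h2 : ∑ x with ¬p x, f x = f o + ∑ x with p x, f x := by
    rw [← Finset.add_sum_erase _ _ (Finset.mem_filter.2 ⟨Finset.mem_univ o, hpo⟩)]
    congr 1
    refine Finset.sum_nbij' ρ ρ ?_ ?_ (fun x _ => hρ x) (fun x _ => hρ x) fun x _ => (hf x).symm
    · intro x hx
      simp only [Finset.mem_erase, Finset.mem_filter, Finset.mem_univ, true_and] at hx ⊢
      exact (hp x hx.1).2 hx.2
    · intro x hx
      simp only [Finset.mem_erase, Finset.mem_filter, Finset.mem_univ, true_and] at hx ⊢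
      have hxo : x ≠ o := fun h => hpo (h ▸ hx)
      exact ⟨fun h => hxo (by rw [← hρ x, h, ho]), fun h => (hp x hxo).1 h hx⟩
  rw [← Finset.sum_filter_add_sum_filter_not Finset.univ p, h2]
  omega

theorem card_filter_of_involution (hρ : ∀ x, ρ (ρ x) = x) (ho : ρ o = o) (hpo : ¬p o)
    (hp : ∀ x, x ≠ o → (p (ρ x) ↔ ¬p x)) {r : X → Prop} [DecidablePred r]
    (hr : ∀ x, r (ρ x) ↔ r x) :
    (Finset.univ.filter r).card =
      (if r o then 1 else 0) + 2 * (Finset.univ.filter fun x => p x ∧ r x).card := by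
  rw [Finset.card_filter, sum_eq_of_involution hρ ho hpo hp (fun x => by simp only [hr]),
    ← Finset.card_filter, Finset.filter_filter]

/-- The restriction of an invariant function to one half: the values where `r` holds are recorded
as a subset. -/
def restrict (o : X) (p r : X → Prop) [DecidablePred p] [DecidablePred r] (f : X → ℕ) :
    (X → ℕ) × Finset X :=
  (fun x => if x = o then (f o - 1) / 2 else if p x ∧ ¬r x then f x else 0,
    Finset.univ.filter fun x => (p x ∧ r x) ∧ f x = 1)

/-- The functions invariant under an involution with a single fixed point, with total `2d + 1`, and
with values at most `1` where `r` holds, are counted by their values on one half. -/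
theorem ncard_symmetric (hρ : ∀ x, ρ (ρ x) = x) (ho : ρ o = o) (hpo : ¬p o)
    (hp : ∀ x, x ≠ o → (p (ρ x) ↔ ¬p x)) {r : X → Prop} [DecidablePred r]
    (hr : ∀ x, r (ρ x) ↔ r x) (hro : ¬r o) (d : ℕ) :
    {f : X → ℕ | ∑ x, f x = 2 * d + 1 ∧ (∀ x, f (ρ x) = f x) ∧
        ∀ x, r x → f x = 0 ∨ f x = 1}.ncard =
      (sumAndSubset (insert o (Finset.univ.filter fun x => p x ∧ ¬r x))
        (Finset.univ.filter fun x => p x ∧ r x) d).card := by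
  have hno : o ∉ Finset.univ.filter fun x => p x ∧ ¬r x := by simp [hpo]
  have hne : ∀ {x}, p x → x ≠ o := fun hx h => hpo (h ▸ hx)
  have hsplit : ∀ f : X → ℕ, ∑ x with p x, f x =
      ∑ x with p x ∧ ¬r x, f x + ∑ x with p x ∧ r x, f x := fun f => by
    rw [← Finset.sum_filter_add_sum_filter_not (Finset.univ.filter p) r, Finset.filter_filter,
      Finset.filter_filter, add_comm]
  -- Points other than `o` come in pairs, so an odd total makes `f o` odd and the halving loses
  -- nothing.
  have hodd : ∀ f : X → ℕ, ∑ x, f x = 2 * d + 1 → (∀ x, f (ρ x) = f x) →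
      2 * ((f o - 1) / 2) + 1 = f o ∧ (f o - 1) / 2 + ∑ x with p x, f x = d := by
    intro f h1 h2
    rw [sum_eq_of_involution hρ ho hpo hp h2] at h1
    omega
  rw [← Set.ncard_coe_finset]
  refine (Set.InvOn.bijOn (f := restrict o p r) (f' := symmetrize ρ o p)
    ⟨?_, ?_⟩ ?_ ?_).ncard_eq
  · rintro f ⟨h1, h2, h3⟩
    have key : ∀ x, p x → symmetrize ρ o p (restrict o p r f) x = f x := by
      intro x hx
      rw [symmetrize_of_pos hpo _ hx]
      simp only [restrict, if_neg (hne hx), Finset.mem_filter, Finset.mem_univ, true_and, hx]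
      by_cases hrx : r x
      · rcases h3 x hrx with h | h <;> simp [hrx, h]
      · simp [hrx]
    funext x
    by_cases hxo : x = o
    · rw [hxo, symmetrize_self]
      simp only [restrict, if_true]
      exact (hodd f h1 h2).1
    · by_cases hx : p x
      · exact key x hx
      · rw [← symmetrize_involution hρ ho hp, ← h2]
        exact key _ ((hp x hxo).2 hx)
  · rintro ⟨f, S⟩ hg
    obtain ⟨-, h2, h3⟩ := mem_sumAndSubset.1 (Finset.mem_coe.1 hg)
    have hS : ∀ x ∈ S, p x ∧ r x := fun x hx => (Finset.mem_filter.1 (h3 hx)).2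
    have hf : ∀ x, f x ≠ 0 → x = o ∨ p x ∧ ¬r x := fun x hx => by simpa using h2 x hx
    refine Prod.ext (funext fun x => ?_) (Finset.ext fun x => ?_)
    · change (if x = o then (symmetrize ρ o p (f, S) o - 1) / 2 else
        if p x ∧ ¬r x then symmetrize ρ o p (f, S) x else 0) = f x
      split_ifs with hxo hx
      · rw [symmetrize_self, hxo]
        change (2 * f o + 1 - 1) / 2 = f o
        omega
      · rw [symmetrize_of_pos hpo _ hx.1, if_neg fun h => hx.2 (hS x h).2]
        rfl
      · by_contra hc
        exact (hf x (Ne.symm hc)).elim hxo hx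
    · simp only [restrict, Finset.mem_filter, Finset.mem_univ, true_and]
      constructor
      · rintro ⟨⟨hx, hrx⟩, h⟩
        rw [symmetrize_of_pos hpo _ hx] at h
        by_contra hc
        have h0 : f x = 0 := by
          by_contra h0
          exact (hf x h0).elim (hne hx) fun hh => hh.2 hrx
        simp [hc, h0] at h
      · intro hx
        obtain ⟨hpx, hrx⟩ := hS x hx
        have h0 : f x = 0 := by
          by_contra h0
          exact (hf x h0).elim (hne hpx) fun hh => hh.2 hrx
        refine ⟨⟨hpx, hrx⟩, ?_⟩
        rw [symmetrize_of_pos hpo _ hpx, if_pos hx]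
        exact congrArg (· + 1) h0
  · rintro f ⟨h1, h2, h3⟩
    rw [Finset.mem_coe, mem_sumAndSubset]
    refine ⟨?_, fun x hx => ?_, ?_⟩
    · have h4 := (hodd f h1 h2).2
      rw [hsplit] at h4
      have e1 : ∑ x with p x ∧ ¬r x, (restrict o p r f).1 x = ∑ x with p x ∧ ¬r x, f x :=
        Finset.sum_congr rfl fun x hx => by
          have hx := (Finset.mem_filter.1 hx).2
          simp only [restrict, if_neg (hne hx.1), if_pos hx]
      have e2 : (restrict o p r f).2.card = ∑ x with p x ∧ r x, f x := by
        simp only [restrict]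
        rw [← Finset.filter_filter, Finset.card_filter]
        refine Finset.sum_congr rfl fun x hx => ?_
        rcases h3 x (Finset.mem_filter.1 hx).2.2 with h | h <;> rw [h] <;> rfl
      have e3 : (restrict o p r f).1 o = (f o - 1) / 2 := if_pos rfl
      rw [Finset.sum_insert hno, e1, e2, e3]
      omega
    · by_contra hc
      simp only [Finset.mem_insert, Finset.mem_filter, Finset.mem_univ, true_and, not_or] at hc
      exact hx (by simp only [restrict]; rw [if_neg hc.1, if_neg hc.2])
    · intro x hx
      simp only [restrict, Finset.mem_filter, Finset.mem_univ, true_and] at hx ⊢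
      exact hx.1
  · rintro ⟨f, S⟩ hg
    obtain ⟨h1, h2, h3⟩ := mem_sumAndSubset.1 (Finset.mem_coe.1 hg)
    dsimp only at h1 h2 h3
    have hS : ∀ x ∈ S, p x ∧ r x := fun x hx => (Finset.mem_filter.1 (h3 hx)).2
    have hf : ∀ x, p x → r x → f x = 0 := fun x hx hrx => by
      by_contra h0
      have := h2 x h0
      simp [hne hx, hrx] at this
    have hsym := symmetrize_involution hρ ho hp (f, S)
    refine ⟨?_, hsym, ?_⟩
    · have e1 : ∑ x with p x ∧ ¬r x, symmetrize ρ o p (f, S) x = ∑ x with p x ∧ ¬r x, f x :=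
        Finset.sum_congr rfl fun x hx => by
          have hx := (Finset.mem_filter.1 hx).2
          rw [symmetrize_of_pos hpo _ hx.1, if_neg fun h => hx.2 (hS x h).2]
          rfl
      have e2 : ∑ x with p x ∧ r x, symmetrize ρ o p (f, S) x = S.card := by
        rw [← Finset.inter_eq_right.2 h3, ← Finset.filter_mem_eq_inter, Finset.card_filter]
        refine Finset.sum_congr rfl fun x hx => ?_
        have hx := (Finset.mem_filter.1 hx).2
        rw [symmetrize_of_pos hpo _ hx.1]
        dsimp only
        rw [hf x hx.1 hx.2, zero_add]
        simp [hx]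
      rw [sum_eq_of_involution hρ ho hpo hp hsym, hsplit, e1, e2, symmetrize_self]
      rw [Finset.sum_insert hno] at h1
      dsimp only
      omega
    · have key : ∀ x, p x → r x → symmetrize ρ o p (f, S) x = 0 ∨ symmetrize ρ o p (f, S) x = 1 := by
        intro x hx hrx
        rw [symmetrize_of_pos hpo _ hx]
        dsimp only
        rw [hf x hx hrx]
        split_ifs <;> simp
      intro x hrx
      by_cases hx : p x
      · exact key x hx hrx
      · rw [← hsym]
        exact key _ ((hp x fun h => hro (h ▸ hrx)).2 hx) ((hr x).2 hrx)

/-! ### Positions of a matrix sorted by parity -/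

variable (m n : ℕ)

open Classical in
theorem card_not_isOdd :
    (Finset.univ.filter fun i : Seg (m + n) => ¬IsOdd m i).card = 2 * m + 1 := by
  rw [card_eq_of_neg_mem, Finset.filter_filter]
  · congr 2
    refine Eq.trans ?_ (card_pos_le (d := m + n) (t := m) (Nat.le_add_right m n))
    congr 1
    ext x
    simp only [Finset.mem_filter, Finset.mem_univ, true_and]
    rw [IsOdd]
    constructor
    · rintro ⟨h1, h2⟩
      rw [abs_of_pos h2] at h1
      omega
    · rintro ⟨h1, h2⟩
      rw [abs_of_pos h1]
      omega
  · simp [isOdd_neg]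
  · simp [IsOdd, zeroIdx]

open Classical in
theorem card_isOdd : (Finset.univ.filter fun i : Seg (m + n) => IsOdd m i).card = 2 * n := by
  have h := Finset.card_filter_add_card_filter_not (s := Finset.univ)
    fun i : Seg (m + n) => IsOdd m i
  rw [card_not_isOdd, Finset.card_univ, card_seg] at h
  omega

theorem card_mixed : (Finset.univ.filter fun z : Seg (m + n) × Seg (m + n) =>
    parity m z.1 ≠ parity m z.2).card = 2 * (4 * m * n + 2 * n) := by
  classical
  have h : (Finset.univ.filter fun z : Seg (m + n) × Seg (m + n) =>
      parity m z.1 ≠ parity m z.2) =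
      (Finset.univ.filter fun i => IsOdd m i) ×ˢ (Finset.univ.filter fun i => ¬IsOdd m i) ∪
      (Finset.univ.filter fun i => ¬IsOdd m i) ×ˢ (Finset.univ.filter fun i => IsOdd m i) := by
    ext z
    simp only [Finset.mem_filter, Finset.mem_univ, true_and, Finset.mem_union, Finset.mem_product,
      parity_ne_iff]
    tauto
  rw [h, Finset.card_union_of_disjoint, Finset.card_product, Finset.card_product, card_isOdd,
    card_not_isOdd]
  · ring
  · rw [Finset.disjoint_left]
    intro z h1 h2
    exact (Finset.mem_filter.1 (Finset.mem_product.1 h2).1).2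
      (Finset.mem_filter.1 (Finset.mem_product.1 h1).1).2

theorem ncard_Xi (d : ℕ) : (Xi m n d).ncard = ∑ k ∈ Finset.range (d + 1),
    Nat.choose (2 * m ^ 2 + 2 * n ^ 2 + 2 * m + k) k * Nat.choose (4 * m * n + 2 * n) (d - k) := by
  classical
  let o : Seg (m + n) × Seg (m + n) := (zeroIdx _, zeroIdx _)
  let ρ : Seg (m + n) × Seg (m + n) → Seg (m + n) × Seg (m + n) := fun z => (neg z.1, neg z.2)
  -- The positions lexicographically above the centre form one half: the point reflection exchanges
  -- them with those below.
  let p : Seg (m + n) × Seg (m + n) → Prop := fun z => 0 < z.1.1 ∨ z.1.1 = 0 ∧ 0 < z.2.1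
  let r : Seg (m + n) × Seg (m + n) → Prop := fun z => parity m z.1 ≠ parity m z.2
  have hρ : ∀ z, ρ (ρ z) = z := fun z => Prod.ext (neg_neg' _) (neg_neg' _)
  have ho : ρ o = o := rfl
  have hpo : ¬p o := by simp [p, o, zeroIdx]
  have hp : ∀ z, z ≠ o → (p (ρ z) ↔ ¬p z) := by
    rintro ⟨i, j⟩ hz
    have : ¬(i.1 = 0 ∧ j.1 = 0) := fun h => hz (Prod.ext (Subtype.ext h.1) (Subtype.ext h.2))
    simp only [p, ρ, neg_val]
    omega
  have hr : ∀ z, r (ρ z) ↔ r z := fun z => by simp only [r, ρ, parity, neg_val, abs_neg]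
  have hro : ¬r o := by simp [r, o]
  have key := ncard_symmetric hρ ho hpo hp hr hro d
  have hc1 := card_filter_of_involution hρ ho hpo hp hr
  have hc2 := card_filter_of_involution hρ ho hpo hp (r := fun z => ¬r z) fun z => not_congr (hr z)
  have hmix : (Finset.univ.filter r).card = _ := card_mixed m n
  have htot := Finset.card_filter_add_card_filter_not (s := Finset.univ) r
  rw [Finset.card_univ, Fintype.card_prod, card_seg, hmix] at htot
  rw [if_neg hro, hmix] at hc1
  rw [if_pos hro] at hc2
  have hXi : (Xi m n d).ncard = {f : Seg (m + n) × Seg (m + n) → ℕ | ∑ z, f z = 2 * d + 1 ∧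
      (∀ z, f (ρ z) = f z) ∧ ∀ z, r z → f z = 0 ∨ f z = 1}.ncard := by
    refine (Set.InvOn.bijOn (f := fun A z => A z.1 z.2) (f' := fun f i j => f (i, j))
      ⟨fun _ _ => rfl, fun _ _ => rfl⟩ ?_ ?_).ncard_eq
    · rintro A ⟨h1, h2, h3⟩
      exact ⟨(Fintype.sum_prod_type _).trans h1, fun z => h2 _ _, fun z => h3 _ _⟩
    · rintro f ⟨h1, h2, h3⟩
      exact ⟨(Fintype.sum_prod_type _).symm.trans h1, fun i j => h2 (i, j), fun i j => h3 (i, j)⟩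
  rw [hXi, key, card_sumAndSubset, Finset.card_insert_of_notMem (by simp [hpo])]
  have hO : (Finset.univ.filter fun z => p z ∧ r z).card = 4 * m * n + 2 * n := by omega
  have hE : (Finset.univ.filter fun z => p z ∧ ¬r z).card = 2 * m ^ 2 + 2 * n ^ 2 + 2 * m := by
    rw [hc2] at htot
    nlinarith
  rw [hO, hE]
  -- The central position adds one to the number of unrestricted positions, which cancels the `- 1`
  -- of stars and bars.
  refine Finset.sum_congr rfl fun k _ => ?_
  congr 2
  omega

end Counting

end IotaSchur

end

/-- The elements `e_A` are well defined (every `A ∈ Ξ_{m|n,d}` is `κ(μ, g, ν)` for exactly one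
triple, and there is an endomorphism `φ_{μν}^g` as described, which `e_A` is), they form a basis, and
the rank is as stated. -/
theorem lemma2p7 (m n d : ℕ) (hd : d ≠ 0) :
    Set.BijOn
        (fun t : IotaSchur.Comp m n d × IotaSchur.W d × IotaSchur.Comp m n d =>
          IotaSchur.kappa t.1 t.2.1 t.2.2)
        {t | t.2.1 ∈ IotaSchur.minDoubleCirc t.1 t.2.2} (IotaSchur.Xi m n d) ∧
    (∀ (A : IotaSchur.Xi m n d) (μ : IotaSchur.Comp m n d) (g : IotaSchur.W d)
        (ν : IotaSchur.Comp m n d), g ∈ IotaSchur.minDoubleCirc μ ν →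
        IotaSchur.kappa μ g ν = A.1 → IotaSchur.IsPhi μ g ν (IotaSchur.e A)) ∧
    (∃ b : Module.Basis (IotaSchur.Xi m n d) IotaSchur.LaurentA (IotaSchur.SchurJ m n d),
        ∀ A, b A = IotaSchur.e A) ∧
    Module.rank IotaSchur.LaurentA (IotaSchur.SchurJ m n d) =
      ((∑ k ∈ Finset.range (d + 1),
        Nat.choose (2 * m ^ 2 + 2 * n ^ 2 + 2 * m + k) k *
          Nat.choose (4 * m * n + 2 * n) (d - k) : ℕ) : Cardinal) := by
  obtain ⟨b, hb⟩ := IotaSchur.exists_basis m n d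
  have _ := Fintype.ofFinite (IotaSchur.Xi m n d)
  refine ⟨IotaSchur.kappa_bijOn m n d, IotaSchur.isPhi_e, ⟨b, hb⟩, ?_⟩
  rw [rank_eq_card_basis b, ← IotaSchur.ncard_Xi, ← Nat.card_coe_set_eq, Nat.card_eq_fintype_card]
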